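/- Let $Ca,We>0$, $\gamma,\gamma_0>1$ be constants, and put $$f(R)=\Big[\big(1+\tfrac{2}{Ca}\tfrac{2}{We}\big)R^{-3\gamma_0}-\tfrac{2}{Ca}\tfrac{2}{We}R^{-1}\Big]^{-1/\gamma}-1\quad (0<R<\overline R),\qquad \overline R=\Big(1+\tfrac{Ca}{2}\tfrac{We}{2}\Big)^{\frac1{3\gamma_0-1}},$$ and $\xi(x)=(1+3x)^{1/3}$. For $T>0$ let $(u,q,R)$ be a classical solution on $[0,\infty)\times[0,T]$ of the spherically symmetric isentropic Euler equations in Lagrangian mass coordinates, $$\partial_tq=\partial_x(r^2u),\quad \partial_tu=c^2r^2\partial_xq,\quad \frac{dR}{dt}=u|_{x=0},\quad r=\Big(R(t)^3+3x+3\int_0^xq(y,t)\,dy\Big)^{1/3},$$ with $\rho=(1+q)^{-1}$, $c=\big(\tfrac{Ca\,\gamma}{2}\rho^{\gamma+1}\big)^{1/2}$, where $0<R(t)<\overline R$ and $u,q$ are $C^2$ up to the boundary of $[0,\infty)\times[0,T]$. No boundary condition relating $q|_{x=0}$ to $R$ is imposed. Let $\varphi$ be the velocity potential, i.e. $\rho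 r^2\partial_x\varphi=u$ and $\varphi(x,t)\to0$ as $x\to\infty$, which is a classical ($C^3$ up to the boundary) solution on $[0,\infty)\times[0,T]$ of the quasilinear wave equation $$\partial_t^2\varphi-c^2\partial_x(r^4\partial_x\varphi)=0 .$$ Put, for $j=0,1,2$, $$e^j(t)=\tfrac12\int_0^\infty\big((\partial_t^ju)^2+c^2(\partial_t^jq)^2\big)dx+\tfrac12c^2|_{x=0}\,f'(R(t))^{-1}\big(\partial_t^jf(R)(t)\big)^2 .$$ For every $\tilde B>0$ there are constants $\epsilon_0,\kappa_0,C>0$, depending only on $\tilde B,Ca,We,\gamma,\gamma_0$, such that the following holds for all such $T$, $(u,q,R)$, $\varphi$ and all $\epsilon\in(0,\epsilon_0]$. Assume that on $[0,T]$ $$\sum_{j=0}^2e^j(t)\le4\sum_{j=0}^2e^j(0)\le4\tilde B\epsilon^2,\qquad -\tfrac12\le q(x,t)\le\tfrac12\ (x>0),\qquad -\tfrac12\le f(R(t))\le\tfrac12,$$ and that $1+\overline c\,T\le\exp(\kappa_0/\epsilon)$ for some upper bound $\overline c$ of $c\,r^2\xi^{-2}$ on $[0,\infty)\times[0,T]$.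 Then $$\begin{aligned} &\sum_{j=0}^2\Big\{\int_0^T\!\!\int_0^\infty\xi^{-1}\Big((\partial_t^{1+j}\varphi)^2+(cr^2\partial_x\partial_t^j\varphi)^2\Big)dx\,dt+\int_0^T\!\!\int_0^\infty\xi^{-3}(\partial_t^j\varphi)^2dx\,dt\\ &\qquad+\int_0^T(\partial_t^{1+j}\varphi)^2\big|_{x=0}dt+\int_0^T\Big(cr^2\partial_x\partial_t^j\varphi+\frac{c}{\rho r}\partial_t^j\varphi\Big)^2\Big|_{x=0}dt\Big\}\\ &\le C\Big[\max\{\log_2T,1\}\sum_{j=0}^2\sup_{0\le t\le T}\int_0^\infty\Big((\partial_t^{1+j}\varphi)^2+(cr^2\partial_x\partial_t^j\varphi)^2\Big)dx+\int_0^T\varphi^2|_{x=0}\,dt\Big], \end{aligned}$$ and the right-hand side is finite. -/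

import Mathlib

open Set Filter Topology MeasureTheory
open scoped ENNReal

noncomputable section

namespace Bubble

/-- Physical constants: cavitation number, Weber number, and the adiabatic exponents of the liquid
(`γ`) and of the gas (`γ₀`). -/
structure Params where
  Ca : ℝ
  We : ℝ
  γ : ℝ
  γ₀ : ℝ
  Ca_pos : 0 < Ca
  We_pos : 0 < We
  one_lt_γ : 1 < γ
  one_lt_γ₀ : 1 < γ₀

/-- The radius function `ξ(x) = (1 + 3x)^{1/3}` of the equilibrium. -/
def xi (x : ℝ) : ℝ := (1 + 3 * x) ^ (1 / 3 : ℝ)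

/-- `∂_t^j g (x, t)`, for functions on `[0, ∞) × [0, T]` (one-sided at `t = 0` and `t = T`). -/
def dt (T : ℝ) (j : ℕ) (g : ℝ → ℝ → ℝ) (x t : ℝ) : ℝ :=
  iteratedDerivWithin j (fun s => g x s) (Icc 0 T) t

/-- `∂_x g (x, t)`, for functions on `[0, ∞) × [0, T]` (one-sided at `x = 0`). -/
def dx (g : ℝ → ℝ → ℝ) (x t : ℝ) : ℝ :=
  derivWithin (fun y => g y t) (Ici 0) x

/-- `f(R) = [(1 + (2/Ca)(2/We)) R^{-3γ₀} - (2/Ca)(2/We) R^{-1}]^{-1/γ} - 1`. -/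
def Params.f (P : Params) (R : ℝ) : ℝ :=
  ((1 + 2 / P.Ca * (2 / P.We)) * R ^ (-3 * P.γ₀) - 2 / P.Ca * (2 / P.We) * R ^ (-1 : ℝ))
    ^ (-1 / P.γ) - 1

/-- The right end point of the interval `(0, Rbar)` on which `f` is smooth and increasing. -/
def Params.Rbar (P : Params) : ℝ :=
  (1 + P.Ca / 2 * (P.We / 2)) ^ (1 / (3 * P.γ₀ - 1))

/-- The density `ρ = (1 + q)⁻¹`. -/
def rho (q : ℝ → ℝ → ℝ) (x t : ℝ) : ℝ := (1 + q x t)⁻¹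

/-- The specific sound speed `c = (Ca γ / 2 · ρ^{γ+1})^{1/2}`. -/
def Params.c (P : Params) (q : ℝ → ℝ → ℝ) (x t : ℝ) : ℝ :=
  Real.sqrt (P.Ca * P.γ / 2 * rho q x t ^ (P.γ + 1))

/-- The Eulerian radius `r = (R(t)³ + 3x + 3 ∫_0^x q dy)^{1/3}` of the particle with label `x`. -/
def rad (q : ℝ → ℝ → ℝ) (R : ℝ → ℝ) (x t : ℝ) : ℝ :=
  (R t ^ 3 + 3 * x + 3 * ∫ y in (0 : ℝ)..x, q y t) ^ (1 / 3 : ℝ)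

/-- Classical solutions `(u, q, R)` on `[0, ∞) × [0, T]` of the Euler equations in Lagrangian mass
coordinates, where `R` is the radius of the inner surface `x = 0`, which moves with the fluid.
No pressure balance (no boundary condition for `q`) is imposed at `x = 0`. -/
structure IsEulerFlow (P : Params) (T : ℝ) (u q : ℝ → ℝ → ℝ) (R : ℝ → ℝ) : Prop where
  smooth_u : ContDiffOn ℝ 2 (fun z : ℝ × ℝ => u z.1 z.2) (Ici 0 ×ˢ Icc 0 T)
  smooth_q : ContDiffOn ℝ 2 (fun z : ℝ × ℝ => q z.1 z.2) (Ici 0 ×ˢ Icc 0 T)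
  R_mem : ∀ t ∈ Icc 0 T, R t ∈ Ioo 0 P.Rbar
  kinematic : ∀ t ∈ Icc 0 T, HasDerivWithinAt R (u 0 t) (Icc 0 T) t
  continuity : ∀ x ∈ Ioi (0 : ℝ), ∀ t ∈ Ioo 0 T,
    dt T 1 q x t = dx (fun y s => rad q R y s ^ 2 * u y s) x t
  momentum : ∀ x ∈ Ioi (0 : ℝ), ∀ t ∈ Ioo 0 T,
    dt T 1 u x t = P.c q x t ^ 2 * rad q R x t ^ 2 * dx q x t

/-- `φ` is the velocity potential of the flow: `ρ r² ∂_x φ = u` and `φ = 0` at infinity. -/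
structure IsVelocityPotential (T : ℝ) (u q : ℝ → ℝ → ℝ) (R : ℝ → ℝ) (φ : ℝ → ℝ → ℝ) : Prop where
  velocity : ∀ x ∈ Ioi (0 : ℝ), ∀ t ∈ Icc 0 T, rho q x t * rad q R x t ^ 2 * dx φ x t = u x t
  tendsto_zero : ∀ t ∈ Icc 0 T, Tendsto (fun x => φ x t) atTop (𝓝 0)

/-- `φ` is a classical solution of `∂_t² φ - c² ∂_x (r⁴ ∂_x φ) = 0` on `[0, ∞) × [0, T]`. -/
structure SolvesWave (P : Params) (T : ℝ) (q : ℝ → ℝ → ℝ) (R : ℝ → ℝ) (φ : ℝ → ℝ → ℝ) :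
    Prop where
  smooth : ContDiffOn ℝ 3 (fun z : ℝ × ℝ => φ z.1 z.2) (Ici 0 ×ˢ Icc 0 T)
  wave : ∀ x ∈ Ioi (0 : ℝ), ∀ t ∈ Ioo 0 T,
    dt T 2 φ x t - P.c q x t ^ 2 * dx (fun y s => rad q R y s ^ 4 * dx φ y s) x t = 0

/-- The energy `e^j(t) = ½ ∫ ((∂_t^j u)² + c² (∂_t^j q)²) dx + ½ c²|_{x=0} f'(R)⁻¹ (∂_t^j f(R))²`,
with values in `[0, ∞]`. -/
def energy (P : Params) (T : ℝ) (u q : ℝ → ℝ → ℝ) (R : ℝ → ℝ) (j : ℕ) (t : ℝ) : ℝ≥0∞ :=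
  (∫⁻ x in Ioi (0 : ℝ),
      ENNReal.ofReal (1 / 2 * (dt T j u x t ^ 2 + P.c q x t ^ 2 * dt T j q x t ^ 2)))
    + ENNReal.ofReal (1 / 2 * P.c q 0 t ^ 2 * (deriv P.f (R t))⁻¹
        * iteratedDerivWithin j (fun s => P.f (R s)) (Icc 0 T) t ^ 2)

/-- The bootstrap bounds on `[0, T]`: an energy bound with constants `B`, `ε`, and pointwise bounds
on `q` and on `f(R)` (the latter is the former at `x = 0` when the pressure balance `q = f(R)`
holds there). -/
structure Bootstrap (P : Params) (T B ε : ℝ) (u q : ℝ → ℝ → ℝ) (R : ℝ → ℝ) : Prop where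
  energy_le : ∀ t ∈ Icc 0 T, ∑ j ∈ Finset.range 3, energy P T u q R j t
    ≤ 4 * ∑ j ∈ Finset.range 3, energy P T u q R j 0
  energy_init_le : 4 * ∑ j ∈ Finset.range 3, energy P T u q R j 0 ≤ ENNReal.ofReal (4 * B * ε ^ 2)
  q_mem : ∀ x ∈ Ioi (0 : ℝ), ∀ t ∈ Icc 0 T, q x t ∈ Icc (-1 / 2 : ℝ) (1 / 2)
  f_mem : ∀ t ∈ Icc 0 T, P.f (R t) ∈ Icc (-1 / 2 : ℝ) (1 / 2)

/-- `c r² ∂_x ∂_t^j φ`. -/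
def flux (P : Params) (T : ℝ) (q : ℝ → ℝ → ℝ) (R : ℝ → ℝ) (φ : ℝ → ℝ → ℝ) (j : ℕ) (x t : ℝ) : ℝ :=
  P.c q x t * rad q R x t ^ 2 * dx (dt T j φ) x t

/-- The density `(∂_t^{1+j} φ)² + (c r² ∂_x ∂_t^j φ)²`. -/
def density (P : Params) (T : ℝ) (q : ℝ → ℝ → ℝ) (R : ℝ → ℝ) (φ : ℝ → ℝ → ℝ) (j : ℕ)
    (x t : ℝ) : ℝ :=
  dt T (1 + j) φ x t ^ 2 + flux P T q R φ j x t ^ 2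

/-- The `j`-th weighted space-time norm together with the `j`-th boundary traces. -/
def kssNorm (P : Params) (T : ℝ) (q : ℝ → ℝ → ℝ) (R : ℝ → ℝ) (φ : ℝ → ℝ → ℝ) (j : ℕ) : ℝ≥0∞ :=
  (∫⁻ t in Icc 0 T, ∫⁻ x in Ioi (0 : ℝ), ENNReal.ofReal ((xi x)⁻¹ * density P T q R φ j x t))
  + (∫⁻ t in Icc 0 T, ∫⁻ x in Ioi (0 : ℝ), ENNReal.ofReal ((xi x ^ 3)⁻¹ * dt T j φ x t ^ 2))
  + (∫⁻ t in Icc 0 T, ENNReal.ofReal (dt T (1 + j) φ 0 t ^ 2))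
  + (∫⁻ t in Icc 0 T, ENNReal.ofReal
      ((flux P T q R φ j 0 t + P.c q 0 t / (rho q 0 t * rad q R 0 t) * dt T j φ 0 t) ^ 2))

/-- `max_{0 ≤ t ≤ T} ∫ ((∂_t^{1+j} φ)² + (c r² ∂_x ∂_t^j φ)²) dx`. -/
def supEnergy (P : Params) (T : ℝ) (q : ℝ → ℝ → ℝ) (R : ℝ → ℝ) (φ : ℝ → ℝ → ℝ) (j : ℕ) : ℝ≥0∞ :=
  ⨆ t ∈ Icc 0 T, ∫⁻ x in Ioi (0 : ℝ), ENNReal.ofReal (density P T q R φ j x t)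

/-- `max {log₂ T, 1} ∑_{j ≤ 2} (sup-in-time energy) + ∫_0^T φ²|_{x=0} dt`. -/
def kssBound (P : Params) (T : ℝ) (q : ℝ → ℝ → ℝ) (R : ℝ → ℝ) (φ : ℝ → ℝ → ℝ) : ℝ≥0∞ :=
  ENNReal.ofReal (max (Real.logb 2 T) 1) * ∑ j ∈ Finset.range 3, supEnergy P T q R φ j
    + ∫⁻ t in Icc 0 T, ENNReal.ofReal (φ 0 t ^ 2)

end Bubble

end

/-! In the Eulerian radius the equation is a perturbation of the radial wave equation, so `w = r φ`
nearly solves a one-dimensional wave equation. The classical multiplier for it is `g ∂_r w` with an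
increasing weight `g`. In mass coordinates this amounts to pairing `∂_t v` with `r ∂_x (r v)`
(`radial`), and `multiplierIdentity` is the resulting exact identity: a time-boundary term equals a
flux at `x = X`, minus a flux at `x = 0`, minus a space-time integral weighted by `g'`, plus errors.
The flux at `x = 0` has a sign and contains exactly the two boundary traces to be estimated.

The weight is chosen so that `dg/dξ = 1/ξ - 1/(τ + ξ)` with `τ = 1 + T`. It lies between `1` and `1
+ log (1 + τ)`, which is where the logarithm comes from. Since `g' r²` is comparable to `1/ξ` up to
a loss of `1/τ`, and this loss integrated over time `T ≤ τ` costs only one energy, no dyadic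
decomposition is needed (`exists_weighted_le`).

Every error term carries a coefficient of size `ε/ξ`: bounded energy of order two forces `u, ∂_t u,
q, ∂_t q = O(ε/ξ)` (`exists_pointBound`), and space derivatives are traded for time derivatives
through the equations. The functions `∂_t φ` and `∂_t² φ` solve the same wave equation with
quadratic sources `F₁`, `F₂`. The only factor in them without pointwise decay is `∂_t² q`, and
`exists_abs_qtt_le` recovers it from the derivatives of `φ`. All errors are thus at most `C ε log (2
+ T)` times the quantity to be estimated. The restriction to exponentially long times makes this
factor small, and the errors are absorbed level by level (`absorb_three`).

The multiplier controls `r ∂_x (r v)` only. Hardy's inequality (`hardy`) separates `r² ∂_x v` from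
`v/ξ` at the price of the trace `v(0, t)²`. For `v = ∂_t φ` and `v = ∂_t² φ` that trace is already
part of the estimate one level below, so only the trace of `φ` itself remains on the right.

Two limits have to be justified. The identity is used on `[0, X]`, and the flux at `X` tends to zero
along a sequence because it is integrable against `ξ⁻² dx`, a measure of infinite mass
(`exists_totalFlux_le`). This needs the wave energies and `φ/ξ` in `L²`, which follow from
Bernoulli's law (`bernoulli`, `exists_waveBound`) and a Hardy inequality at infinity
(`integral_div_wt_sq_le`). Moreover a `C³` potential is one derivative short for the identity at the
level `∂_t² φ`. There it is proved for difference quotients of `∂_t φ` and passed to the limit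
(`multiplierIdentity_φtt`). -/

noncomputable section

namespace Bubble

/-! ### Calculus on the closed strip `[0, ∞) × [0, T]` -/

/-- The closed strip `[0, ∞) × [0, T]`. -/
def strip (T : ℝ) : Set (ℝ × ℝ) := Ici 0 ×ˢ Icc 0 T

theorem mem_strip {T x t : ℝ} : (x, t) ∈ strip T ↔ 0 ≤ x ∧ t ∈ Icc 0 T := Iff.rfl

theorem uniqueDiffOn_strip {T : ℝ} (hT : 0 < T) : UniqueDiffOn ℝ (strip T) :=
  (uniqueDiffOn_Ici 0).prod (uniqueDiffOn_Icc hT)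

theorem interior_strip (T : ℝ) : interior (strip T) = Ioi 0 ×ˢ Ioo 0 T := by
  rw [strip, interior_prod_eq, interior_Ici, interior_Icc]

theorem strip_subset_closure_interior {T : ℝ} (hT : 0 < T) :
    strip T ⊆ closure (Ioi (0 : ℝ) ×ˢ Ioo 0 T) := by
  rw [closure_prod_eq, closure_Ioi, closure_Ioo hT.ne]; exact subset_rfl

/-- Two functions that are continuous on the closed strip and agree in its interior are equal. -/
theorem eqOn_strip {T : ℝ} (hT : 0 < T) {f g : ℝ → ℝ → ℝ}
    (hf : ContinuousOn (fun z : ℝ × ℝ => f z.1 z.2) (strip T))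
    (hg : ContinuousOn (fun z : ℝ × ℝ => g z.1 z.2) (strip T))
    (h : ∀ x ∈ Ioi (0 : ℝ), ∀ t ∈ Ioo 0 T, f x t = g x t) {x t : ℝ} (hx : 0 ≤ x)
    (ht : t ∈ Icc 0 T) : f x t = g x t :=
  Set.EqOn.of_subset_closure (s := Ioi (0 : ℝ) ×ˢ Ioo 0 T) (fun z hz => h z.1 hz.1 z.2 hz.2) hf hg
    (prod_mono Ioi_subset_Ici_self Ioo_subset_Icc_self) (strip_subset_closure_interior hT)
    (mem_strip.2 ⟨hx, ht⟩)

section Partial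

variable {T : ℝ} {g : ℝ → ℝ → ℝ} {x t : ℝ}

theorem hasDerivWithinAt_fderivWithin_snd
    (hg : DifferentiableOn ℝ (fun z : ℝ × ℝ => g z.1 z.2) (strip T)) (hx : 0 ≤ x)
    (ht : t ∈ Icc 0 T) :
    HasDerivWithinAt (fun s => g x s)
      (fderivWithin ℝ (fun z : ℝ × ℝ => g z.1 z.2) (strip T) (x, t) (0, 1)) (Icc 0 T) t := by
  have h := (hg (x, t) (mem_strip.2 ⟨hx, ht⟩)).hasFDerivWithinAt
  have h2 : HasDerivWithinAt (fun s : ℝ => (x, s)) ((0 : ℝ), (1 : ℝ)) (Icc 0 T) t :=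
    (hasDerivWithinAt_const t _ x).prodMk (hasDerivWithinAt_id t _)
  exact h.comp_hasDerivWithinAt t h2 (fun s hs => mem_strip.2 ⟨hx, hs⟩)

theorem hasDerivWithinAt_fderivWithin_fst
    (hg : DifferentiableOn ℝ (fun z : ℝ × ℝ => g z.1 z.2) (strip T)) (hx : 0 ≤ x)
    (ht : t ∈ Icc 0 T) :
    HasDerivWithinAt (fun y => g y t)
      (fderivWithin ℝ (fun z : ℝ × ℝ => g z.1 z.2) (strip T) (x, t) (1, 0)) (Ici 0) x := by
  have h := (hg (x, t) (mem_strip.2 ⟨hx, ht⟩)).hasFDerivWithinAt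
  have h2 : HasDerivWithinAt (fun y : ℝ => (y, t)) ((1 : ℝ), (0 : ℝ)) (Ici 0) x :=
    (hasDerivWithinAt_id x _).prodMk (hasDerivWithinAt_const x _ t)
  exact h.comp_hasDerivWithinAt x h2 (fun s hs => mem_strip.2 ⟨hs, ht⟩)

theorem dt_one : dt T 1 g x t = derivWithin (fun s => g x s) (Icc 0 T) t := by
  rw [dt, iteratedDerivWithin_one]

theorem dt_zero (g : ℝ → ℝ → ℝ) : dt T 0 g = g := by
  funext x t; rw [dt, iteratedDerivWithin_zero]

theorem dt_succ (j : ℕ) (g : ℝ → ℝ → ℝ) : dt T (j + 1) g = dt T 1 (dt T j g) := by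
  funext x t; rw [dt_one, dt, iteratedDerivWithin_succ]; rfl

theorem dt_one_eq_fderivWithin (hT : 0 < T)
    (hg : DifferentiableOn ℝ (fun z : ℝ × ℝ => g z.1 z.2) (strip T)) (hx : 0 ≤ x)
    (ht : t ∈ Icc 0 T) :
    dt T 1 g x t = fderivWithin ℝ (fun z : ℝ × ℝ => g z.1 z.2) (strip T) (x, t) (0, 1) := by
  rw [dt_one]
  exact (hasDerivWithinAt_fderivWithin_snd hg hx ht).derivWithin (uniqueDiffOn_Icc hT t ht)

theorem dx_eq_fderivWithin
    (hg : DifferentiableOn ℝ (fun z : ℝ × ℝ => g z.1 z.2) (strip T)) (hx : 0 ≤ x)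
    (ht : t ∈ Icc 0 T) :
    dx g x t = fderivWithin ℝ (fun z : ℝ × ℝ => g z.1 z.2) (strip T) (x, t) (1, 0) :=
  (hasDerivWithinAt_fderivWithin_fst hg hx ht).derivWithin (uniqueDiffOn_Ici 0 x hx)

theorem hasDerivAt_dt (hT : 0 < T)
    (hg : DifferentiableOn ℝ (fun z : ℝ × ℝ => g z.1 z.2) (strip T)) (hx : 0 ≤ x)
    (ht : t ∈ Ioo 0 T) : HasDerivAt (fun s => g x s) (dt T 1 g x t) t := by
  rw [dt_one_eq_fderivWithin hT hg hx (Ioo_subset_Icc_self ht)]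
  exact (hasDerivWithinAt_fderivWithin_snd hg hx (Ioo_subset_Icc_self ht)).hasDerivAt
    (Icc_mem_nhds ht.1 ht.2)

theorem hasDerivAt_dx
    (hg : DifferentiableOn ℝ (fun z : ℝ × ℝ => g z.1 z.2) (strip T)) (hx : 0 < x)
    (ht : t ∈ Icc 0 T) : HasDerivAt (fun y => g y t) (dx g x t) x := by
  rw [dx_eq_fderivWithin hg hx.le ht]
  exact (hasDerivWithinAt_fderivWithin_fst hg hx.le ht).hasDerivAt (Ici_mem_nhds hx)

theorem contDiffOn_dt (hT : 0 < T) {m n : WithTop ℕ∞} (hmn : m + 1 ≤ n)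
    (hg : ContDiffOn ℝ n (fun z : ℝ × ℝ => g z.1 z.2) (strip T)) :
    ContDiffOn ℝ m (fun z : ℝ × ℝ => dt T 1 g z.1 z.2) (strip T) := by
  have h1 := hg.fderivWithin (uniqueDiffOn_strip hT) hmn
  have hd : DifferentiableOn ℝ (fun z : ℝ × ℝ => g z.1 z.2) (strip T) :=
    (hg.of_le (le_trans le_add_self hmn)).differentiableOn one_ne_zero
  exact (h1.clm_apply (contDiffOn_const (c := ((0 : ℝ), (1 : ℝ))))).congr
    (fun z hz => dt_one_eq_fderivWithin hT hd hz.1 hz.2)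

theorem contDiffOn_dx (hT : 0 < T) {m n : WithTop ℕ∞} (hmn : m + 1 ≤ n)
    (hg : ContDiffOn ℝ n (fun z : ℝ × ℝ => g z.1 z.2) (strip T)) :
    ContDiffOn ℝ m (fun z : ℝ × ℝ => dx g z.1 z.2) (strip T) := by
  have h1 := hg.fderivWithin (uniqueDiffOn_strip hT) hmn
  have hd : DifferentiableOn ℝ (fun z : ℝ × ℝ => g z.1 z.2) (strip T) :=
    (hg.of_le (le_trans le_add_self hmn)).differentiableOn one_ne_zero
  exact (h1.clm_apply (contDiffOn_const (c := ((1 : ℝ), (0 : ℝ))))).congr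
    (fun z hz => dx_eq_fderivWithin hd hz.1 hz.2)

/-- Both sides are entries of the second derivative within the strip. That derivative is symmetric
at boundary points too, because every point of the strip is a limit of interior points. -/
theorem dx_dt_comm (hT : 0 < T)
    (hg : ContDiffOn ℝ 2 (fun z : ℝ × ℝ => g z.1 z.2) (strip T)) (hx : 0 ≤ x)
    (ht : t ∈ Icc 0 T) : dt T 1 (dx g) x t = dx (dt T 1 g) x t := by
  have hz : (x, t) ∈ strip T := mem_strip.2 ⟨hx, ht⟩
  have hu := uniqueDiffOn_strip hT
  have h21 : (1 : WithTop ℕ∞) + 1 ≤ 2 := by norm_num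
  set G := fun z : ℝ × ℝ => g z.1 z.2
  have hd : DifferentiableOn ℝ G (strip T) := hg.differentiableOn two_ne_zero
  have hD : DifferentiableOn ℝ (fderivWithin ℝ G (strip T)) (strip T) :=
    (hg.fderivWithin hu h21).differentiableOn one_ne_zero
  have key : ∀ a : ℝ × ℝ, HasFDerivWithinAt (fun z => fderivWithin ℝ G (strip T) z a)
      ((fderivWithin ℝ (fderivWithin ℝ G (strip T)) (strip T) (x, t)).flip a) (strip T) (x, t) :=
    fun a => by
      have := (hD (x, t) hz).hasFDerivWithinAt.clm_apply
        (hasFDerivWithinAt_const a (x, t) (strip T))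
      simpa using this
  have hdt : DifferentiableOn ℝ (fun z : ℝ × ℝ => dt T 1 g z.1 z.2) (strip T) :=
    (contDiffOn_dt hT h21 hg).differentiableOn one_ne_zero
  have hdx : DifferentiableOn ℝ (fun z : ℝ × ℝ => dx g z.1 z.2) (strip T) :=
    (contDiffOn_dx hT h21 hg).differentiableOn one_ne_zero
  have e1 : fderivWithin ℝ (fun z : ℝ × ℝ => dt T 1 g z.1 z.2) (strip T) (x, t)
      = (fderivWithin ℝ (fderivWithin ℝ G (strip T)) (strip T) (x, t)).flip (0, 1) :=
    ((key (0, 1)).congr (fun z hz => dt_one_eq_fderivWithin hT hd hz.1 hz.2)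
      (dt_one_eq_fderivWithin hT hd hx ht)).fderivWithin (hu _ hz)
  have e2 : fderivWithin ℝ (fun z : ℝ × ℝ => dx g z.1 z.2) (strip T) (x, t)
      = (fderivWithin ℝ (fderivWithin ℝ G (strip T)) (strip T) (x, t)).flip (1, 0) :=
    ((key (1, 0)).congr (fun z hz => dx_eq_fderivWithin hd hz.1 hz.2)
      (dx_eq_fderivWithin hd hx ht)).fderivWithin (hu _ hz)
  rw [dt_one_eq_fderivWithin hT hdx hx ht, dx_eq_fderivWithin hdt hx ht, e1, e2]
  have hs := (hg (x, t) hz).isSymmSndFDerivWithinAt (by simp) hu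
    (by rw [interior_strip]; exact strip_subset_closure_interior hT hz) hz
  exact hs.eq (0, 1) (1, 0)

theorem dx_congr {f : ℝ → ℝ → ℝ} (h : ∀ y, 0 ≤ y → f y t = g y t) (hx : 0 ≤ x) :
    dx f x t = dx g x t :=
  derivWithin_congr (fun y hy => h y hy) (h x hx)

end Partial

/-! ### Extension by constants from the strip to the plane -/

/-- The nearest point of `[0, T]`. -/
def clamp (T t : ℝ) : ℝ := max 0 (min t T)

theorem clamp_mem {T : ℝ} (hT : 0 < T) (t : ℝ) : clamp T t ∈ Icc 0 T :=
  ⟨le_max_left _ _, max_le hT.le (min_le_right _ _)⟩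

theorem clamp_of_mem {T t : ℝ} (ht : t ∈ Icc 0 T) : clamp T t = t := by
  rw [clamp, min_eq_left ht.2, max_eq_right ht.1]

theorem continuous_clamp (T : ℝ) : Continuous (clamp T) := by
  unfold clamp; fun_prop

/-- Extension by constants of a function on the strip to the plane. -/
def ext (T : ℝ) (g : ℝ → ℝ → ℝ) (x t : ℝ) : ℝ := g (max x 0) (clamp T t)

theorem ext_apply {T : ℝ} (g : ℝ → ℝ → ℝ) {x t : ℝ} (hx : 0 ≤ x) (ht : t ∈ Icc 0 T) :
    ext T g x t = g x t := by
  rw [ext, max_eq_left hx, clamp_of_mem ht]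

theorem continuous_ext {T : ℝ} (hT : 0 < T) {g : ℝ → ℝ → ℝ}
    (hg : ContinuousOn (fun z : ℝ × ℝ => g z.1 z.2) (strip T)) :
    Continuous (fun z : ℝ × ℝ => ext T g z.1 z.2) := by
  have h : Continuous fun z : ℝ × ℝ => (max z.1 0, clamp T z.2) :=
    (continuous_fst.max continuous_const).prodMk ((continuous_clamp T).comp continuous_snd)
  exact hg.comp_continuous h fun z => mem_strip.2 ⟨le_max_right _ _, clamp_mem hT _⟩

/-- `f'` is the time derivative of `f` on `[0, ∞) × (0, T)`. -/
def HasDt (T : ℝ) (f f' : ℝ → ℝ → ℝ) : Prop :=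
  ∀ x, 0 ≤ x → ∀ t ∈ Ioo 0 T, HasDerivAt (fun s => f x s) (f' x t) t

/-- `f'` is the space derivative of `f` on `(0, ∞) × [0, T]`. -/
def HasDx (T : ℝ) (f f' : ℝ → ℝ → ℝ) : Prop :=
  ∀ x, 0 < x → ∀ t ∈ Icc 0 T, HasDerivAt (fun y => f y t) (f' x t) x

theorem HasDt.ext {T : ℝ} {f f' : ℝ → ℝ → ℝ} (h : HasDt T f f') :
    HasDt T (ext T f) (ext T f') := by
  intro x hx t ht
  rw [ext_apply f' hx (Ioo_subset_Icc_self ht)]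
  refine (h x hx t ht).congr_of_eventuallyEq ?_
  filter_upwards [Ioo_mem_nhds ht.1 ht.2] with s hs
  exact ext_apply f hx (Ioo_subset_Icc_self hs)

theorem HasDx.ext {T : ℝ} {f f' : ℝ → ℝ → ℝ} (h : HasDx T f f') :
    HasDx T (ext T f) (ext T f') := by
  intro x hx t ht
  rw [ext_apply f' hx.le ht]
  refine (h x hx t ht).congr_of_eventuallyEq ?_
  filter_upwards [Ioi_mem_nhds hx] with y hy
  exact ext_apply f (le_of_lt hy) ht

theorem hasDt_dt {T : ℝ} (hT : 0 < T) {g : ℝ → ℝ → ℝ}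
    (hg : DifferentiableOn ℝ (fun z : ℝ × ℝ => g z.1 z.2) (strip T)) : HasDt T g (dt T 1 g) :=
  fun _ hx _ ht => hasDerivAt_dt hT hg hx ht

theorem hasDx_dx {T : ℝ} {g : ℝ → ℝ → ℝ}
    (hg : DifferentiableOn ℝ (fun z : ℝ × ℝ => g z.1 z.2) (strip T)) : HasDx T g (dx g) :=
  fun _ hx _ ht => hasDerivAt_dx hg hx ht

/-! ### The Eulerian radius -/

theorem intervalIntegral_comm {f : ℝ → ℝ → ℝ} (hf : Continuous fun z : ℝ × ℝ => f z.1 z.2)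
    (a b c d : ℝ) :
    ∫ x in a..b, ∫ t in c..d, f x t = ∫ t in c..d, ∫ x in a..b, f x t := by
  refine intervalIntegral_intervalIntegral_swap ?_
  exact (hf.continuousOn.integrableOn_compact (isCompact_uIcc.prod isCompact_uIcc)).mono_set
    (prod_mono uIoc_subset_uIcc uIoc_subset_uIcc)

theorem hasDerivAt_cbrt {b : ℝ → ℝ} {b' t : ℝ} (h : HasDerivAt b b' t) (hb : 0 < b t) :
    HasDerivAt (fun s => b s ^ (1 / 3 : ℝ)) (b' / (3 * (b t ^ (1 / 3 : ℝ)) ^ 2)) t := by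
  refine (h.rpow_const (p := 1 / 3) (Or.inl hb.ne')).congr_deriv ?_
  have h3 : b t ^ ((1 : ℝ) / 3 - 1) = ((b t ^ (1 / 3 : ℝ)) ^ 2)⁻¹ := by
    rw [← Real.rpow_natCast, ← Real.rpow_mul hb.le, ← Real.rpow_neg hb.le]; norm_num
  rw [h3]; field_simp

variable {P : Params} {T : ℝ} {u q : ℝ → ℝ → ℝ} {R : ℝ → ℝ}

/-- The cube of the Eulerian radius. -/
def radCube (q : ℝ → ℝ → ℝ) (R : ℝ → ℝ) (x t : ℝ) : ℝ :=
  R t ^ 3 + 3 * x + 3 * ∫ y in (0 : ℝ)..x, q y t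

theorem continuousOn_strip_of_contDiffOn {n : WithTop ℕ∞} {g : ℝ → ℝ → ℝ}
    (hg : ContDiffOn ℝ n (fun z : ℝ × ℝ => g z.1 z.2) (Ici 0 ×ˢ Icc 0 T)) :
    ContinuousOn (fun z : ℝ × ℝ => g z.1 z.2) (strip T) := hg.continuousOn

theorem ext_intervalIntegral (g : ℝ → ℝ → ℝ) {x t : ℝ} (hx : 0 ≤ x) (ht : t ∈ Icc 0 T) :
    ∫ y in (0 : ℝ)..x, ext T g y t = ∫ y in (0 : ℝ)..x, g y t :=
  intervalIntegral.integral_congr fun y hy => by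
    rw [uIcc_of_le hx] at hy; exact ext_apply g hy.1 ht

theorem continuousOn_slice {g : ℝ → ℝ → ℝ}
    (hg : ContinuousOn (fun z : ℝ × ℝ => g z.1 z.2) (strip T)) {t : ℝ} (ht : t ∈ Icc 0 T) :
    ContinuousOn (fun y => g y t) (Ici 0) :=
  hg.comp (f := fun y => (y, t)) (by fun_prop) fun _ hy => mem_strip.2 ⟨hy, ht⟩

theorem continuousOn_slice_time {g : ℝ → ℝ → ℝ}
    (hg : ContinuousOn (fun z : ℝ × ℝ => g z.1 z.2) (strip T)) {x : ℝ} (hx : 0 ≤ x) :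
    ContinuousOn (fun s => g x s) (Icc 0 T) :=
  hg.comp (f := fun s => (x, s)) (by fun_prop) fun _ hs => mem_strip.2 ⟨hx, hs⟩

namespace IsEulerFlow

theorem continuousOn_R (h : IsEulerFlow P T u q R) : ContinuousOn R (Icc 0 T) :=
  fun t ht => (h.kinematic t ht).continuousWithinAt

theorem continuousOn_radCube (h : IsEulerFlow P T u q R) (hT : 0 < T) :
    ContinuousOn (fun z : ℝ × ℝ => radCube q R z.1 z.2) (strip T) := by
  have hR : ContinuousOn (fun z : ℝ × ℝ => R z.2) (strip T) :=
    h.continuousOn_R.comp continuousOn_snd fun z hz => hz.2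
  have hq := continuous_ext hT (continuousOn_strip_of_contDiffOn h.smooth_q)
  have hI : Continuous fun z : ℝ × ℝ => ∫ y in (0 : ℝ)..z.1, ext T q y z.2 :=
    intervalIntegral.continuous_parametric_intervalIntegral_of_continuous
      (f := fun (z : ℝ × ℝ) y => ext T q y z.2)
      (hq.comp (f := fun p : (ℝ × ℝ) × ℝ => (p.2, p.1.2)) (by fun_prop)) continuous_fst
  have : ContinuousOn (fun z : ℝ × ℝ => R z.2 ^ 3 + 3 * z.1
      + 3 * ∫ y in (0 : ℝ)..z.1, ext T q y z.2) (strip T) :=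
    ((hR.pow 3).add (by fun_prop)).add (hI.continuousOn.const_mul 3)
  refine this.congr fun z hz => ?_
  simp only [radCube]
  rw [ext_intervalIntegral q hz.1 hz.2]

theorem radCube_ge (h : IsEulerFlow P T u q R)
    (hq : ∀ x, 0 ≤ x → ∀ t ∈ Icc 0 T, q x t ∈ Icc (-1 / 2 : ℝ) (1 / 2)) {x t : ℝ} (hx : 0 ≤ x)
    (ht : t ∈ Icc 0 T) : R t ^ 3 + 3 / 2 * x ≤ radCube q R x t := by
  have hi : IntervalIntegrable (fun y => q y t) volume 0 x :=
    ((continuousOn_slice (continuousOn_strip_of_contDiffOn h.smooth_q) ht).mono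
      (by rw [uIcc_of_le hx]; exact Icc_subset_Ici_self)).intervalIntegrable
  have h1 := intervalIntegral.integral_mono_on hx (intervalIntegrable_const (c := (-1 / 2 : ℝ))) hi
    fun y hy => (hq y hy.1 t ht).1
  rw [intervalIntegral.integral_const, smul_eq_mul] at h1
  unfold radCube
  linarith

theorem radCube_le (h : IsEulerFlow P T u q R)
    (hq : ∀ x, 0 ≤ x → ∀ t ∈ Icc 0 T, q x t ∈ Icc (-1 / 2 : ℝ) (1 / 2)) {x t : ℝ} (hx : 0 ≤ x)
    (ht : t ∈ Icc 0 T) : radCube q R x t ≤ R t ^ 3 + 9 / 2 * x := by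
  have hi : IntervalIntegrable (fun y => q y t) volume 0 x :=
    ((continuousOn_slice (continuousOn_strip_of_contDiffOn h.smooth_q) ht).mono
      (by rw [uIcc_of_le hx]; exact Icc_subset_Ici_self)).intervalIntegrable
  have h1 := intervalIntegral.integral_mono_on hx hi (intervalIntegrable_const (c := (1 / 2 : ℝ)))
    fun y hy => (hq y hy.1 t ht).2
  rw [intervalIntegral.integral_const, smul_eq_mul] at h1
  unfold radCube
  linarith

theorem radCube_pos (h : IsEulerFlow P T u q R)
    (hq : ∀ x, 0 ≤ x → ∀ t ∈ Icc 0 T, q x t ∈ Icc (-1 / 2 : ℝ) (1 / 2)) {x t : ℝ} (hx : 0 ≤ x)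
    (ht : t ∈ Icc 0 T) : 0 < radCube q R x t := by
  have := h.radCube_ge hq hx ht
  have h2 := pow_pos (h.R_mem t ht).1 3
  linarith

theorem rad_pos (h : IsEulerFlow P T u q R)
    (hq : ∀ x, 0 ≤ x → ∀ t ∈ Icc 0 T, q x t ∈ Icc (-1 / 2 : ℝ) (1 / 2)) {x t : ℝ} (hx : 0 ≤ x)
    (ht : t ∈ Icc 0 T) : 0 < rad q R x t :=
  Real.rpow_pos_of_pos (h.radCube_pos hq hx ht) _

theorem rad_zero (h : IsEulerFlow P T u q R) {t : ℝ} (ht : t ∈ Icc 0 T) : rad q R 0 t = R t := by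
  have := (h.R_mem t ht).1
  rw [rad, intervalIntegral.integral_same, mul_zero, add_zero, add_zero,
    ← Real.rpow_natCast, ← Real.rpow_mul this.le]
  norm_num

theorem continuousOn_rad (h : IsEulerFlow P T u q R) (hT : 0 < T) :
    ContinuousOn (fun z : ℝ × ℝ => rad q R z.1 z.2) (strip T) :=
  (h.continuousOn_radCube hT).rpow_const fun _ _ => Or.inr (by norm_num)

theorem hasDx_rad (h : IsEulerFlow P T u q R)
    (hq : ∀ x, 0 ≤ x → ∀ t ∈ Icc 0 T, q x t ∈ Icc (-1 / 2 : ℝ) (1 / 2)) (hT : 0 < T) :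
    HasDx T (rad q R) (fun x t => (1 + q x t) / rad q R x t ^ 2) := by
  intro x hx t ht
  have hc := continuous_ext hT (continuousOn_strip_of_contDiffOn h.smooth_q)
  have hc' : Continuous fun y => ext T q y t := hc.comp (f := fun y => (y, t)) (by fun_prop)
  have h1 : HasDerivAt (fun y => ∫ z in (0 : ℝ)..y, ext T q z t) (ext T q x t) x :=
    intervalIntegral.integral_hasDerivAt_right (hc'.intervalIntegrable _ _)
      (hc'.stronglyMeasurableAtFilter _ _) hc'.continuousAt
  have h2 : HasDerivAt (fun y => ∫ z in (0 : ℝ)..y, q z t) (q x t) x := by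
    rw [← ext_apply q hx.le ht]
    refine h1.congr_of_eventuallyEq ?_
    filter_upwards [Ioi_mem_nhds hx] with y hy
    exact (ext_intervalIntegral q (le_of_lt hy) ht).symm
  have h3 : HasDerivAt (fun y => radCube q R y t) (3 * 1 + 3 * q x t) x :=
    (((hasDerivAt_id x).const_mul 3).const_add (R t ^ 3)).add (h2.const_mul 3)
  have h4 := hasDerivAt_cbrt h3 (h.radCube_pos hq hx.le ht)
  refine h4.congr_deriv ?_
  change _ / (3 * rad q R x t ^ 2) = _
  have := h.rad_pos hq hx.le ht
  field_simp

theorem hasDx_rad_sq_mul_u (h : IsEulerFlow P T u q R)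
    (hq : ∀ x, 0 ≤ x → ∀ t ∈ Icc 0 T, q x t ∈ Icc (-1 / 2 : ℝ) (1 / 2)) (hT : 0 < T) :
    HasDx T (fun x t => rad q R x t ^ 2 * u x t)
      (fun x t => rad q R x t ^ 2 * dx u x t + 2 * (1 + q x t) * u x t / rad q R x t) := by
  intro x hx t ht
  have h1 := h.hasDx_rad hq hT x hx t ht
  have h2 := hasDx_dx (h.smooth_u.differentiableOn two_ne_zero) x hx t ht
  have hr := h.rad_pos hq hx.le ht
  refine ((h1.fun_pow 2).fun_mul h2).congr_deriv ?_
  field_simp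
  ring

/-- The continuity equation, with the space derivative carried out. -/
theorem dt_q_eq (h : IsEulerFlow P T u q R)
    (hq : ∀ x, 0 ≤ x → ∀ t ∈ Icc 0 T, q x t ∈ Icc (-1 / 2 : ℝ) (1 / 2)) (hT : 0 < T)
    {x t : ℝ} (hx : 0 ≤ x) (ht : t ∈ Icc 0 T) :
    dt T 1 q x t = rad q R x t ^ 2 * dx u x t + 2 * (1 + q x t) * u x t / rad q R x t := by
  have hr := h.continuousOn_rad hT
  have c1 : ContinuousOn (fun z : ℝ × ℝ => dt T 1 q z.1 z.2) (strip T) :=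
    (contDiffOn_dt hT (m := 1) (by norm_num) h.smooth_q).continuousOn
  have c2 : ContinuousOn (fun z : ℝ × ℝ => dx u z.1 z.2) (strip T) :=
    (contDiffOn_dx hT (m := 1) (by norm_num) h.smooth_u).continuousOn
  have c3 := continuousOn_strip_of_contDiffOn h.smooth_u
  have c4 := continuousOn_strip_of_contDiffOn h.smooth_q
  refine eqOn_strip (f := dt T 1 q) (g := fun x t => rad q R x t ^ 2 * dx u x t
    + 2 * (1 + q x t) * u x t / rad q R x t) hT c1 ?_ ?_ hx ht
  · refine ContinuousOn.add (by fun_prop) (ContinuousOn.div (by fun_prop) hr ?_)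
    exact fun z hz => (h.rad_pos hq hz.1 hz.2).ne'
  · intro x hx t ht
    rw [h.continuity x hx t ht]
    exact (h.hasDx_rad_sq_mul_u hq hT x hx t
      (Ioo_subset_Icc_self ht)).hasDerivWithinAt.derivWithin
      (uniqueDiffOn_Ici 0 x (mem_Ioi.1 hx).le)

/-- Particle paths: mass conservation on `[0, x]` together with the kinematic condition at the inner
surface says that the particle `x` moves with velocity `u`. The integrated form is proved first,
with Fubini in place of differentiation under the integral sign, and the fundamental theorem of
calculus then gives the derivative. -/
theorem hasDt_rad (h : IsEulerFlow P T u q R)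
    (hq : ∀ x, 0 ≤ x → ∀ t ∈ Icc 0 T, q x t ∈ Icc (-1 / 2 : ℝ) (1 / 2)) (hT : 0 < T) :
    HasDt T (rad q R) u := by
  intro x hx t ht
  have cr := h.continuousOn_rad hT
  have cu := continuousOn_strip_of_contDiffOn h.smooth_u
  have cq := continuousOn_strip_of_contDiffOn h.smooth_q
  have hqt := hasDt_dt hT (h.smooth_q.differentiableOn two_ne_zero)
  have cqt : Continuous fun z : ℝ × ℝ => ext T (dt T 1 q) z.1 z.2 :=
    continuous_ext hT (contDiffOn_dt hT (m := 1) (by norm_num) h.smooth_q).continuousOn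
  have cw : Continuous fun z : ℝ × ℝ => ext T (fun x t => rad q R x t ^ 2 * u x t) z.1 z.2 :=
    continuous_ext hT (by fun_prop)
  set w := ext T (fun x t => rad q R x t ^ 2 * u x t) with hw
  have cws : ∀ x, Continuous fun s => w x s := fun x =>
    cw.comp (f := fun s => (x, s)) (by fun_prop)
  have hsub : ∀ s ∈ Icc 0 T, Icc 0 s ⊆ Icc 0 T := fun s hs => Icc_subset_Icc_right hs.2
  have hR : ∀ s ∈ Icc 0 T, ∫ τ in (0 : ℝ)..s, 3 * w 0 τ = R s ^ 3 - R 0 ^ 3 := by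
    intro s hs
    refine intervalIntegral.integral_eq_sub_of_hasDerivAt_of_le hs.1
      ((h.continuousOn_R.mono (hsub s hs)).pow 3) ?_
      (((cws 0).const_mul 3).intervalIntegrable _ _)
    intro τ hτ
    have hτ' : τ ∈ Ioo 0 T := ⟨hτ.1, hτ.2.trans_le hs.2⟩
    have := ((h.kinematic τ (Ioo_subset_Icc_self hτ')).hasDerivAt
      (Icc_mem_nhds hτ'.1 hτ'.2)).fun_pow 3
    refine this.congr_deriv ?_
    rw [hw, ext_apply _ le_rfl (Ioo_subset_Icc_self hτ'), h.rad_zero (Ioo_subset_Icc_self hτ')]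
    push_cast; ring
  have hI1 : ∀ s ∈ Icc 0 T, (∫ y in (0 : ℝ)..x, q y s) - ∫ y in (0 : ℝ)..x, q y 0
      = ∫ y in (0 : ℝ)..x, ∫ τ in (0 : ℝ)..s, ext T (dt T 1 q) y τ := by
    intro s hs
    have hii : ∀ s ∈ Icc 0 T, IntervalIntegrable (fun y => q y s) volume 0 x := fun s hs =>
      ((continuousOn_slice cq hs).mono
        (by rw [uIcc_of_le hx]; exact Icc_subset_Ici_self)).intervalIntegrable
    rw [← intervalIntegral.integral_sub (hii s hs) (hii 0 ⟨le_rfl, hT.le⟩)]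
    refine intervalIntegral.integral_congr fun y hy => ?_
    rw [uIcc_of_le hx] at hy
    symm
    refine intervalIntegral.integral_eq_sub_of_hasDerivAt_of_le hs.1
      ((continuousOn_slice_time cq hy.1).mono (hsub s hs)) ?_
      ((cqt.comp (f := fun s => (y, s)) (by fun_prop)).intervalIntegrable _ _)
    intro τ hτ
    have hτ' : τ ∈ Ioo 0 T := ⟨hτ.1, hτ.2.trans_le hs.2⟩
    rw [ext_apply _ hy.1 (Ioo_subset_Icc_self hτ')]
    exact hqt y hy.1 τ hτ'
  have hI2 : ∀ τ ∈ Icc 0 T, ∫ y in (0 : ℝ)..x, ext T (dt T 1 q) y τ = w x τ - w 0 τ := by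
    intro τ hτ
    rw [hw, ext_apply _ hx hτ, ext_apply _ le_rfl hτ]
    refine intervalIntegral.integral_eq_sub_of_hasDerivAt_of_le
      (f := fun y => rad q R y τ ^ 2 * u y τ) hx
      ((((continuousOn_slice cr hτ).pow 2).mul (continuousOn_slice cu hτ)).mono
        Icc_subset_Ici_self) ?_
      ((cqt.comp (f := fun y => (y, τ)) (by fun_prop)).intervalIntegrable _ _)
    intro y hy
    rw [ext_apply _ hy.1.le hτ, h.dt_q_eq hq hT hy.1.le hτ]
    exact h.hasDx_rad_sq_mul_u hq hT y hy.1 τ hτ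
  -- The contributions `w 0` at the inner surface cancel between the motion of `R` and the mass
  -- balance.
  have hI : ∀ s ∈ Icc 0 T, radCube q R x s = radCube q R x 0 + ∫ τ in (0 : ℝ)..s, 3 * w x τ := by
    intro s hs
    have e1 := hI1 s hs
    rw [intervalIntegral_comm cqt, intervalIntegral.integral_congr (g := fun τ => w x τ - w 0 τ)
      (fun τ hτ => hI2 τ (hsub s hs (by rwa [uIcc_of_le hs.1] at hτ))),
      intervalIntegral.integral_sub ((cws x).intervalIntegrable _ _)
        ((cws 0).intervalIntegrable _ _)] at e1
    have e2 := hR s hs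
    rw [intervalIntegral.integral_const_mul] at e2 ⊢
    unfold radCube
    linarith
  have hd : HasDerivAt (fun s => radCube q R x s) (3 * w x t) t := by
    have c := (cws x).const_mul 3
    have := (intervalIntegral.integral_hasDerivAt_right (c.intervalIntegrable 0 t)
      (c.stronglyMeasurableAtFilter _ _) c.continuousAt).const_add (radCube q R x 0)
    refine this.congr_of_eventuallyEq ?_
    filter_upwards [Ioo_mem_nhds ht.1 ht.2] with s hs
    exact hI s (Ioo_subset_Icc_self hs)
  have h4 := hasDerivAt_cbrt hd (h.radCube_pos hq hx (Ioo_subset_Icc_self ht))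
  refine h4.congr_deriv ?_
  change _ / (3 * rad q R x t ^ 2) = _
  have := h.rad_pos hq hx (Ioo_subset_Icc_self ht)
  rw [hw, ext_apply _ hx (Ioo_subset_Icc_self ht)]
  field_simp

end IsEulerFlow

/-! ### Flows extended to the plane -/

/-- A flow with its velocity potential, together with the derivatives that classical regularity
provides, all extended by constants from the strip `[0, ∞) × [0, T]` to the plane. -/
structure Jet where
  T : ℝ
  κ : ℝ
  γ : ℝ
  u : ℝ → ℝ → ℝ
  ut : ℝ → ℝ → ℝ
  utt : ℝ → ℝ → ℝ
  ux : ℝ → ℝ → ℝ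
  utx : ℝ → ℝ → ℝ
  q : ℝ → ℝ → ℝ
  qt : ℝ → ℝ → ℝ
  qtt : ℝ → ℝ → ℝ
  qx : ℝ → ℝ → ℝ
  qtx : ℝ → ℝ → ℝ
  r : ℝ → ℝ → ℝ
  φ : ℝ → ℝ → ℝ
  φt : ℝ → ℝ → ℝ
  φtt : ℝ → ℝ → ℝ
  φttt : ℝ → ℝ → ℝ
  φx : ℝ → ℝ → ℝ
  φtx : ℝ → ℝ → ℝ
  φttx : ℝ → ℝ → ℝ
  φxx : ℝ → ℝ → ℝ
  φtxx : ℝ → ℝ → ℝ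
  T_pos : 0 < T
  κ_pos : 0 < κ
  one_lt_γ : 1 < γ
  cont_u : Continuous fun z : ℝ × ℝ => u z.1 z.2
  cont_ut : Continuous fun z : ℝ × ℝ => ut z.1 z.2
  cont_utt : Continuous fun z : ℝ × ℝ => utt z.1 z.2
  cont_ux : Continuous fun z : ℝ × ℝ => ux z.1 z.2
  cont_utx : Continuous fun z : ℝ × ℝ => utx z.1 z.2
  cont_q : Continuous fun z : ℝ × ℝ => q z.1 z.2
  cont_qt : Continuous fun z : ℝ × ℝ => qt z.1 z.2
  cont_qtt : Continuous fun z : ℝ × ℝ => qtt z.1 z.2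
  cont_qx : Continuous fun z : ℝ × ℝ => qx z.1 z.2
  cont_qtx : Continuous fun z : ℝ × ℝ => qtx z.1 z.2
  cont_r : Continuous fun z : ℝ × ℝ => r z.1 z.2
  cont_φ : Continuous fun z : ℝ × ℝ => φ z.1 z.2
  cont_φt : Continuous fun z : ℝ × ℝ => φt z.1 z.2
  cont_φtt : Continuous fun z : ℝ × ℝ => φtt z.1 z.2
  cont_φttt : Continuous fun z : ℝ × ℝ => φttt z.1 z.2
  cont_φx : Continuous fun z : ℝ × ℝ => φx z.1 z.2
  cont_φtx : Continuous fun z : ℝ × ℝ => φtx z.1 z.2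
  cont_φttx : Continuous fun z : ℝ × ℝ => φttx z.1 z.2
  cont_φxx : Continuous fun z : ℝ × ℝ => φxx z.1 z.2
  cont_φtxx : Continuous fun z : ℝ × ℝ => φtxx z.1 z.2
  r_pos : ∀ x t, 0 < r x t
  q_mem : ∀ x t, q x t ∈ Icc (-1 / 2 : ℝ) (1 / 2)
  hasDt_u : HasDt T u ut
  hasDt_ut : HasDt T ut utt
  hasDt_ux : HasDt T ux utx
  hasDt_q : HasDt T q qt
  hasDt_qt : HasDt T qt qtt
  hasDt_qx : HasDt T qx qtx
  hasDt_r : HasDt T r u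
  hasDt_φ : HasDt T φ φt
  hasDt_φt : HasDt T φt φtt
  hasDt_φtt : HasDt T φtt φttt
  hasDt_φx : HasDt T φx φtx
  hasDt_φtx : HasDt T φtx φttx
  hasDt_φxx : HasDt T φxx φtxx
  hasDx_u : HasDx T u ux
  hasDx_ut : HasDx T ut utx
  hasDx_q : HasDx T q qx
  hasDx_qt : HasDx T qt qtx
  hasDx_φ : HasDx T φ φx
  hasDx_φt : HasDx T φt φtx
  hasDx_φtt : HasDx T φtt φttx
  hasDx_φx : HasDx T φx φxx
  hasDx_φtx : HasDx T φtx φtxx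
  hasDx_r : HasDx T r fun x t => (1 + q x t) / r x t ^ 2
  continuity : ∀ x t, qt x t = r x t ^ 2 * ux x t + 2 * (1 + q x t) * u x t / r x t
  momentum : ∀ x t, ut x t = κ * (1 + q x t)⁻¹ ^ (γ + 1) * r x t ^ 2 * qx x t
  velocity : ∀ x t, r x t ^ 2 * φx x t = (1 + q x t) * u x t
  wave : ∀ x t, φtt x t = κ * (1 + q x t)⁻¹ ^ (γ + 1)
    * (r x t ^ 4 * φxx x t + 4 * r x t * (1 + q x t) * φx x t)

namespace Jet

variable (J : Jet)

@[fun_prop] theorem continuous_u {α : Type*} [TopologicalSpace α] {a b : α → ℝ}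
    (ha : Continuous a) (hb : Continuous b) : Continuous fun z => J.u (a z) (b z) :=
  J.cont_u.comp (ha.prodMk hb)

@[fun_prop] theorem continuous_ut {α : Type*} [TopologicalSpace α] {a b : α → ℝ}
    (ha : Continuous a) (hb : Continuous b) : Continuous fun z => J.ut (a z) (b z) :=
  J.cont_ut.comp (ha.prodMk hb)

@[fun_prop] theorem continuous_utt {α : Type*} [TopologicalSpace α] {a b : α → ℝ}
    (ha : Continuous a) (hb : Continuous b) : Continuous fun z => J.utt (a z) (b z) :=
  J.cont_utt.comp (ha.prodMk hb)

@[fun_prop] theorem continuous_ux {α : Type*} [TopologicalSpace α] {a b : α → ℝ}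
    (ha : Continuous a) (hb : Continuous b) : Continuous fun z => J.ux (a z) (b z) :=
  J.cont_ux.comp (ha.prodMk hb)

@[fun_prop] theorem continuous_utx {α : Type*} [TopologicalSpace α] {a b : α → ℝ}
    (ha : Continuous a) (hb : Continuous b) : Continuous fun z => J.utx (a z) (b z) :=
  J.cont_utx.comp (ha.prodMk hb)

@[fun_prop] theorem continuous_q {α : Type*} [TopologicalSpace α] {a b : α → ℝ}
    (ha : Continuous a) (hb : Continuous b) : Continuous fun z => J.q (a z) (b z) :=
  J.cont_q.comp (ha.prodMk hb)

@[fun_prop] theorem continuous_qt {α : Type*} [TopologicalSpace α] {a b : α → ℝ}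
    (ha : Continuous a) (hb : Continuous b) : Continuous fun z => J.qt (a z) (b z) :=
  J.cont_qt.comp (ha.prodMk hb)

@[fun_prop] theorem continuous_qtt {α : Type*} [TopologicalSpace α] {a b : α → ℝ}
    (ha : Continuous a) (hb : Continuous b) : Continuous fun z => J.qtt (a z) (b z) :=
  J.cont_qtt.comp (ha.prodMk hb)

@[fun_prop] theorem continuous_qx {α : Type*} [TopologicalSpace α] {a b : α → ℝ}
    (ha : Continuous a) (hb : Continuous b) : Continuous fun z => J.qx (a z) (b z) :=
  J.cont_qx.comp (ha.prodMk hb)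

@[fun_prop] theorem continuous_qtx {α : Type*} [TopologicalSpace α] {a b : α → ℝ}
    (ha : Continuous a) (hb : Continuous b) : Continuous fun z => J.qtx (a z) (b z) :=
  J.cont_qtx.comp (ha.prodMk hb)

@[fun_prop] theorem continuous_r {α : Type*} [TopologicalSpace α] {a b : α → ℝ}
    (ha : Continuous a) (hb : Continuous b) : Continuous fun z => J.r (a z) (b z) :=
  J.cont_r.comp (ha.prodMk hb)

@[fun_prop] theorem continuous_φ {α : Type*} [TopologicalSpace α] {a b : α → ℝ}
    (ha : Continuous a) (hb : Continuous b) : Continuous fun z => J.φ (a z) (b z) :=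
  J.cont_φ.comp (ha.prodMk hb)

@[fun_prop] theorem continuous_φt {α : Type*} [TopologicalSpace α] {a b : α → ℝ}
    (ha : Continuous a) (hb : Continuous b) : Continuous fun z => J.φt (a z) (b z) :=
  J.cont_φt.comp (ha.prodMk hb)

@[fun_prop] theorem continuous_φtt {α : Type*} [TopologicalSpace α] {a b : α → ℝ}
    (ha : Continuous a) (hb : Continuous b) : Continuous fun z => J.φtt (a z) (b z) :=
  J.cont_φtt.comp (ha.prodMk hb)

@[fun_prop] theorem continuous_φttt {α : Type*} [TopologicalSpace α] {a b : α → ℝ}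
    (ha : Continuous a) (hb : Continuous b) : Continuous fun z => J.φttt (a z) (b z) :=
  J.cont_φttt.comp (ha.prodMk hb)

@[fun_prop] theorem continuous_φx {α : Type*} [TopologicalSpace α] {a b : α → ℝ}
    (ha : Continuous a) (hb : Continuous b) : Continuous fun z => J.φx (a z) (b z) :=
  J.cont_φx.comp (ha.prodMk hb)

@[fun_prop] theorem continuous_φtx {α : Type*} [TopologicalSpace α] {a b : α → ℝ}
    (ha : Continuous a) (hb : Continuous b) : Continuous fun z => J.φtx (a z) (b z) :=
  J.cont_φtx.comp (ha.prodMk hb)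

@[fun_prop] theorem continuous_φttx {α : Type*} [TopologicalSpace α] {a b : α → ℝ}
    (ha : Continuous a) (hb : Continuous b) : Continuous fun z => J.φttx (a z) (b z) :=
  J.cont_φttx.comp (ha.prodMk hb)

@[fun_prop] theorem continuous_φtxx {α : Type*} [TopologicalSpace α] {a b : α → ℝ}
    (ha : Continuous a) (hb : Continuous b) : Continuous fun z => J.φtxx (a z) (b z) :=
  J.cont_φtxx.comp (ha.prodMk hb)

theorem r_ne (x t : ℝ) : J.r x t ≠ 0 := (J.r_pos x t).ne'

theorem one_add_q_pos (x t : ℝ) : 0 < 1 + J.q x t := by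
  have := (J.q_mem x t).1; linarith

theorem one_add_q_ne (x t : ℝ) : 1 + J.q x t ≠ 0 := (J.one_add_q_pos x t).ne'

/-- The square of the sound speed. -/
def s (x t : ℝ) : ℝ := J.κ * (1 + J.q x t)⁻¹ ^ (J.γ + 1)

theorem s_pos (x t : ℝ) : 0 < J.s x t :=
  mul_pos J.κ_pos (Real.rpow_pos_of_pos (inv_pos.2 (J.one_add_q_pos x t)) _)

theorem s_ne (x t : ℝ) : J.s x t ≠ 0 := (J.s_pos x t).ne'

@[fun_prop] theorem continuous_s {α : Type*} [TopologicalSpace α] {a b : α → ℝ}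
    (ha : Continuous a) (hb : Continuous b) : Continuous fun z => J.s (a z) (b z) := by
  unfold s
  have h : Continuous fun z => 1 + J.q (a z) (b z) := by fun_prop
  exact continuous_const.mul ((h.inv₀ fun z => J.one_add_q_ne _ _).rpow_const
    fun z => Or.inr (by have := J.one_lt_γ; linarith))

theorem hasDerivAt_inv_rpow {f : ℝ → ℝ} {f' t κ p : ℝ} (hf : HasDerivAt f f' t)
    (h : 0 < 1 + f t) : HasDerivAt (fun a => κ * (1 + f a)⁻¹ ^ p)
      (-p * (κ * (1 + f t)⁻¹ ^ p) * f' / (1 + f t)) t := by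
  have h1 : HasDerivAt (fun a => (1 + f a)⁻¹) (-f' / (1 + f t) ^ 2) t :=
    (hf.const_add 1).fun_inv h.ne'
  refine ((h1.rpow_const (p := p) (Or.inl (inv_pos.2 h).ne')).const_mul κ).congr_deriv ?_
  rw [Real.rpow_sub_one (inv_pos.2 h).ne']
  field_simp

theorem hasDt_s : HasDt J.T J.s fun x t =>
    -(J.γ + 1) * J.s x t * J.qt x t / (1 + J.q x t) := fun x hx t ht =>
  hasDerivAt_inv_rpow (J.hasDt_q x hx t ht) (J.one_add_q_pos x t)

theorem hasDx_s : HasDx J.T J.s fun x t =>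
    -(J.γ + 1) * J.s x t * J.qx x t / (1 + J.q x t) := fun x hx t ht =>
  hasDerivAt_inv_rpow (f := fun y => J.q y t) (J.hasDx_q x hx t ht) (J.one_add_q_pos x t)

end Jet

/-! ### The extension of a classical flow -/

/-- The bootstrap bound is assumed for `x > 0` only; it reaches `x = 0` by continuity. -/
theorem Bootstrap.q_mem_Icc {P : Params} {T B ε : ℝ} {u q : ℝ → ℝ → ℝ} {R : ℝ → ℝ}
    (hb : Bootstrap P T B ε u q R) (h : IsEulerFlow P T u q R) {x : ℝ} (hx : 0 ≤ x) {t : ℝ}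
    (ht : t ∈ Icc 0 T) : q x t ∈ Icc (-1 / 2 : ℝ) (1 / 2) := by
  have hc := continuousOn_slice (continuousOn_strip_of_contDiffOn h.smooth_q) ht
  have h1 : MapsTo (fun y => q y t) (closure (Ioi 0)) (closure (Icc (-1 / 2 : ℝ) (1 / 2))) :=
    MapsTo.closure_of_continuousOn (fun y hy => hb.q_mem y hy t ht) (by rwa [closure_Ioi])
  rw [closure_Ioi, isClosed_Icc.closure_eq] at h1
  exact h1 hx

theorem Params.c_sq (P : Params) {q : ℝ → ℝ → ℝ} {x t : ℝ} (h : 0 < 1 + q x t) :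
    P.c q x t ^ 2 = P.Ca * P.γ / 2 * (1 + q x t)⁻¹ ^ (P.γ + 1) := by
  have := P.Ca_pos
  have := P.one_lt_γ
  rw [Params.c, Real.sq_sqrt, rho]
  have := Real.rpow_pos_of_pos (inv_pos.2 h) (P.γ + 1)
  unfold rho
  positivity

section OfFlow

variable {P : Params} {T : ℝ} {u q : ℝ → ℝ → ℝ} {R : ℝ → ℝ} {φ : ℝ → ℝ → ℝ}

theorem IsEulerFlow.dt_u_eq (h : IsEulerFlow P T u q R)
    (hq : ∀ x, 0 ≤ x → ∀ t ∈ Icc 0 T, q x t ∈ Icc (-1 / 2 : ℝ) (1 / 2)) (hT : 0 < T)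
    {x t : ℝ} (hx : 0 ≤ x) (ht : t ∈ Icc 0 T) :
    dt T 1 u x t = P.Ca * P.γ / 2 * (1 + q x t)⁻¹ ^ (P.γ + 1) * rad q R x t ^ 2 * dx q x t := by
  have hr := h.continuousOn_rad hT
  have c1 := (contDiffOn_dx hT (m := 1) (by norm_num) h.smooth_q).continuousOn
  have c4 := continuousOn_strip_of_contDiffOn h.smooth_q
  have hpos : ∀ z ∈ strip T, 0 < 1 + q z.1 z.2 := fun z hz => by
    have := (hq z.1 hz.1 z.2 hz.2).1; linarith
  have c5 : ContinuousOn (fun z : ℝ × ℝ => (1 + q z.1 z.2)⁻¹ ^ (P.γ + 1)) (strip T) :=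
    ((continuousOn_const.add c4).inv₀ fun z hz => (hpos z hz).ne').rpow_const
      fun z _ => Or.inr (by have := P.one_lt_γ; linarith)
  refine eqOn_strip (f := dt T 1 u) (g := fun x t => P.Ca * P.γ / 2
    * (1 + q x t)⁻¹ ^ (P.γ + 1) * rad q R x t ^ 2 * dx q x t) hT
    (contDiffOn_dt hT (m := 1) (by norm_num) h.smooth_u).continuousOn (by fun_prop) ?_ hx ht
  intro x hx t ht
  rw [h.momentum x hx t ht,
    P.c_sq (hpos (x, t) ⟨(mem_Ioi.1 hx).le, Ioo_subset_Icc_self ht⟩)]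

theorem IsVelocityPotential.velocity_strip (hv : IsVelocityPotential T u q R φ)
    (hw : SolvesWave P T q R φ) (h : IsEulerFlow P T u q R)
    (hq : ∀ x, 0 ≤ x → ∀ t ∈ Icc 0 T, q x t ∈ Icc (-1 / 2 : ℝ) (1 / 2)) (hT : 0 < T)
    {x t : ℝ} (hx : 0 ≤ x) (ht : t ∈ Icc 0 T) :
    rad q R x t ^ 2 * dx φ x t = (1 + q x t) * u x t := by
  have hr := h.continuousOn_rad hT
  have c2 : ContinuousOn (fun z : ℝ × ℝ => dx φ z.1 z.2) (strip T) :=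
    (contDiffOn_dx hT (m := 1) (by norm_num) hw.smooth).continuousOn
  have c3 := continuousOn_strip_of_contDiffOn h.smooth_u
  have c4 := continuousOn_strip_of_contDiffOn h.smooth_q
  refine eqOn_strip (f := fun x t => rad q R x t ^ 2 * dx φ x t)
    (g := fun x t => (1 + q x t) * u x t) hT (by fun_prop) (by fun_prop) ?_ hx ht
  intro x hx t ht
  have ht' := Ioo_subset_Icc_self ht
  rw [← hv.velocity x hx t ht', rho]
  have := (hq x (le_of_lt hx) t ht').1
  have : 1 + q x t ≠ 0 := by linarith
  field_simp

theorem SolvesWave.wave_strip (hw : SolvesWave P T q R φ) (h : IsEulerFlow P T u q R)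
    (hq : ∀ x, 0 ≤ x → ∀ t ∈ Icc 0 T, q x t ∈ Icc (-1 / 2 : ℝ) (1 / 2)) (hT : 0 < T)
    {x t : ℝ} (hx : 0 ≤ x) (ht : t ∈ Icc 0 T) :
    dt T 1 (dt T 1 φ) x t = P.Ca * P.γ / 2 * (1 + q x t)⁻¹ ^ (P.γ + 1)
      * (rad q R x t ^ 4 * dx (dx φ) x t + 4 * rad q R x t * (1 + q x t) * dx φ x t) := by
  have hr := h.continuousOn_rad hT
  have s1 := contDiffOn_dx hT (m := 2) (by norm_num) hw.smooth
  have s2 := contDiffOn_dx hT (m := 1) (by norm_num) s1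
  have s3 := contDiffOn_dt hT (m := 2) (by norm_num) hw.smooth
  have s4 := contDiffOn_dt hT (m := 1) (by norm_num) s3
  have c1 := s1.continuousOn
  have c2 := s2.continuousOn
  have c4 := continuousOn_strip_of_contDiffOn h.smooth_q
  have hpos : ∀ z ∈ strip T, 0 < 1 + q z.1 z.2 := fun z hz => by
    have := (hq z.1 hz.1 z.2 hz.2).1; linarith
  have c5 : ContinuousOn (fun z : ℝ × ℝ => (1 + q z.1 z.2)⁻¹ ^ (P.γ + 1)) (strip T) :=
    ((continuousOn_const.add c4).inv₀ fun z hz => (hpos z hz).ne').rpow_const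
      fun z _ => Or.inr (by have := P.one_lt_γ; linarith)
  refine eqOn_strip (f := dt T 1 (dt T 1 φ)) (g := fun x t =>
    P.Ca * P.γ / 2 * (1 + q x t)⁻¹ ^ (P.γ + 1)
      * (rad q R x t ^ 4 * dx (dx φ) x t + 4 * rad q R x t * (1 + q x t) * dx φ x t))
    hT s4.continuousOn (by fun_prop) ?_ hx ht
  intro x hx t ht
  have ht' := Ioo_subset_Icc_self ht
  have hx' : (0 : ℝ) ≤ x := (mem_Ioi.1 hx).le
  have h1 := hw.wave x hx t ht
  rw [P.c_sq (hpos (x, t) ⟨hx', ht'⟩), sub_eq_zero, dt_succ 1] at h1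
  rw [h1]
  congr 1
  have d1 := h.hasDx_rad hq hT x hx t ht'
  have d2 := hasDx_dx (s1.differentiableOn two_ne_zero) x hx t ht'
  have := h.rad_pos hq hx' ht'
  refine (((d1.fun_pow 4).fun_mul d2).congr_deriv ?_).hasDerivWithinAt.derivWithin
    (uniqueDiffOn_Ici 0 x hx')
  field_simp
  push_cast
  ring

/-- The extension to the plane of a classical flow with its velocity potential. -/
def Jet.ofFlow (h : IsEulerFlow P T u q R) (hv : IsVelocityPotential T u q R φ)
    (hw : SolvesWave P T q R φ)
    (hq : ∀ x, 0 ≤ x → ∀ t ∈ Icc 0 T, q x t ∈ Icc (-1 / 2 : ℝ) (1 / 2)) (hT : 0 < T) : Jet where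
  T := T
  κ := P.Ca * P.γ / 2
  γ := P.γ
  u := ext T u
  ut := ext T (dt T 1 u)
  utt := ext T (dt T 1 (dt T 1 u))
  ux := ext T (dx u)
  utx := ext T (dx (dt T 1 u))
  q := ext T q
  qt := ext T (dt T 1 q)
  qtt := ext T (dt T 1 (dt T 1 q))
  qx := ext T (dx q)
  qtx := ext T (dx (dt T 1 q))
  r := ext T (rad q R)
  φ := ext T φ
  φt := ext T (dt T 1 φ)
  φtt := ext T (dt T 1 (dt T 1 φ))
  φttt := ext T (dt T 1 (dt T 1 (dt T 1 φ)))
  φx := ext T (dx φ)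
  φtx := ext T (dx (dt T 1 φ))
  φttx := ext T (dx (dt T 1 (dt T 1 φ)))
  φxx := ext T (dx (dx φ))
  φtxx := ext T (dx (dx (dt T 1 φ)))
  T_pos := hT
  κ_pos := by have := P.Ca_pos; have := P.one_lt_γ; positivity
  one_lt_γ := P.one_lt_γ
  cont_u := continuous_ext hT h.smooth_u.continuousOn
  cont_ut := continuous_ext hT (contDiffOn_dt hT (m := 1) (by norm_num) h.smooth_u).continuousOn
  cont_utt := continuous_ext hT (contDiffOn_dt hT (m := 0) (n := 1) (by norm_num)
    (contDiffOn_dt hT (by norm_num) h.smooth_u)).continuousOn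
  cont_ux := continuous_ext hT (contDiffOn_dx hT (m := 1) (by norm_num) h.smooth_u).continuousOn
  cont_utx := continuous_ext hT (contDiffOn_dx hT (m := 0) (n := 1) (by norm_num)
    (contDiffOn_dt hT (by norm_num) h.smooth_u)).continuousOn
  cont_q := continuous_ext hT h.smooth_q.continuousOn
  cont_qt := continuous_ext hT (contDiffOn_dt hT (m := 1) (by norm_num) h.smooth_q).continuousOn
  cont_qtt := continuous_ext hT (contDiffOn_dt hT (m := 0) (n := 1) (by norm_num)
    (contDiffOn_dt hT (by norm_num) h.smooth_q)).continuousOn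
  cont_qx := continuous_ext hT (contDiffOn_dx hT (m := 1) (by norm_num) h.smooth_q).continuousOn
  cont_qtx := continuous_ext hT (contDiffOn_dx hT (m := 0) (n := 1) (by norm_num)
    (contDiffOn_dt hT (by norm_num) h.smooth_q)).continuousOn
  cont_r := continuous_ext hT (h.continuousOn_rad hT)
  cont_φ := continuous_ext hT hw.smooth.continuousOn
  cont_φt := continuous_ext hT (contDiffOn_dt hT (m := 2) (by norm_num) hw.smooth).continuousOn
  cont_φtt := continuous_ext hT (contDiffOn_dt hT (m := 1) (n := 2) (by norm_num)
    (contDiffOn_dt hT (by norm_num) hw.smooth)).continuousOn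
  cont_φttt := continuous_ext hT (contDiffOn_dt hT (m := 0) (n := 1) (by norm_num)
    (contDiffOn_dt hT (n := 2) (by norm_num) (contDiffOn_dt hT (by norm_num)
      hw.smooth))).continuousOn
  cont_φx := continuous_ext hT (contDiffOn_dx hT (m := 2) (by norm_num) hw.smooth).continuousOn
  cont_φtx := continuous_ext hT (contDiffOn_dx hT (m := 1) (n := 2) (by norm_num)
    (contDiffOn_dt hT (by norm_num) hw.smooth)).continuousOn
  cont_φttx := continuous_ext hT (contDiffOn_dx hT (m := 0) (n := 1) (by norm_num)
    (contDiffOn_dt hT (n := 2) (by norm_num) (contDiffOn_dt hT (by norm_num)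
      hw.smooth))).continuousOn
  cont_φxx := continuous_ext hT (contDiffOn_dx hT (m := 1) (n := 2) (by norm_num)
    (contDiffOn_dx hT (by norm_num) hw.smooth)).continuousOn
  cont_φtxx := continuous_ext hT (contDiffOn_dx hT (m := 0) (n := 1) (by norm_num)
    (contDiffOn_dx hT (n := 2) (by norm_num) (contDiffOn_dt hT (by norm_num)
      hw.smooth))).continuousOn
  -- Clamped arguments always lie in the strip, so positivity, the bounds on `q` and the algebraic
  -- relations hold on the whole plane. Only the derivative relations remain restricted to the
  -- strip.
  r_pos := fun x t => h.rad_pos hq (le_max_right _ _) (clamp_mem hT t)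
  q_mem := fun x t => hq _ (le_max_right _ _) _ (clamp_mem hT t)
  hasDt_u := (hasDt_dt hT (h.smooth_u.differentiableOn two_ne_zero)).ext
  hasDt_ut := (hasDt_dt hT ((contDiffOn_dt hT (m := 1) (by norm_num)
    h.smooth_u).differentiableOn one_ne_zero)).ext
  hasDt_ux := HasDt.ext fun x hx t ht => by
    rw [← dx_dt_comm hT h.smooth_u hx (Ioo_subset_Icc_self ht)]
    exact hasDt_dt hT ((contDiffOn_dx hT (m := 1) (by norm_num)
      h.smooth_u).differentiableOn one_ne_zero) x hx t ht
  hasDt_q := (hasDt_dt hT (h.smooth_q.differentiableOn two_ne_zero)).ext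
  hasDt_qt := (hasDt_dt hT ((contDiffOn_dt hT (m := 1) (by norm_num)
    h.smooth_q).differentiableOn one_ne_zero)).ext
  hasDt_qx := HasDt.ext fun x hx t ht => by
    rw [← dx_dt_comm hT h.smooth_q hx (Ioo_subset_Icc_self ht)]
    exact hasDt_dt hT ((contDiffOn_dx hT (m := 1) (by norm_num)
      h.smooth_q).differentiableOn one_ne_zero) x hx t ht
  hasDt_r := (h.hasDt_rad hq hT).ext
  hasDt_φ := (hasDt_dt hT (hw.smooth.differentiableOn three_ne_zero)).ext
  hasDt_φt := (hasDt_dt hT ((contDiffOn_dt hT (m := 2) (by norm_num)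
    hw.smooth).differentiableOn two_ne_zero)).ext
  hasDt_φtt := (hasDt_dt hT ((contDiffOn_dt hT (m := 1) (n := 2) (by norm_num)
    (contDiffOn_dt hT (by norm_num) hw.smooth)).differentiableOn one_ne_zero)).ext
  hasDt_φx := HasDt.ext fun x hx t ht => by
    rw [← dx_dt_comm hT (hw.smooth.of_le (by norm_num)) hx (Ioo_subset_Icc_self ht)]
    exact hasDt_dt hT ((contDiffOn_dx hT (m := 2) (by norm_num)
      hw.smooth).differentiableOn two_ne_zero) x hx t ht
  hasDt_φtx := HasDt.ext fun x hx t ht => by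
    have hφt := contDiffOn_dt hT (m := 2) (by norm_num) hw.smooth
    rw [← dx_dt_comm hT hφt hx (Ioo_subset_Icc_self ht)]
    exact hasDt_dt hT ((contDiffOn_dx hT (m := 1) (by norm_num)
      hφt).differentiableOn one_ne_zero) x hx t ht
  -- The time derivative has to pass two space derivatives: first the inner one, for all `y ≥ 0` at
  -- once, then the outer one.
  hasDt_φxx := HasDt.ext fun x hx t ht => by
    have hφx := contDiffOn_dx hT (m := 2) (by norm_num) hw.smooth
    have ht' := Ioo_subset_Icc_self ht
    rw [dx_congr (g := dt T 1 (dx φ)) (fun y hy =>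
      (dx_dt_comm hT (hw.smooth.of_le (by norm_num)) hy ht').symm) hx,
      ← dx_dt_comm hT hφx hx ht']
    exact hasDt_dt hT ((contDiffOn_dx hT (m := 1) (by norm_num)
      hφx).differentiableOn one_ne_zero) x hx t ht
  hasDx_u := (hasDx_dx (h.smooth_u.differentiableOn two_ne_zero)).ext
  hasDx_ut := (hasDx_dx ((contDiffOn_dt hT (m := 1) (by norm_num)
    h.smooth_u).differentiableOn one_ne_zero)).ext
  hasDx_q := (hasDx_dx (h.smooth_q.differentiableOn two_ne_zero)).ext
  hasDx_qt := (hasDx_dx ((contDiffOn_dt hT (m := 1) (by norm_num)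
    h.smooth_q).differentiableOn one_ne_zero)).ext
  hasDx_φ := (hasDx_dx (hw.smooth.differentiableOn three_ne_zero)).ext
  hasDx_φt := (hasDx_dx ((contDiffOn_dt hT (m := 2) (by norm_num)
    hw.smooth).differentiableOn two_ne_zero)).ext
  hasDx_φtt := (hasDx_dx ((contDiffOn_dt hT (m := 1) (n := 2) (by norm_num)
    (contDiffOn_dt hT (by norm_num) hw.smooth)).differentiableOn one_ne_zero)).ext
  hasDx_φx := (hasDx_dx ((contDiffOn_dx hT (m := 2) (by norm_num)
    hw.smooth).differentiableOn two_ne_zero)).ext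
  hasDx_φtx := (hasDx_dx ((contDiffOn_dx hT (m := 1) (n := 2) (by norm_num)
    (contDiffOn_dt hT (by norm_num) hw.smooth)).differentiableOn one_ne_zero)).ext
  hasDx_r := (h.hasDx_rad hq hT).ext
  continuity := fun x t => h.dt_q_eq hq hT (le_max_right _ _) (clamp_mem hT t)
  momentum := fun x t => h.dt_u_eq hq hT (le_max_right _ _) (clamp_mem hT t)
  velocity := fun x t => hv.velocity_strip hw h hq hT (le_max_right _ _) (clamp_mem hT t)
  wave := fun x t => hw.wave_strip h hq hT (le_max_right _ _) (clamp_mem hT t)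

end OfFlow

namespace Jet

variable (J : Jet)

/-! ### Differentiated forms of the equations -/

/-- Differentiated identities are checked in the interior, where two-sided derivatives exist, and
extended to the boundary by continuity. -/
theorem eq_of_eq_interior {f g : ℝ → ℝ → ℝ} (hf : Continuous fun z : ℝ × ℝ => f z.1 z.2)
    (hg : Continuous fun z : ℝ × ℝ => g z.1 z.2)
    (h : ∀ x, 0 < x → ∀ t ∈ Ioo 0 J.T, f x t = g x t) {x t : ℝ} (hx : 0 ≤ x)
    (ht : t ∈ Icc 0 J.T) : f x t = g x t :=
  eqOn_strip J.T_pos hf.continuousOn hg.continuousOn h hx ht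

theorem momentum' (x t : ℝ) : J.ut x t = J.s x t * J.r x t ^ 2 * J.qx x t := J.momentum x t

theorem wave' (x t : ℝ) : J.φtt x t = J.s x t
    * (J.r x t ^ 4 * J.φxx x t + 4 * J.r x t * (1 + J.q x t) * J.φx x t) := J.wave x t

variable {x t : ℝ} (hx : 0 ≤ x) (ht : t ∈ Icc 0 J.T)
include hx ht

/-- Time derivative of the continuity equation, with `u_x` eliminated by that equation. It expresses
the mixed derivative through quantities that the energy controls. -/
theorem r_sq_mul_utx : J.r x t ^ 2 * J.utx x t = J.qtt x t - 4 * J.qt x t * J.u x t / J.r x t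
    + 6 * (1 + J.q x t) * J.u x t ^ 2 / J.r x t ^ 2
    - 2 * (1 + J.q x t) * J.ut x t / J.r x t := by
  refine J.eq_of_eq_interior (f := fun x t => J.r x t ^ 2 * J.utx x t) (g := fun x t =>
    J.qtt x t - 4 * J.qt x t * J.u x t / J.r x t
    + 6 * (1 + J.q x t) * J.u x t ^ 2 / J.r x t ^ 2
    - 2 * (1 + J.q x t) * J.ut x t / J.r x t)
    (by fun_prop) (by fun_prop (disch := intro z; first
      | exact J.r_ne _ _ | exact pow_ne_zero _ (J.r_ne _ _))) ?_ hx ht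
  intro x hx t ht
  have hr := J.r_ne x t
  have h := (((J.hasDt_r x hx.le t ht).fun_pow 2).fun_mul (J.hasDt_ux x hx.le t ht)).fun_add
    (((((J.hasDt_q x hx.le t ht).const_add 1).const_mul 2).fun_mul
      (J.hasDt_u x hx.le t ht)).fun_div (J.hasDt_r x hx.le t ht) hr)
  have h2 := (J.hasDt_qt x hx.le t ht).unique
    (h.congr_of_eventuallyEq (Eventually.of_forall fun s => J.continuity x s))
  have h3 := J.continuity x t
  have h4 : J.ux x t = (J.qt x t - 2 * (1 + J.q x t) * J.u x t / J.r x t) / J.r x t ^ 2 := by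
    rw [h3]; field_simp; ring
  rw [h4] at h2
  field_simp at h2 ⊢
  push_cast at h2
  refine mul_left_cancel₀ hr ?_
  linear_combination -h2

/-- Time derivative of the momentum equation. It is read from right to left, as a formula for `r²
q_tx`. -/
theorem utt_eq : J.utt x t = J.s x t * J.r x t ^ 2 * J.qtx x t
    + (-(J.γ + 1) * J.qt x t / (1 + J.q x t) + 2 * J.u x t / J.r x t) * J.ut x t := by
  refine J.eq_of_eq_interior (f := J.utt) (g := fun x t => J.s x t * J.r x t ^ 2 * J.qtx x t
    + (-(J.γ + 1) * J.qt x t / (1 + J.q x t) + 2 * J.u x t / J.r x t) * J.ut x t)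
    (by fun_prop) (by fun_prop (disch := intro z; first
      | exact J.r_ne _ _ | exact J.one_add_q_ne _ _)) ?_ hx ht
  intro x hx t ht
  have hr := J.r_ne x t
  have hq := J.one_add_q_ne x t
  have h := ((J.hasDt_s x hx.le t ht).fun_mul ((J.hasDt_r x hx.le t ht).fun_pow 2)).fun_mul
    (J.hasDt_qx x hx.le t ht)
  have h2 := (J.hasDt_ut x hx.le t ht).unique
    (h.congr_of_eventuallyEq (Eventually.of_forall fun s => J.momentum' x s))
  rw [h2, J.momentum']
  field_simp
  push_cast
  ring

/-- This relation and the next one come from differentiating `r² φ_x = (1 + q) u` in time. -/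
theorem r_sq_mul_φtx : J.r x t ^ 2 * J.φtx x t = (1 + J.q x t) * J.ut x t
    + J.qt x t * J.u x t - 2 * J.u x t / J.r x t * (J.r x t ^ 2 * J.φx x t) := by
  refine J.eq_of_eq_interior (f := fun x t => J.r x t ^ 2 * J.φtx x t)
    (g := fun x t => (1 + J.q x t) * J.ut x t
    + J.qt x t * J.u x t - 2 * J.u x t / J.r x t * (J.r x t ^ 2 * J.φx x t))
    (by fun_prop) (by fun_prop (disch := intro z; exact J.r_ne _ _)) ?_ hx ht
  intro x hx t ht
  have hr := J.r_ne x t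
  have h := ((J.hasDt_r x hx.le t ht).fun_pow 2).fun_mul (J.hasDt_φx x hx.le t ht)
  have h' := ((J.hasDt_q x hx.le t ht).const_add 1).fun_mul (J.hasDt_u x hx.le t ht)
  have h2 := h.unique
    (h'.congr_of_eventuallyEq (Eventually.of_forall fun s => J.velocity x s))
  field_simp
  push_cast at h2
  linear_combination h2

theorem r_sq_mul_φttx : J.r x t ^ 2 * J.φttx x t = (1 + J.q x t) * J.utt x t
    + 2 * J.qt x t * J.ut x t + J.qtt x t * J.u x t
    - 4 * J.u x t / J.r x t * (J.r x t ^ 2 * J.φtx x t)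
    - (2 * J.ut x t / J.r x t + 2 * J.u x t ^ 2 / J.r x t ^ 2) * (J.r x t ^ 2 * J.φx x t) := by
  refine J.eq_of_eq_interior (f := fun x t => J.r x t ^ 2 * J.φttx x t)
    (g := fun x t => (1 + J.q x t) * J.utt x t
    + 2 * J.qt x t * J.ut x t + J.qtt x t * J.u x t
    - 4 * J.u x t / J.r x t * (J.r x t ^ 2 * J.φtx x t)
    - (2 * J.ut x t / J.r x t + 2 * J.u x t ^ 2 / J.r x t ^ 2) * (J.r x t ^ 2 * J.φx x t))
    (by fun_prop) (by fun_prop (disch := intro z; first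
      | exact J.r_ne _ _ | exact pow_ne_zero _ (J.r_ne _ _))) ?_ hx ht
  intro x hx t ht
  have hr := J.r_ne x t
  have h := ((J.hasDt_r x hx.le t ht).fun_pow 2).fun_mul (J.hasDt_φtx x hx.le t ht)
  have h' := ((((J.hasDt_q x hx.le t ht).const_add 1).fun_mul (J.hasDt_ut x hx.le t ht)).fun_add
    ((J.hasDt_qt x hx.le t ht).fun_mul (J.hasDt_u x hx.le t ht))).fun_sub
    ((((J.hasDt_u x hx.le t ht).const_mul 2).fun_div (J.hasDt_r x hx.le t ht) hr).fun_mul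
      (((J.hasDt_r x hx.le t ht).fun_pow 2).fun_mul (J.hasDt_φx x hx.le t ht)))
  have h2 := h.unique (h'.congr_of_eventuallyEq (by
    filter_upwards [Ioo_mem_nhds ht.1 ht.2] with s hs
    exact J.r_sq_mul_φtx hx.le (Ioo_subset_Icc_self hs)))
  field_simp at h2 ⊢
  push_cast at h2
  refine mul_left_cancel₀ hr ?_
  linear_combination h2

/-- By the velocity relation `∂_x (r⁴ φ_x) = ∂_x ((1 + q) r² u) = (1 + q) q_t + r² u q_x`.
Multiplication by the squared sound speed and the momentum equation give the claim. No normalization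
of `φ` at infinity is involved. -/
theorem φtt_eq : J.φtt x t = J.s x t * (1 + J.q x t) * J.qt x t + J.u x t * J.ut x t := by
  refine J.eq_of_eq_interior (f := J.φtt)
    (g := fun x t => J.s x t * (1 + J.q x t) * J.qt x t + J.u x t * J.ut x t)
    (by fun_prop) (by fun_prop) ?_ hx ht
  intro x hx t ht
  have ht' := Ioo_subset_Icc_self ht
  have hr := J.r_ne x t
  have h := ((J.hasDx_r x hx t ht').fun_pow 2).fun_mul (J.hasDx_φx x hx t ht')
  have h' := ((J.hasDx_q x hx t ht').const_add 1).fun_mul (J.hasDx_u x hx t ht')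
  have h2 := h.unique
    (h'.congr_of_eventuallyEq (Eventually.of_forall fun s => J.velocity s t))
  have h3 := J.velocity x t
  rw [J.wave', J.momentum', J.continuity]
  have h4 : J.φx x t = (1 + J.q x t) * J.u x t / J.r x t ^ 2 := by
    rw [← h3]; field_simp
  rw [h4] at h2 ⊢
  field_simp at h2 ⊢
  push_cast at h2
  refine mul_left_cancel₀ hr ?_
  linear_combination J.s x t * h2

theorem φttt_eq : J.φttt x t = J.s x t * (1 + J.q x t) * J.qtt x t
    - J.γ * J.s x t * J.qt x t ^ 2 + J.ut x t ^ 2 + J.u x t * J.utt x t := by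
  refine J.eq_of_eq_interior (f := J.φttt)
    (g := fun x t => J.s x t * (1 + J.q x t) * J.qtt x t
    - J.γ * J.s x t * J.qt x t ^ 2 + J.ut x t ^ 2 + J.u x t * J.utt x t)
    (by fun_prop) (by fun_prop) ?_ hx ht
  intro x hx t ht
  have hq := J.one_add_q_ne x t
  have h' := (((J.hasDt_s x hx.le t ht).fun_mul ((J.hasDt_q x hx.le t ht).const_add 1)).fun_mul
    (J.hasDt_qt x hx.le t ht)).fun_add ((J.hasDt_u x hx.le t ht).fun_mul (J.hasDt_ut x hx.le t ht))
  have h2 := (J.hasDt_φtt x hx.le t ht).unique (h'.congr_of_eventuallyEq (by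
    filter_upwards [Ioo_mem_nhds ht.1 ht.2] with s hs
    exact J.φtt_eq hx.le (Ioo_subset_Icc_self hs)))
  rw [h2]
  field_simp
  ring

end Jet

/-! ### The weight `ξ` -/

/-- The weight `ξ`, extended by `1` to the negative half-line. -/
def wt (x : ℝ) : ℝ := xi (max x 0)

theorem wt_of_nonneg {x : ℝ} (hx : 0 ≤ x) : wt x = xi x := by rw [wt, max_eq_left hx]

theorem one_le_wt (x : ℝ) : 1 ≤ wt x :=
  Real.one_le_rpow (by have := le_max_right x 0; linarith) (by norm_num)

theorem wt_pos (x : ℝ) : 0 < wt x := zero_lt_one.trans_le (one_le_wt x)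

theorem wt_ne (x : ℝ) : wt x ≠ 0 := (wt_pos x).ne'

theorem wt_zero : wt 0 = 1 := by simp [wt, xi]

@[fun_prop] theorem continuous_wt : Continuous wt := by
  unfold wt xi
  exact Continuous.rpow_const (by fun_prop) fun _ => Or.inr (by norm_num)

theorem wt_cube {x : ℝ} (hx : 0 ≤ x) : wt x ^ 3 = 1 + 3 * x := by
  rw [wt_of_nonneg hx, xi, ← Real.rpow_natCast, ← Real.rpow_mul (by positivity)]
  norm_num

theorem hasDerivAt_wt {x : ℝ} (hx : 0 < x) : HasDerivAt wt (wt x ^ 2)⁻¹ x := by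
  have h1 : HasDerivAt (fun y : ℝ => 1 + 3 * y) (3 * 1) x :=
    ((hasDerivAt_id x).const_mul 3).const_add 1
  have h2 := hasDerivAt_cbrt h1 (by positivity)
  have h3 : HasDerivAt xi (wt x ^ 2)⁻¹ x := by
    refine h2.congr_deriv ?_
    have := wt_ne x
    change _ / (3 * xi x ^ 2) = _
    rw [← wt_of_nonneg hx.le]
    field_simp
  refine h3.congr_of_eventuallyEq ?_
  filter_upwards [Ioi_mem_nhds hx] with y hy
  exact wt_of_nonneg (le_of_lt hy)

theorem tendsto_wt : Tendsto wt atTop atTop := by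
  have h : Tendsto xi atTop atTop := by
    unfold xi
    exact (tendsto_rpow_atTop (by norm_num)).comp
      (tendsto_atTop_add_const_left _ _ (tendsto_id.const_mul_atTop (by norm_num)))
  refine h.congr' ?_
  filter_upwards [eventually_ge_atTop 0] with x hx
  exact (wt_of_nonneg hx).symm

/-! ### One-dimensional inequalities -/

theorem integral_eq_sub_of_pos {f f' : ℝ → ℝ} (hf : Continuous f) (hf' : Continuous f')
    (h : ∀ x, 0 < x → HasDerivAt f (f' x) x) {a b : ℝ} (ha : 0 ≤ a) (hab : a ≤ b) :
    ∫ x in a..b, f' x = f b - f a :=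
  intervalIntegral.integral_eq_sub_of_hasDerivAt_of_le hab hf.continuousOn
    (fun x hx => h x (ha.trans_lt hx.1)) (hf'.intervalIntegrable _ _)

theorem integral_mono_of_le {f g : ℝ → ℝ} (hf : Continuous f) (hg : Continuous g) {a b : ℝ}
    (hab : a ≤ b) (h : ∀ x ∈ Icc a b, f x ≤ g x) : ∫ x in a..b, f x ≤ ∫ x in a..b, g x :=
  intervalIntegral.integral_mono_on hab (hf.intervalIntegrable _ _) (hg.intervalIntegrable _ _) h

theorem integral_le_integral_of_le {f : ℝ → ℝ} (hf : Continuous f) {a b c d : ℝ} (hab : a ≤ b)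
    (hca : c ≤ a) (hbd : b ≤ d) (h : ∀ x ∈ Icc c d, 0 ≤ f x) :
    ∫ x in a..b, f x ≤ ∫ x in c..d, f x := by
  refine intervalIntegral.integral_mono_interval hca hab hbd ?_ (hf.intervalIntegrable _ _)
  refine (ae_restrict_iff' measurableSet_Ioc).2 (Eventually.of_forall fun x hx => ?_)
  exact h x (Ioc_subset_Icc_self hx)

/-- A nonnegative function that is integrable against `ξ⁻² dx` is small somewhere far out. -/
theorem exists_le_of_integral_le {h : ℝ → ℝ} (hc : Continuous h) (h0 : ∀ x, 0 ≤ x → 0 ≤ h x)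
    {A : ℝ} (hA : ∀ X, 0 ≤ X → ∫ x in (0 : ℝ)..X, (wt x ^ 2)⁻¹ * h x ≤ A) {δ : ℝ} (hδ : 0 < δ)
    (N : ℝ) : ∃ X, N ≤ X ∧ 0 ≤ X ∧ h X ≤ δ := by
  by_contra! hcon
  set M := max N 0
  have hM : 0 ≤ M := le_max_right _ _
  have hw : Continuous fun x => (wt x ^ 2)⁻¹ :=
    Continuous.inv₀ (by fun_prop) fun x => pow_ne_zero _ (wt_ne x)
  -- The primitive of `ξ⁻²` is `ξ`, which is unbounded; this `X` makes the mass of `[M, X]` exceed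
  -- `A / δ`.
  obtain ⟨X, hX1, hX2⟩ := ((tendsto_wt.eventually_gt_atTop (wt M + A / δ)).and
    (eventually_ge_atTop M)).exists
  have h1 : ∫ x in M..X, (wt x ^ 2)⁻¹ * δ = (wt X - wt M) * δ := by
    rw [intervalIntegral.integral_mul_const, integral_eq_sub_of_pos continuous_wt hw
      (fun x hx => hasDerivAt_wt hx) hM hX2]
  have h2 : ∫ x in M..X, (wt x ^ 2)⁻¹ * δ ≤ ∫ x in M..X, (wt x ^ 2)⁻¹ * h x := by
    refine integral_mono_of_le (hw.mul continuous_const) (hw.mul hc) hX2 fun x hx => ?_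
    have h1 := hcon x ((le_max_left _ _).trans hx.1) (hM.trans hx.1)
    have h2 := wt_pos x
    exact mul_le_mul_of_nonneg_left h1.le (by positivity)
  have h3 : ∫ x in M..X, (wt x ^ 2)⁻¹ * h x ≤ ∫ x in (0 : ℝ)..X, (wt x ^ 2)⁻¹ * h x := by
    refine integral_le_integral_of_le (hw.mul hc) hX2 hM le_rfl fun x hx => ?_
    have h1 := h0 x hx.1
    have h2 := wt_pos x
    exact mul_nonneg (by positivity) h1
  have h4 := hA X (hM.trans hX2)
  have h5 : A / δ * δ < (wt X - wt M) * δ := by gcongr; linarith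
  rw [div_mul_cancel₀ _ hδ.ne'] at h5
  linarith

/-- Integrate the derivative from `x` to a far point at which `h` is at most `δ`, then let `δ` tend
to zero. The bound `A'` serves only to find that point and does not enter the result. -/
theorem le_of_abs_deriv_le {h h' k : ℝ → ℝ} (hc : Continuous h) (hc' : Continuous h')
    (hk : Continuous k) (hd : ∀ x, 0 < x → HasDerivAt h (h' x) x) (h0 : ∀ x, 0 ≤ x → 0 ≤ h x)
    (hle : ∀ x, 0 ≤ x → |h' x| ≤ k x) {A A' : ℝ}
    (hA : ∀ X, 0 ≤ X → ∫ x in (0 : ℝ)..X, k x ≤ A)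
    (hA' : ∀ X, 0 ≤ X → ∫ x in (0 : ℝ)..X, (wt x ^ 2)⁻¹ * h x ≤ A') {x : ℝ} (hx : 0 ≤ x) :
    h x ≤ A := by
  refine le_of_forall_pos_le_add fun δ hδ => ?_
  obtain ⟨X, hX, hX0, hXδ⟩ := exists_le_of_integral_le hc h0 hA' hδ x
  have h1 := integral_eq_sub_of_pos hc hc' hd hx hX
  have h2 : ∫ y in x..X, -k y ≤ ∫ y in x..X, h' y :=
    integral_mono_of_le hk.neg hc' hX fun y hy => (abs_le.1 (hle y (hx.trans hy.1))).1
  rw [intervalIntegral.integral_neg] at h2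
  have h3 : ∫ y in x..X, k y ≤ ∫ y in (0 : ℝ)..X, k y :=
    integral_le_integral_of_le hk hX hx le_rfl fun y hy => (abs_nonneg _).trans (hle y hy.1)
  linarith [hA X hX0]

theorem abs_mul_mul_le {c M D a b : ℝ} (hc : |c| ≤ M) (ha : a ^ 2 ≤ D) (hb : b ^ 2 ≤ D) :
    |c * (a * b)| ≤ M * D := by
  rw [abs_mul]
  have h1 : |a * b| ≤ D := by
    rw [abs_le]; constructor <;> nlinarith [sq_nonneg (a + b), sq_nonneg (a - b)]
  have := (abs_nonneg c).trans hc
  gcongr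

theorem abs_mul_le_of_le {a b A B : ℝ} (ha : |a| ≤ A) (hb : |b| ≤ B) : |a * b| ≤ A * B := by
  rw [abs_mul]
  have := (abs_nonneg a).trans ha
  gcongr

theorem abs_div_le_of_le {a b A B : ℝ} (ha : |a| ≤ A) (hb : 0 < b) (hB : 1 ≤ B * b) :
    |a / b| ≤ A * B := by
  rw [div_eq_mul_inv]
  refine abs_mul_le_of_le ha ?_
  rw [abs_of_pos (inv_pos.2 hb), inv_le_iff_one_le_mul₀ hb]
  exact hB

theorem abs_add_le_of_le {a b A B : ℝ} (ha : |a| ≤ A) (hb : |b| ≤ B) : |a + b| ≤ A + B :=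
  (abs_add_le a b).trans (add_le_add ha hb)

theorem abs_sub_le_of_le {a b A B : ℝ} (ha : |a| ≤ A) (hb : |b| ≤ B) : |a - b| ≤ A + B :=
  (abs_sub a b).trans (add_le_add ha hb)

/-! ### Pointwise bounds -/

namespace Jet

/-- The sum of the squares of the time derivatives of order at most two. -/
def energyDensity (J : Jet) (x t : ℝ) : ℝ :=
  J.u x t ^ 2 + J.ut x t ^ 2 + J.utt x t ^ 2 + J.q x t ^ 2 + J.qt x t ^ 2 + J.qtt x t ^ 2

/-- The flow has radius comparable to `ξ`, sound speed comparable to `1`, and energy of size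
`ε²`. -/
structure EnergyBound (J : Jet) (K ε : ℝ) : Prop where
  one_le : 1 ≤ K
  ε_pos : 0 < ε
  ε_le_one : ε ≤ 1
  γ_le : J.γ + 1 ≤ K
  wt_le : ∀ x, 0 ≤ x → ∀ t ∈ Icc 0 J.T, wt x ≤ K * J.r x t
  r_le : ∀ x, 0 ≤ x → ∀ t ∈ Icc 0 J.T, J.r x t ≤ K * wt x
  one_le_s : ∀ x, 0 ≤ x → ∀ t ∈ Icc 0 J.T, 1 ≤ K * J.s x t
  s_le : ∀ x, 0 ≤ x → ∀ t ∈ Icc 0 J.T, J.s x t ≤ K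
  energy_le : ∀ t ∈ Icc 0 J.T, ∀ X, 0 ≤ X → ∫ x in (0 : ℝ)..X, J.energyDensity x t ≤ K * ε ^ 2

/-- Pointwise decay of the lower-order derivatives. -/
structure PointBound (J : Jet) (K ε : ℝ) : Prop where
  abs_u : ∀ x, 0 ≤ x → ∀ t ∈ Icc 0 J.T, |J.u x t| ≤ K * (ε / wt x)
  abs_ut : ∀ x, 0 ≤ x → ∀ t ∈ Icc 0 J.T, |J.ut x t| ≤ K * (ε / wt x)
  abs_q : ∀ x, 0 ≤ x → ∀ t ∈ Icc 0 J.T, |J.q x t| ≤ K * (ε / wt x)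
  abs_qt : ∀ x, 0 ≤ x → ∀ t ∈ Icc 0 J.T, |J.qt x t| ≤ K * (ε / wt x)

variable {J : Jet} {K ε : ℝ}

theorem EnergyBound.one_le_mul_r (hb : J.EnergyBound K ε) {x t : ℝ} (hx : 0 ≤ x)
    (ht : t ∈ Icc 0 J.T) : 1 ≤ K * J.r x t :=
  (one_le_wt x).trans (hb.wt_le x hx t ht)

theorem abs_one_add_q_le (J : Jet) (x t : ℝ) : |1 + J.q x t| ≤ 2 := by
  have := J.q_mem x t
  rw [abs_le]; constructor <;> linarith [this.1, this.2]

theorem one_le_mul_one_add_q (J : Jet) (x t : ℝ) : 1 ≤ 2 * (1 + J.q x t) := by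
  have := (J.q_mem x t).1
  linarith

/-- A Sobolev bound with decay: the derivative of `(r g)²` is the expression in the hypothesis `h`,
hence dominated by the energy density. Since `r` is comparable to `ξ`, a bound on `r g` is the decay
`1/ξ`. Each application replaces `r² g_x` by time derivatives through the equations. -/
theorem EnergyBound.abs_le_of_hasDx (hb : J.EnergyBound K ε) {g gx : ℝ → ℝ → ℝ}
    (hg : Continuous fun z : ℝ × ℝ => g z.1 z.2) (hgx : Continuous fun z : ℝ × ℝ => gx z.1 z.2)
    (hd : HasDx J.T g gx) {C : ℝ} (hC : 0 ≤ C)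
    (h : ∀ x, 0 ≤ x → ∀ t ∈ Icc 0 J.T,
      |2 * (1 + J.q x t) / J.r x t * (g x t * g x t) + 2 * (g x t * (J.r x t ^ 2 * gx x t))|
        ≤ C * J.energyDensity x t)
    (hle : ∀ x t, g x t ^ 2 ≤ J.energyDensity x t) {x t : ℝ} (hx : 0 ≤ x) (ht : t ∈ Icc 0 J.T) :
    |g x t| ≤ (K ^ 3 * C + 1) * (ε / wt x) := by
  have hK := hb.one_le
  have cg : Continuous fun x => g x t := hg.comp (f := fun x => (x, t)) (by fun_prop)
  have cgx : Continuous fun x => gx x t := hgx.comp (f := fun x => (x, t)) (by fun_prop)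
  have cD : Continuous fun x => J.energyDensity x t := by unfold energyDensity; fun_prop
  have hw : Continuous fun x => (wt x ^ 2)⁻¹ :=
    Continuous.inv₀ (by fun_prop) fun x => pow_ne_zero _ (wt_ne x)
  have key : (J.r x t * g x t) ^ 2 ≤ C * (K * ε ^ 2) := by
    refine le_of_abs_deriv_le (h := fun x => (J.r x t * g x t) ^ 2)
      (h' := fun x => 2 * (1 + J.q x t) / J.r x t * (g x t * g x t)
        + 2 * (g x t * (J.r x t ^ 2 * gx x t)))
      (k := fun x => C * J.energyDensity x t) (A' := K ^ 2 * (K * ε ^ 2)) (by fun_prop)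
      (by fun_prop (disch := intro z; exact J.r_ne _ _)) (by fun_prop) ?_
      (fun x _ => sq_nonneg _) (fun x hx => h x hx t ht) ?_ ?_ hx
    · intro x hx
      refine (((J.hasDx_r x hx t ht).fun_mul (hd x hx t ht)).fun_pow 2).congr_deriv ?_
      have := J.r_ne x t
      field_simp
      push_cast
      ring
    · intro X hX
      rw [intervalIntegral.integral_const_mul]
      exact mul_le_mul_of_nonneg_left (hb.energy_le t ht X hX) hC
    · intro X hX
      refine (integral_mono_of_le (g := fun x => K ^ 2 * J.energyDensity x t)
        (hw.mul (by fun_prop)) (by fun_prop) hX fun x hx => ?_).trans ?_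
      · have h1 := hb.r_le x hx.1 t ht
        have h2 := (J.r_pos x t).le
        have h3 := hle x t
        have h4 := wt_pos x
        calc (wt x ^ 2)⁻¹ * (J.r x t * g x t) ^ 2
            ≤ (wt x ^ 2)⁻¹ * ((K * wt x) ^ 2 * g x t ^ 2) := by rw [mul_pow]; gcongr
          _ = K ^ 2 * g x t ^ 2 := by field_simp
          _ ≤ _ := by gcongr
      · rw [intervalIntegral.integral_const_mul]
        exact mul_le_mul_of_nonneg_left (hb.energy_le t ht X hX) (by positivity)
  have hwp := wt_pos x
  have hεp := hb.ε_pos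
  rw [← mul_div_assoc, le_div_iff₀ hwp, ← abs_of_pos hwp, ← abs_mul]
  refine abs_le_of_sq_le_sq ?_ (by positivity)
  have h1 : wt x ^ 2 ≤ (K * J.r x t) ^ 2 := by
    have := hb.wt_le x hx t ht; gcongr
  calc (g x t * wt x) ^ 2 = wt x ^ 2 * g x t ^ 2 := by ring
    _ ≤ (K * J.r x t) ^ 2 * g x t ^ 2 := by gcongr
    _ = K ^ 2 * (J.r x t * g x t) ^ 2 := by ring
    _ ≤ K ^ 2 * (C * (K * ε ^ 2)) := by gcongr
    _ = (K ^ 3 * C) * ε ^ 2 := by ring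
    -- A square root of the constant is avoided through `a ≤ (a + 1)²`.
    _ ≤ (K ^ 3 * C + 1) ^ 2 * ε ^ 2 := by
        have : 0 ≤ K ^ 3 * C := by positivity
        gcongr; nlinarith
    _ = ((K ^ 3 * C + 1) * ε) ^ 2 := by ring

theorem div_wt_le_one (hb : J.EnergyBound K ε) (x : ℝ) : ε / wt x ≤ 1 := by
  rw [div_le_one (wt_pos x)]; exact hb.ε_le_one.trans (one_le_wt x)

section

variable (J : Jet) (x t : ℝ)

theorem u_sq_le : J.u x t ^ 2 ≤ J.energyDensity x t := by
  unfold energyDensity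
  nlinarith [sq_nonneg (J.ut x t), sq_nonneg (J.utt x t), sq_nonneg (J.q x t), sq_nonneg (J.qt x t),
    sq_nonneg (J.qtt x t)]

theorem ut_sq_le : J.ut x t ^ 2 ≤ J.energyDensity x t := by
  unfold energyDensity
  nlinarith [sq_nonneg (J.u x t), sq_nonneg (J.utt x t), sq_nonneg (J.q x t), sq_nonneg (J.qt x t),
    sq_nonneg (J.qtt x t)]

theorem utt_sq_le : J.utt x t ^ 2 ≤ J.energyDensity x t := by
  unfold energyDensity
  nlinarith [sq_nonneg (J.u x t), sq_nonneg (J.ut x t), sq_nonneg (J.q x t), sq_nonneg (J.qt x t),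
    sq_nonneg (J.qtt x t)]

theorem q_sq_le : J.q x t ^ 2 ≤ J.energyDensity x t := by
  unfold energyDensity
  nlinarith [sq_nonneg (J.u x t), sq_nonneg (J.ut x t), sq_nonneg (J.utt x t), sq_nonneg (J.qt x t),
    sq_nonneg (J.qtt x t)]

theorem qt_sq_le : J.qt x t ^ 2 ≤ J.energyDensity x t := by
  unfold energyDensity
  nlinarith [sq_nonneg (J.u x t), sq_nonneg (J.ut x t), sq_nonneg (J.utt x t), sq_nonneg (J.q x t),
    sq_nonneg (J.qtt x t)]

theorem qtt_sq_le : J.qtt x t ^ 2 ≤ J.energyDensity x t := by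
  unfold energyDensity
  nlinarith [sq_nonneg (J.u x t), sq_nonneg (J.ut x t), sq_nonneg (J.utt x t), sq_nonneg (J.q x t),
    sq_nonneg (J.qt x t)]

end

namespace EnergyBound

variable (hb : J.EnergyBound K ε)
include hb

theorem K_nonneg : 0 ≤ K := zero_le_one.trans hb.one_le

theorem abs_two_mul_one_add_q_div_r_le {x t : ℝ} (hx : 0 ≤ x) (ht : t ∈ Icc 0 J.T) :
    |2 * (1 + J.q x t) / J.r x t| ≤ 2 * 2 * K :=
  abs_div_le_of_le (abs_mul_le_of_le (by norm_num) (J.abs_one_add_q_le x t)) (J.r_pos x t)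
    (hb.one_le_mul_r hx ht)

theorem abs_inv_r_le {x t : ℝ} (hx : 0 ≤ x) (ht : t ∈ Icc 0 J.T) : |1 / J.r x t| ≤ 1 * K :=
  abs_div_le_of_le (by norm_num) (J.r_pos x t) (hb.one_le_mul_r hx ht)

theorem abs_inv_s_le {x t : ℝ} (hx : 0 ≤ x) (ht : t ∈ Icc 0 J.T) : |1 / J.s x t| ≤ 1 * K :=
  abs_div_le_of_le (by norm_num) (J.s_pos x t) (hb.one_le_s x hx t ht)

theorem abs_u_le : ∀ x, 0 ≤ x → ∀ t ∈ Icc 0 J.T,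
    |J.u x t| ≤ (K ^ 3 * (2 * 2 * K + 2) + 1) * (ε / wt x) := by
  intro x hx t ht
  have hK := hb.K_nonneg
  refine hb.abs_le_of_hasDx J.cont_u J.cont_ux J.hasDx_u (by positivity) ?_ J.u_sq_le hx ht
  intro x hx t ht
  have e : 2 * (1 + J.q x t) / J.r x t * (J.u x t * J.u x t)
      + 2 * (J.u x t * (J.r x t ^ 2 * J.ux x t))
      = 2 * (J.u x t * J.qt x t) - 2 * (1 + J.q x t) / J.r x t * (J.u x t * J.u x t) := by
    rw [J.continuity]; have := J.r_ne x t; field_simp; ring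
  rw [e, add_comm _ 2, add_mul]
  exact abs_sub_le_of_le (abs_mul_mul_le (by norm_num) (J.u_sq_le x t) (J.qt_sq_le x t))
    (abs_mul_mul_le (hb.abs_two_mul_one_add_q_div_r_le hx ht) (J.u_sq_le x t) (J.u_sq_le x t))

theorem abs_q_le : ∀ x, 0 ≤ x → ∀ t ∈ Icc 0 J.T,
    |J.q x t| ≤ (K ^ 3 * (2 * 2 * K + 2 * (1 * K)) + 1) * (ε / wt x) := by
  intro x hx t ht
  have hK := hb.K_nonneg
  refine hb.abs_le_of_hasDx J.cont_q J.cont_qx J.hasDx_q (by positivity) ?_ J.q_sq_le hx ht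
  intro x hx t ht
  have e : 2 * (1 + J.q x t) / J.r x t * (J.q x t * J.q x t)
      + 2 * (J.q x t * (J.r x t ^ 2 * J.qx x t))
      = 2 * (1 + J.q x t) / J.r x t * (J.q x t * J.q x t)
        + 2 * (1 / J.s x t) * (J.q x t * J.ut x t) := by
    rw [J.momentum']; have := J.s_ne x t; field_simp
  rw [e, add_mul]
  exact abs_add_le_of_le
    (abs_mul_mul_le (hb.abs_two_mul_one_add_q_div_r_le hx ht) (J.q_sq_le x t) (J.q_sq_le x t))
    (abs_mul_mul_le (abs_mul_le_of_le (by norm_num) (hb.abs_inv_s_le hx ht))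
      (J.q_sq_le x t) (J.ut_sq_le x t))

/-- The formula for `r² u_tx` is quadratic in lower-order terms, so one factor `u` must already be
known to be bounded. -/
theorem abs_ut_le {M : ℝ} (hM : 0 ≤ M) (hu : ∀ x, 0 ≤ x → ∀ t ∈ Icc 0 J.T, |J.u x t| ≤ M) :
    ∀ x, 0 ≤ x → ∀ t ∈ Icc 0 J.T, |J.ut x t|
      ≤ (K ^ 3 * (2 + 8 * M * (1 * K) + 12 * 2 * M * (1 * K * (1 * K)) + 2 * 2 * K) + 1)
        * (ε / wt x) := by
  intro x hx t ht
  have hK := hb.K_nonneg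
  refine hb.abs_le_of_hasDx J.cont_ut J.cont_utx J.hasDx_ut (by positivity) ?_ J.ut_sq_le hx ht
  intro x hx t ht
  have e : 2 * (1 + J.q x t) / J.r x t * (J.ut x t * J.ut x t)
      + 2 * (J.ut x t * (J.r x t ^ 2 * J.utx x t))
      = 2 * (J.ut x t * J.qtt x t) - 8 * J.u x t * (1 / J.r x t) * (J.ut x t * J.qt x t)
        + 12 * (1 + J.q x t) * J.u x t * (1 / J.r x t * (1 / J.r x t)) * (J.ut x t * J.u x t)
        - 2 * (1 + J.q x t) / J.r x t * (J.ut x t * J.ut x t) := by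
    rw [J.r_sq_mul_utx hx ht]; have := J.r_ne x t; field_simp; ring
  have h1 := hb.abs_inv_r_le hx ht
  rw [e, add_mul, add_mul, add_mul]
  refine abs_sub_le_of_le (abs_add_le_of_le (abs_sub_le_of_le
    (abs_mul_mul_le (by norm_num) (J.ut_sq_le x t) (J.qtt_sq_le x t))
    (abs_mul_mul_le (abs_mul_le_of_le (abs_mul_le_of_le (by norm_num) (hu x hx t ht)) h1)
      (J.ut_sq_le x t) (J.qt_sq_le x t)))
    (abs_mul_mul_le (abs_mul_le_of_le (abs_mul_le_of_le (abs_mul_le_of_le (by norm_num)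
      (J.abs_one_add_q_le x t)) (hu x hx t ht)) (abs_mul_le_of_le h1 h1))
      (J.ut_sq_le x t) (J.u_sq_le x t)))
    (abs_mul_mul_le (hb.abs_two_mul_one_add_q_div_r_le hx ht) (J.ut_sq_le x t) (J.ut_sq_le x t))

/-- Here `r² q_tx` comes from the differentiated momentum equation. Its nonlinear terms need prior
bounds on both `u` and `u_t`. -/
theorem abs_qt_le {M : ℝ} (hM : 0 ≤ M) (hu : ∀ x, 0 ≤ x → ∀ t ∈ Icc 0 J.T, |J.u x t| ≤ M)
    (hut : ∀ x, 0 ≤ x → ∀ t ∈ Icc 0 J.T, |J.ut x t| ≤ M) :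
    ∀ x, 0 ≤ x → ∀ t ∈ Icc 0 J.T, |J.qt x t|
      ≤ (K ^ 3 * (2 * 2 * K + 2 * (1 * K) + 2 * (1 * K) * K * M * 2
        + 4 * (1 * K) * M * (1 * K)) + 1) * (ε / wt x) := by
  intro x hx t ht
  have hK := hb.K_nonneg
  refine hb.abs_le_of_hasDx J.cont_qt J.cont_qtx J.hasDx_qt (by positivity) ?_ J.qt_sq_le hx ht
  intro x hx t ht
  have e : 2 * (1 + J.q x t) / J.r x t * (J.qt x t * J.qt x t)
      + 2 * (J.qt x t * (J.r x t ^ 2 * J.qtx x t))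
      = 2 * (1 + J.q x t) / J.r x t * (J.qt x t * J.qt x t)
        + 2 * (1 / J.s x t) * (J.qt x t * J.utt x t)
        + 2 * (1 / J.s x t) * (J.γ + 1) * J.ut x t / (1 + J.q x t) * (J.qt x t * J.qt x t)
        - 4 * (1 / J.s x t) * J.u x t * (1 / J.r x t) * (J.qt x t * J.ut x t) := by
    rw [J.utt_eq hx ht]
    have := J.s_ne x t
    have := J.r_ne x t
    have := J.one_add_q_ne x t
    field_simp
    ring
  have h1 := hb.abs_inv_r_le hx ht
  have h2 := hb.abs_inv_s_le hx ht
  have h3 : |J.γ + 1| ≤ K := by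
    rw [abs_of_nonneg (by have := J.one_lt_γ; linarith)]; exact hb.γ_le
  rw [e, add_mul, add_mul, add_mul]
  refine abs_sub_le_of_le (abs_add_le_of_le (abs_add_le_of_le
    (abs_mul_mul_le (hb.abs_two_mul_one_add_q_div_r_le hx ht) (J.qt_sq_le x t) (J.qt_sq_le x t))
    (abs_mul_mul_le (abs_mul_le_of_le (by norm_num) h2) (J.qt_sq_le x t) (J.utt_sq_le x t)))
    (abs_mul_mul_le (abs_div_le_of_le (abs_mul_le_of_le (abs_mul_le_of_le (abs_mul_le_of_le
      (by norm_num) h2) h3) (hut x hx t ht)) (J.one_add_q_pos x t) (J.one_le_mul_one_add_q x t))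
      (J.qt_sq_le x t) (J.qt_sq_le x t)))
    (abs_mul_mul_le (abs_mul_le_of_le (abs_mul_le_of_le (abs_mul_le_of_le (by norm_num) h2)
      (hu x hx t ht)) h1) (J.qt_sq_le x t) (J.ut_sq_le x t))

end EnergyBound

/-- Bounded energy implies smallness and decay of the lower-order derivatives. -/
theorem exists_pointBound (K : ℝ) : ∃ K', ∀ (J : Jet) (ε : ℝ), J.EnergyBound K ε →
    J.PointBound K' ε := by
  by_cases hK : 0 ≤ K
  swap
  · exact ⟨0, fun J ε hb => absurd hb.K_nonneg hK⟩
  set K1 := K ^ 3 * (2 * 2 * K + 2) + 1 with hK1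
  set K2 := K ^ 3 * (2 + 8 * K1 * (1 * K) + 12 * 2 * K1 * (1 * K * (1 * K)) + 2 * 2 * K) + 1
    with hK2
  have h1 : 0 ≤ K1 := by positivity
  have h2 : 0 ≤ K2 := by positivity
  set K3 := K ^ 3 * (2 * 2 * K + 2 * (1 * K) + 2 * (1 * K) * K * (K1 + K2) * 2
        + 4 * (1 * K) * (K1 + K2) * (1 * K)) + 1 with hK3
  set K4 := K ^ 3 * (2 * 2 * K + 2 * (1 * K)) + 1 with hK4
  have h3 : 0 ≤ K3 := by positivity
  have h4 : 0 ≤ K4 := by positivity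
  refine ⟨K1 + K2 + K3 + K4, fun J ε hb => ?_⟩
  have hw : ∀ x, 0 ≤ ε / wt x := fun x => div_nonneg hb.ε_pos.le (wt_pos x).le
  have hle : ∀ x {a c : ℝ}, 0 ≤ c → a ≤ c * (ε / wt x) → a ≤ c := fun x a c hc h =>
    h.trans (mul_le_of_le_one_right hc (div_wt_le_one hb x))
  -- The order is forced: `u` first, then `u_t`, which uses it, then `q_t`, which uses both. The
  -- bound on `q` is independent of the others.
  have hu := hb.abs_u_le
  have hu1 : ∀ x, 0 ≤ x → ∀ t ∈ Icc 0 J.T, |J.u x t| ≤ K1 := fun x hx t ht =>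
    hle x h1 (hu x hx t ht)
  have hut := hb.abs_ut_le h1 hu1
  have hut1 : ∀ x, 0 ≤ x → ∀ t ∈ Icc 0 J.T, |J.ut x t| ≤ K2 := fun x hx t ht =>
    hle x h2 (hut x hx t ht)
  have hqt := hb.abs_qt_le (M := K1 + K2) (by positivity)
    (fun x hx t ht => (hu1 x hx t ht).trans (by linarith))
    (fun x hx t ht => (hut1 x hx t ht).trans (by linarith))
  have hq := hb.abs_q_le
  constructor
  · exact fun x hx t ht => (hu x hx t ht).trans
      (mul_le_mul_of_nonneg_right (by linarith) (hw x))
  · exact fun x hx t ht => (hut x hx t ht).trans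
      (mul_le_mul_of_nonneg_right (by linarith) (hw x))
  · exact fun x hx t ht => (hq x hx t ht).trans
      (mul_le_mul_of_nonneg_right (by linarith) (hw x))
  · exact fun x hx t ht => (hqt x hx t ht).trans
      (mul_le_mul_of_nonneg_right (by linarith) (hw x))

end Jet

theorem HasDt.mono {T T' : ℝ} {f f' : ℝ → ℝ → ℝ} (h : HasDt T f f') (hT : T' ≤ T) :
    HasDt T' f f' := fun x hx t ht => h x hx t ⟨ht.1, ht.2.trans_le hT⟩

theorem HasDx.mono {T T' : ℝ} {f f' : ℝ → ℝ → ℝ} (h : HasDx T f f') (hT : T' ≤ T) :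
    HasDx T' f f' := fun x hx t ht => h x hx t ⟨ht.1, ht.2.trans hT⟩

theorem continuous_integral {f : ℝ → ℝ → ℝ} (hf : Continuous fun z : ℝ × ℝ => f z.1 z.2)
    (a b : ℝ) : Continuous fun t => ∫ x in a..b, f x t :=
  intervalIntegral.continuous_parametric_intervalIntegral_of_continuous'
    (f := fun t x => f x t) (hf.comp continuous_swap) a b

namespace Jet

variable (J : Jet)

/-! ### The multiplier identity -/

/-- `r² ∂_x v + (1 + q) v / r = r ∂_x (r v)`. -/
def radial (v vx : ℝ → ℝ → ℝ) (x t : ℝ) : ℝ :=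
  J.r x t ^ 2 * vx x t + (1 + J.q x t) * v x t / J.r x t

/-- The density `(∂_t v)² + c² (r ∂_x (r v))²`. -/
def mulDensity (v vt vx : ℝ → ℝ → ℝ) (x t : ℝ) : ℝ :=
  vt x t ^ 2 + J.s x t * J.radial v vx x t ^ 2

/-- The error density in the multiplier identity. -/
def mulError (v vt vx F : ℝ → ℝ → ℝ) (x t : ℝ) : ℝ :=
  J.radial v vx x t * F x t - J.s x t * J.qx x t * J.r x t * v x t * J.radial v vx x t
    + vt x t * (J.u x t / J.r x t) * J.radial v vx x t
    + vt x t * (J.r x t * J.ux x t * v x t + J.r x t * J.u x t * vx x t)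
    + 1 / 2 * (J.γ + 1) * J.s x t * J.qx x t / (1 + J.q x t) * J.r x t ^ 2
      * J.radial v vx x t ^ 2

/-- The integrated multiplier identity on `[0, X] × [0, T']`. -/
def MultiplierIdentity (g g' : ℝ → ℝ) (X T' : ℝ) (v vt vx F : ℝ → ℝ → ℝ) : Prop :=
  (∫ x in (0 : ℝ)..X, (g x * vt x T' * J.radial v vx x T' - g x * vt x 0 * J.radial v vx x 0))
    = (∫ t in (0 : ℝ)..T', (1 / 2 * g X * J.r X t ^ 2 * J.mulDensity v vt vx X t
        - 1 / 2 * g 0 * J.r 0 t ^ 2 * J.mulDensity v vt vx 0 t))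
      - (∫ t in (0 : ℝ)..T', ∫ x in (0 : ℝ)..X,
          1 / 2 * g' x * J.r x t ^ 2 * J.mulDensity v vt vx x t)
      + ∫ t in (0 : ℝ)..T', ∫ x in (0 : ℝ)..X, g x * J.mulError v vt vx F x t

variable {J}

theorem continuous_radial {α : Type*} [TopologicalSpace α] {v vx : α → ℝ → ℝ → ℝ} {a b : α → ℝ}
    (ha : Continuous a) (hb : Continuous b)
    (hv : Continuous fun z => v z (a z) (b z)) (hvx : Continuous fun z => vx z (a z) (b z)) :
    Continuous fun z => J.radial (v z) (vx z) (a z) (b z) := by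
  exact (((J.continuous_r ha hb).pow 2).mul hvx).add
    (((continuous_const.add (J.continuous_q ha hb)).mul hv).div (J.continuous_r ha hb)
      fun _ => J.r_ne _ _)

/-- With `w = r v` one has `Z = (1 + q) w_r / r`, so `g v_t Z dx` is approximately `g w_t w_r dr`,
the momentum density of a one-dimensional wave equation. Its time derivative is an exact
`x`-derivative of the flux, minus the term in which the derivative falls on `g`, plus terms produced
by the motion of the background. Integration over the rectangle gives the claim. -/
theorem multiplierIdentity {T' : ℝ} (hT' : 0 ≤ T') (hTT : T' ≤ J.T) {g g' : ℝ → ℝ}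
    (hg : Continuous g) (hg' : Continuous g') (hgd : ∀ x, 0 < x → HasDerivAt g (g' x) x)
    {v vt vx vtt vtx vxx F : ℝ → ℝ → ℝ}
    (cv : Continuous fun z : ℝ × ℝ => v z.1 z.2) (cvt : Continuous fun z : ℝ × ℝ => vt z.1 z.2)
    (cvx : Continuous fun z : ℝ × ℝ => vx z.1 z.2)
    (cvtx : Continuous fun z : ℝ × ℝ => vtx z.1 z.2)
    (cvxx : Continuous fun z : ℝ × ℝ => vxx z.1 z.2)
    (cF : Continuous fun z : ℝ × ℝ => F z.1 z.2)
    (tv : HasDt T' v vt) (tvt : HasDt T' vt vtt) (tvx : HasDt T' vx vtx)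
    (xv : HasDx T' v vx) (xvt : HasDx T' vt vtx) (xvx : HasDx T' vx vxx)
    (heq : ∀ x, 0 ≤ x → ∀ t ∈ Ioo 0 T', vtt x t = J.s x t
      * (J.r x t ^ 4 * vxx x t + 4 * J.r x t * (1 + J.q x t) * vx x t) + F x t)
    {X : ℝ} (hX : 0 ≤ X) : J.MultiplierIdentity g g' X T' v vt vx F := by
  have cZ : Continuous fun z : ℝ × ℝ => J.radial v vx z.1 z.2 := by
    unfold radial
    fun_prop (disch := intro z; exact J.r_ne _ _)
  set Z := J.radial v vx with hZ
  let Zt : ℝ → ℝ → ℝ := fun x t => 2 * J.r x t * J.u x t * vx x t + J.r x t ^ 2 * vtx x t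
    + J.qt x t * v x t / J.r x t + (1 + J.q x t) * vt x t / J.r x t
    - (1 + J.q x t) * v x t * J.u x t / J.r x t ^ 2
  let Zx : ℝ → ℝ → ℝ := fun x t => 2 * (1 + J.q x t) / J.r x t * vx x t + J.r x t ^ 2 * vxx x t
    + J.qx x t * v x t / J.r x t + (1 + J.q x t) * vx x t / J.r x t
    - (1 + J.q x t) ^ 2 * v x t / J.r x t ^ 4
  have tZ : HasDt T' Z Zt := fun x hx t ht => by
    have hr := (J.hasDt_r.mono hTT) x hx t ht
    have hr0 := J.r_ne x t
    refine (((hr.fun_pow 2).fun_mul (tvx x hx t ht)).fun_add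
      ((((J.hasDt_q.mono hTT x hx t ht).const_add 1).fun_mul (tv x hx t ht)).fun_div hr
        hr0)).congr_deriv ?_
    simp only [Zt]
    field_simp
    push_cast
    ring
  have xZ : HasDx T' Z Zx := fun x hx t ht => by
    have hr := (J.hasDx_r.mono hTT) x hx t ht
    have hr0 := J.r_ne x t
    refine (((hr.fun_pow 2).fun_mul (xvx x hx t ht)).fun_add
      ((((J.hasDx_q.mono hTT x hx t ht).const_add 1).fun_mul (xv x hx t ht)).fun_div hr
        hr0)).congr_deriv ?_
    simp only [Zx]
    field_simp
    push_cast
    ring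
  have cZx : Continuous fun z : ℝ × ℝ => Zx z.1 z.2 := by
    simp only [Zx]
    fun_prop (disch := intro z; first | exact J.r_ne _ _ | exact pow_ne_zero _ (J.r_ne _ _))
  let D : ℝ → ℝ → ℝ := fun x t => 1 / 2 * g' x * J.r x t ^ 2 * J.mulDensity v vt vx x t
  let E : ℝ → ℝ → ℝ := fun x t => g x * J.mulError v vt vx F x t
  -- The flux; `Qx` below is its space derivative, with the contribution of `g'` separated off as
  -- `D`.
  let Q : ℝ → ℝ → ℝ := fun x t => 1 / 2 * g x * J.r x t ^ 2 * J.mulDensity v vt vx x t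
  let Qx : ℝ → ℝ → ℝ := fun x t => D x t
    + g x * (1 + J.q x t) / J.r x t * (vt x t ^ 2 + J.s x t * Z x t ^ 2)
    + 1 / 2 * g x * J.r x t ^ 2 * (2 * vt x t * vtx x t
      + (-(J.γ + 1) * J.s x t * J.qx x t / (1 + J.q x t)) * Z x t ^ 2
      + J.s x t * (2 * Z x t * Zx x t))
  have cD : Continuous fun z : ℝ × ℝ => D z.1 z.2 := by
    simp only [D, mulDensity, ← hZ]
    fun_prop
  have cE : Continuous fun z : ℝ × ℝ => E z.1 z.2 := by
    simp only [E, mulError, ← hZ]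
    fun_prop (disch := intro z; first | exact J.r_ne _ _ | exact J.one_add_q_ne _ _)
  have cQ : Continuous fun z : ℝ × ℝ => Q z.1 z.2 := by
    simp only [Q, mulDensity, ← hZ]
    fun_prop
  have cQx : Continuous fun z : ℝ × ℝ => Qx z.1 z.2 := by
    simp only [Qx]
    fun_prop (disch := intro z; first | exact J.r_ne _ _ | exact J.one_add_q_ne _ _)
  have xQ : HasDx T' Q Qx := fun x hx t ht => by
    have hr := (J.hasDx_r.mono hTT) x hx t ht
    have hr0 := J.r_ne x t
    have hq0 := J.one_add_q_ne x t
    have hd := ((xvt x hx t ht).fun_pow 2).fun_add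
      ((J.hasDx_s.mono hTT x hx t ht).fun_mul ((xZ x hx t ht).fun_pow 2))
    refine ((((hgd x hx).const_mul (1 / 2)).fun_mul (hr.fun_pow 2)).fun_mul hd).congr_deriv ?_
    simp only [Qx, D, mulDensity, ← hZ]
    field_simp
    push_cast
    ring
  -- The pointwise conservation law. The second derivatives `vxx` and `vtx` cancel after insertion
  -- of the wave equation and the continuity equation, which is why they are absent from `mulError`.
  have tP : ∀ x, 0 ≤ x → ∀ t ∈ Ioo 0 T', HasDerivAt (fun s => g x * vt x s * Z x s)
      (Qx x t - D x t + E x t) t := fun x hx t ht => by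
    have hr0 := J.r_ne x t
    have hq0 := J.one_add_q_ne x t
    refine (((tvt x hx t ht).const_mul (g x)).fun_mul (tZ x hx t ht)).congr_deriv ?_
    have e1 := heq x hx t ht
    have e2 := J.continuity x t
    simp only [E, Qx, mulError, ← hZ, Zt, Zx, e1, e2]
    simp only [hZ, radial]
    field_simp
    ring
  have h1 : ∀ x ∈ uIcc 0 X, ∫ t in (0 : ℝ)..T', (Qx x t - D x t + E x t)
      = g x * vt x T' * Z x T' - g x * vt x 0 * Z x 0 := fun x hx => by
    rw [uIcc_of_le hX] at hx
    refine intervalIntegral.integral_eq_sub_of_hasDerivAt_of_le hT' ?_ (tP x hx.1) ?_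
    · exact Continuous.continuousOn (by fun_prop)
    · exact Continuous.intervalIntegrable (by fun_prop) _ _
  have h2 : ∀ t ∈ uIcc 0 T', ∫ x in (0 : ℝ)..X, Qx x t = Q X t - Q 0 t := fun t ht => by
    rw [uIcc_of_le hT'] at ht
    refine intervalIntegral.integral_eq_sub_of_hasDerivAt_of_le (f := fun x => Q x t) hX ?_
      (fun x hx => xQ x hx.1 t ht) ?_
    · exact Continuous.continuousOn (by fun_prop)
    · exact Continuous.intervalIntegrable (by fun_prop) _ _
  unfold MultiplierIdentity
  -- The time-boundary term becomes an integral over the rectangle, and Fubini lets the flux be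
  -- integrated in `x` first.
  rw [← intervalIntegral.integral_congr h1, intervalIntegral_comm (by fun_prop),
    ← intervalIntegral.integral_congr h2]
  have hint : ∀ {f : ℝ → ℝ → ℝ}, (Continuous fun z : ℝ × ℝ => f z.1 z.2) → ∀ t,
      IntervalIntegrable (fun x => f x t) volume 0 X := fun hf t =>
    (hf.comp (f := fun x => (x, t)) (by fun_prop)).intervalIntegrable _ _
  have hint2 : ∀ {f : ℝ → ℝ → ℝ}, (Continuous fun z : ℝ × ℝ => f z.1 z.2) →
      IntervalIntegrable (fun t => ∫ x in (0 : ℝ)..X, f x t) volume 0 T' := fun hf =>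
    (continuous_integral hf _ _).intervalIntegrable _ _
  rw [← intervalIntegral.integral_sub (hint2 cQx) (hint2 cD),
    ← intervalIntegral.integral_add ((hint2 cQx).sub (hint2 cD)) (hint2 cE)]
  refine intervalIntegral.integral_congr fun t _ => ?_
  change ∫ x in (0 : ℝ)..X, (Qx x t - D x t + E x t) = (∫ x in (0 : ℝ)..X, Qx x t)
    - (∫ x in (0 : ℝ)..X, D x t) + ∫ x in (0 : ℝ)..X, E x t
  rw [intervalIntegral.integral_add ((hint cQx t).sub (hint cD t)) (hint cE t),
    intervalIntegral.integral_sub (hint cQx t) (hint cD t)]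

end Jet

/-! ### Averaged time derivatives -/

/-- The average of `f x` over `[t, t + h]`. -/
def timeAv (f : ℝ → ℝ → ℝ) (h x t : ℝ) : ℝ := ∫ θ in (0 : ℝ)..1, f x (t + θ * h)

/-- The forward difference quotient in time. -/
def timeDiff (f : ℝ → ℝ → ℝ) (h x t : ℝ) : ℝ := (f x (t + h) - f x t) / h

theorem timeAv_zero (f : ℝ → ℝ → ℝ) (x t : ℝ) : timeAv f 0 x t = f x t := by
  simp [timeAv]

theorem continuous_timeAv {f : ℝ → ℝ → ℝ} (hf : Continuous fun z : ℝ × ℝ => f z.1 z.2)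
    {α : Type*} [TopologicalSpace α] {a b c : α → ℝ} (ha : Continuous a) (hb : Continuous b)
    (hc : Continuous c) : Continuous fun z => timeAv f (a z) (b z) (c z) := by
  have h1 : Continuous fun p : ℝ × ℝ × ℝ => timeAv f p.1 p.2.1 p.2.2 := by
    unfold timeAv
    exact intervalIntegral.continuous_parametric_intervalIntegral_of_continuous'
      (f := fun (p : ℝ × ℝ × ℝ) θ => f p.2.1 (p.2.2 + θ * p.1))
      (hf.comp (f := fun w : (ℝ × ℝ × ℝ) × ℝ => (w.1.2.1, w.1.2.2 + w.2 * w.1.1))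
        (by fun_prop)) _ _
  exact h1.comp (ha.prodMk (hb.prodMk hc))

/-- Averages, unlike difference quotients, are continuous in `h` up to `h = 0`, where they are the
derivative itself. This identification is what allows the limit. -/
theorem timeDiff_eq_timeAv {T : ℝ} {f f' : ℝ → ℝ → ℝ}
    (hf : Continuous fun z : ℝ × ℝ => f z.1 z.2) (hf' : Continuous fun z : ℝ × ℝ => f' z.1 z.2)
    (hd : HasDt T f f') {h x t : ℝ} (hh : 0 < h) (hx : 0 ≤ x) (ht : 0 ≤ t) (hth : t + h ≤ T) :
    timeDiff f h x t = timeAv f' h x t := by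
  have h1 : ∫ θ in (0 : ℝ)..1, f' x (t + θ * h) * h = f x (t + 1 * h) - f x (t + 0 * h) := by
    refine intervalIntegral.integral_eq_sub_of_hasDerivAt_of_le (f := fun θ => f x (t + θ * h))
      zero_le_one ?_ ?_ ?_
    · exact (hf.comp (f := fun θ : ℝ => (x, t + θ * h)) (by fun_prop)).continuousOn
    · intro θ hθ
      have h2 : HasDerivAt (fun θ : ℝ => t + θ * h) (1 * h) θ :=
        ((hasDerivAt_id θ).mul_const h).const_add t
      have h3 := hd x hx (t + θ * h) ⟨by nlinarith [hθ.1], by nlinarith [hθ.2]⟩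
      exact (h3.comp θ h2).congr_deriv (by ring)
    · exact ((hf'.comp (f := fun θ : ℝ => (x, t + θ * h)) (by fun_prop)).mul_const
        h).intervalIntegrable _ _
  rw [intervalIntegral.integral_mul_const, one_mul, zero_mul, add_zero] at h1
  rw [timeDiff, timeAv, div_eq_iff hh.ne', h1]

theorem continuous_timeDiff {f : ℝ → ℝ → ℝ} (hf : Continuous fun z : ℝ × ℝ => f z.1 z.2)
    (h : ℝ) : Continuous fun z : ℝ × ℝ => timeDiff f h z.1 z.2 := by
  unfold timeDiff
  exact ((hf.comp (f := fun z : ℝ × ℝ => (z.1, z.2 + h)) (by fun_prop)).sub hf).div_const h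

theorem HasDt.timeDiff {T T' h : ℝ} {f f' : ℝ → ℝ → ℝ} (hd : HasDt T f f') (hh : 0 < h)
    (hT : T' + h ≤ T) : HasDt T' (timeDiff f h) (timeDiff f' h) := fun x hx t ht => by
  have h1 := hd x hx t ⟨ht.1, by linarith [ht.2]⟩
  have h2 := (hd x hx (t + h) ⟨by linarith [ht.1], by linarith [ht.2]⟩).comp_add_const t h
  exact (h2.sub h1).div_const h

theorem HasDx.timeDiff {T T' h : ℝ} {f f' : ℝ → ℝ → ℝ} (hd : HasDx T f f') (hh : 0 < h)
    (hT : T' + h ≤ T) : HasDx T' (timeDiff f h) (timeDiff f' h) := fun x hx t ht => by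
  have h1 := hd x hx t ⟨ht.1, by linarith [ht.2]⟩
  have h2 := hd x hx (t + h) ⟨by linarith [ht.1], by linarith [ht.2]⟩
  exact (h2.sub h1).div_const h

/-! ### Stability of the multiplier identity under change of functions and limits -/

namespace Jet

variable {J : Jet}

/-- The identity sees only values on the strip, which permits replacing difference quotients by
averages there. -/
theorem MultiplierIdentity.congr {g g' : ℝ → ℝ} {X T' : ℝ} {v vt vx F v' vt' vx' F' : ℝ → ℝ → ℝ}
    (hm : J.MultiplierIdentity g g' X T' v vt vx F) (hX : 0 ≤ X) (hT' : 0 ≤ T')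
    (h1 : ∀ x, 0 ≤ x → ∀ t ∈ Icc 0 T', v x t = v' x t)
    (h2 : ∀ x, 0 ≤ x → ∀ t ∈ Icc 0 T', vt x t = vt' x t)
    (h3 : ∀ x, 0 ≤ x → ∀ t ∈ Icc 0 T', vx x t = vx' x t)
    (h4 : ∀ x, 0 ≤ x → ∀ t ∈ Icc 0 T', F x t = F' x t) :
    J.MultiplierIdentity g g' X T' v' vt' vx' F' := by
  have hZ : ∀ x, 0 ≤ x → ∀ t ∈ Icc 0 T', J.radial v vx x t = J.radial v' vx' x t :=
    fun x hx t ht => by rw [radial, radial, h1 x hx t ht, h3 x hx t ht]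
  have hD : ∀ x, 0 ≤ x → ∀ t ∈ Icc 0 T', J.mulDensity v vt vx x t = J.mulDensity v' vt' vx' x t :=
    fun x hx t ht => by rw [mulDensity, mulDensity, hZ x hx t ht, h2 x hx t ht]
  have hE : ∀ x, 0 ≤ x → ∀ t ∈ Icc 0 T', J.mulError v vt vx F x t = J.mulError v' vt' vx' F' x t :=
    fun x hx t ht => by
      rw [mulError, mulError, hZ x hx t ht, h1 x hx t ht, h2 x hx t ht, h3 x hx t ht, h4 x hx t ht]
  have hT0 : (0 : ℝ) ∈ Icc 0 T' := ⟨le_rfl, hT'⟩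
  have hTT : T' ∈ Icc 0 T' := ⟨hT', le_rfl⟩
  unfold MultiplierIdentity at hm ⊢
  convert hm using 1
  · refine intervalIntegral.integral_congr fun x hx => ?_
    rw [uIcc_of_le hX] at hx
    simp only [hZ x hx.1 _ hT0, hZ x hx.1 _ hTT, h2 x hx.1 _ hT0, h2 x hx.1 _ hTT]
  · congr 1
    · congr 1
      · refine intervalIntegral.integral_congr fun t ht => ?_
        rw [uIcc_of_le hT'] at ht
        simp only [hD X hX t ht, hD 0 le_rfl t ht]
      · refine intervalIntegral.integral_congr fun t ht => ?_
        rw [uIcc_of_le hT'] at ht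
        refine intervalIntegral.integral_congr fun x hx => ?_
        rw [uIcc_of_le hX] at hx
        simp only [hD x hx.1 t ht]
    · refine intervalIntegral.integral_congr fun t ht => ?_
      rw [uIcc_of_le hT'] at ht
      refine intervalIntegral.integral_congr fun x hx => ?_
      rw [uIcc_of_le hX] at hx
      simp only [hE x hx.1 t ht]

/-- The multiplier identity passes to the limit in a parameter. -/
theorem MultiplierIdentity.of_continuous {g g' : ℝ → ℝ} (hg : Continuous g) (hg' : Continuous g')
    {X T' h₀ : ℝ} (hh₀ : 0 < h₀) {v vt vx F : ℝ → ℝ → ℝ → ℝ}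
    (cv : Continuous fun z : ℝ × ℝ × ℝ => v z.1 z.2.1 z.2.2)
    (cvt : Continuous fun z : ℝ × ℝ × ℝ => vt z.1 z.2.1 z.2.2)
    (cvx : Continuous fun z : ℝ × ℝ × ℝ => vx z.1 z.2.1 z.2.2)
    (cF : Continuous fun z : ℝ × ℝ × ℝ => F z.1 z.2.1 z.2.2)
    (hm : ∀ h ∈ Ioo 0 h₀, J.MultiplierIdentity g g' X T' (v h) (vt h) (vx h) (F h)) :
    J.MultiplierIdentity g g' X T' (v 0) (vt 0) (vx 0) (F 0) := by
  have cZ : Continuous fun z : ℝ × ℝ × ℝ => J.radial (v z.1) (vx z.1) z.2.1 z.2.2 :=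
    continuous_radial (v := fun z => v z.1) (vx := fun z => vx z.1)
      (α := ℝ × ℝ × ℝ) (a := fun z => z.2.1) (b := fun z => z.2.2) (by fun_prop) (by fun_prop)
      cv cvx
  have cD : Continuous fun z : ℝ × ℝ × ℝ => J.mulDensity (v z.1) (vt z.1) (vx z.1) z.2.1 z.2.2 := by
    unfold mulDensity; fun_prop
  have cE : Continuous fun z : ℝ × ℝ × ℝ =>
      J.mulError (v z.1) (vt z.1) (vx z.1) (F z.1) z.2.1 z.2.2 := by
    unfold mulError
    fun_prop (disch := intro z; first | exact J.r_ne _ _ | exact J.one_add_q_ne _ _)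
  have cl : ∀ {f : ℝ → ℝ → ℝ → ℝ}, (Continuous fun z : ℝ × ℝ × ℝ => f z.1 z.2.1 z.2.2) →
      ∀ {α : Type} [TopologicalSpace α] {a b c : α → ℝ}, Continuous a → Continuous b →
      Continuous c → Continuous fun z => f (a z) (b z) (c z) :=
    fun hf _ _ _ _ _ ha hb hc => hf.comp (ha.prodMk (hb.prodMk hc))
  have c1 : Continuous fun h => ∫ x in (0 : ℝ)..X,
      (g x * vt h x T' * J.radial (v h) (vx h) x T'
        - g x * vt h x 0 * J.radial (v h) (vx h) x 0) := by
    refine intervalIntegral.continuous_parametric_intervalIntegral_of_continuous'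
      (f := fun h x => _) ?_ _ _
    refine Continuous.sub (((hg.comp continuous_snd).mul ?_).mul ?_)
      (((hg.comp continuous_snd).mul ?_).mul ?_)
    · exact cl cvt continuous_fst continuous_snd continuous_const
    · exact cl (f := fun h x t => J.radial (v h) (vx h) x t) cZ continuous_fst continuous_snd
        continuous_const
    · exact cl cvt continuous_fst continuous_snd continuous_const
    · exact cl (f := fun h x t => J.radial (v h) (vx h) x t) cZ continuous_fst continuous_snd
        continuous_const
  have c2 : Continuous fun h => ∫ t in (0 : ℝ)..T',
      (1 / 2 * g X * J.r X t ^ 2 * J.mulDensity (v h) (vt h) (vx h) X t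
        - 1 / 2 * g 0 * J.r 0 t ^ 2 * J.mulDensity (v h) (vt h) (vx h) 0 t) := by
    refine intervalIntegral.continuous_parametric_intervalIntegral_of_continuous'
      (f := fun h t => _) ?_ _ _
    refine Continuous.sub (Continuous.mul (by fun_prop) ?_) (Continuous.mul (by fun_prop) ?_)
    · exact cl (f := fun h x t => J.mulDensity (v h) (vt h) (vx h) x t) cD continuous_fst
        continuous_const continuous_snd
    · exact cl (f := fun h x t => J.mulDensity (v h) (vt h) (vx h) x t) cD continuous_fst
        continuous_const continuous_snd
  have c3 : Continuous fun h => ∫ t in (0 : ℝ)..T', ∫ x in (0 : ℝ)..X,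
      1 / 2 * g' x * J.r x t ^ 2 * J.mulDensity (v h) (vt h) (vx h) x t := by
    refine intervalIntegral.continuous_parametric_intervalIntegral_of_continuous'
      (f := fun h t => _) ?_ _ _
    refine intervalIntegral.continuous_parametric_intervalIntegral_of_continuous'
      (f := fun (p : ℝ × ℝ) x => _) ?_ _ _
    refine Continuous.mul (by fun_prop) ?_
    exact cl (f := fun h x t => J.mulDensity (v h) (vt h) (vx h) x t) cD
      (a := fun p : (ℝ × ℝ) × ℝ => p.1.1) (by fun_prop) (by fun_prop) (by fun_prop)
  have c4 : Continuous fun h => ∫ t in (0 : ℝ)..T', ∫ x in (0 : ℝ)..X,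
      g x * J.mulError (v h) (vt h) (vx h) (F h) x t := by
    refine intervalIntegral.continuous_parametric_intervalIntegral_of_continuous'
      (f := fun h t => _) ?_ _ _
    refine intervalIntegral.continuous_parametric_intervalIntegral_of_continuous'
      (f := fun (p : ℝ × ℝ) x => _) ?_ _ _
    refine Continuous.mul (by fun_prop) ?_
    exact cl (f := fun h x t => J.mulError (v h) (vt h) (vx h) (F h) x t) cE
      (a := fun p : (ℝ × ℝ) × ℝ => p.1.1) (by fun_prop) (by fun_prop) (by fun_prop)
  -- Both sides are continuous in the parameter, so the set of parameters for which the identity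
  -- holds is closed.
  have hcl : IsClosed {h : ℝ | J.MultiplierIdentity g g' X T' (v h) (vt h) (vx h) (F h)} :=
    isClosed_eq c1 ((c2.sub c3).add c4)
  have h0 : (0 : ℝ) ∈ closure (Ioo 0 h₀) := by
    rw [closure_Ioo hh₀.ne]; exact ⟨le_rfl, hh₀.le⟩
  exact hcl.closure_subset_iff.2 hm h0

/-! ### The commuted wave equations -/

variable (J)

/-- Logarithmic time derivative of `c² r⁴`. -/
def α (x t : ℝ) : ℝ := -(J.γ + 1) * J.qt x t / (1 + J.q x t) + 4 * J.u x t / J.r x t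

def αt (x t : ℝ) : ℝ :=
  -(J.γ + 1) * J.qtt x t / (1 + J.q x t) + (J.γ + 1) * J.qt x t ^ 2 / (1 + J.q x t) ^ 2
    + 4 * J.ut x t / J.r x t - 4 * J.u x t ^ 2 / J.r x t ^ 2

/-- The mismatch between the two coefficients of the operator: `β r²` is the time derivative of `4
c² r (1 + q)` minus `α` times that coefficient. With `A = c² r⁴` handled by `α` alone, the wave
equation turns the commutator into `α φ_tt + β r² φ_x`, free of `φ_xx`. -/
def β (x t : ℝ) : ℝ :=
  J.s x t * (4 * J.qt x t / J.r x t - 12 * (1 + J.q x t) * J.u x t / J.r x t ^ 2)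

def βt (x t : ℝ) : ℝ :=
  -(J.γ + 1) * J.qt x t / (1 + J.q x t) * J.β x t
    + J.s x t * (4 * J.qtt x t / J.r x t - 16 * J.qt x t * J.u x t / J.r x t ^ 2
      - 12 * (1 + J.q x t) * J.ut x t / J.r x t ^ 2
      + 24 * (1 + J.q x t) * J.u x t ^ 2 / J.r x t ^ 3)

/-- The source term in the wave equation for `∂_t φ`. -/
def F₁ (x t : ℝ) : ℝ := J.α x t * J.φtt x t + J.β x t * (J.r x t ^ 2 * J.φx x t)

def F₁t (x t : ℝ) : ℝ :=
  J.αt x t * J.φtt x t + J.α x t * J.φttt x t + J.βt x t * (J.r x t ^ 2 * J.φx x t)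
    + J.β x t * (2 * J.r x t * J.u x t * J.φx x t + J.r x t ^ 2 * J.φtx x t)

/-- The source term in the wave equation for `∂_t² φ`. -/
def F₂ (x t : ℝ) : ℝ :=
  2 * J.α x t * J.φttt x t + J.αt x t * J.φtt x t - J.α x t * J.F₁ x t
    + (J.βt x t + 2 * J.β x t * J.u x t / J.r x t) * (J.r x t ^ 2 * J.φx x t)
    + 2 * J.β x t * (J.r x t ^ 2 * J.φtx x t)

theorem continuous_F₁ : Continuous fun z : ℝ × ℝ => J.F₁ z.1 z.2 := by
  unfold F₁ α β
  fun_prop (disch := intro z; first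
    | exact J.r_ne _ _ | exact J.one_add_q_ne _ _ | exact pow_ne_zero _ (J.r_ne _ _))

theorem continuous_F₁t : Continuous fun z : ℝ × ℝ => J.F₁t z.1 z.2 := by
  unfold F₁t αt βt α β
  fun_prop (disch := intro z; first
    | exact J.r_ne _ _ | exact J.one_add_q_ne _ _ | exact pow_ne_zero _ (J.r_ne _ _)
    | exact pow_ne_zero _ (J.one_add_q_ne _ _))

theorem hasDt_F₁ : HasDt J.T J.F₁ J.F₁t := fun x hx t ht => by
  have hr := J.hasDt_r x hx t ht
  have hu := J.hasDt_u x hx t ht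
  have hq := (J.hasDt_q x hx t ht).const_add 1
  have hqt := J.hasDt_qt x hx t ht
  have hr0 := J.r_ne x t
  have hq0 := J.one_add_q_ne x t
  have hα : HasDerivAt (fun s => J.α x s) (J.αt x t) t := by
    refine (((hqt.const_mul (-(J.γ + 1))).fun_div hq hq0).fun_add
      ((hu.const_mul 4).fun_div hr hr0)).congr_deriv ?_
    unfold αt
    field_simp
    ring
  have hβ : HasDerivAt (fun s => J.β x s) (J.βt x t) t := by
    refine ((J.hasDt_s x hx t ht).fun_mul (((hqt.const_mul 4).fun_div hr hr0).fun_sub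
      (((hq.const_mul 12).fun_mul hu).fun_div (hr.fun_pow 2) (pow_ne_zero _ hr0)))).congr_deriv ?_
    unfold βt β
    field_simp
    push_cast
    ring
  refine ((hα.fun_mul (J.hasDt_φtt x hx t ht)).fun_add
    (hβ.fun_mul ((hr.fun_pow 2).fun_mul (J.hasDt_φx x hx t ht)))).congr_deriv ?_
  unfold F₁t
  push_cast
  ring

/-- The wave equation for `∂_t φ`. -/
theorem wave_φt {x t : ℝ} (hx : 0 ≤ x) (ht : t ∈ Icc 0 J.T) : J.φttt x t = J.s x t
    * (J.r x t ^ 4 * J.φtxx x t + 4 * J.r x t * (1 + J.q x t) * J.φtx x t) + J.F₁ x t := by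
  refine J.eq_of_eq_interior (f := J.φttt) (g := fun x t => J.s x t
    * (J.r x t ^ 4 * J.φtxx x t + 4 * J.r x t * (1 + J.q x t) * J.φtx x t) + J.F₁ x t)
    (by fun_prop) (Continuous.add (by fun_prop) J.continuous_F₁) ?_ hx ht
  intro x hx t ht
  have hr := J.hasDt_r x hx.le t ht
  have hr0 := J.r_ne x t
  have hq0 := J.one_add_q_ne x t
  have h := (J.hasDt_s x hx.le t ht).fun_mul (((hr.fun_pow 4).fun_mul
    (J.hasDt_φxx x hx.le t ht)).fun_add ((((hr.const_mul 4).fun_mul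
      ((J.hasDt_q x hx.le t ht).const_add 1))).fun_mul (J.hasDt_φx x hx.le t ht)))
  have h2 := (J.hasDt_φtt x hx.le t ht).unique
    (h.congr_of_eventuallyEq (Eventually.of_forall fun s => J.wave' x s))
  rw [h2, F₁, α, β, J.wave']
  field_simp
  push_cast
  ring

/-- Time derivative of `c² r⁴`. -/
def At (x t : ℝ) : ℝ := J.α x t * (J.s x t * J.r x t ^ 4)

/-- Time derivative of `4 c² r (1 + q)`. -/
def Bt (x t : ℝ) : ℝ :=
  4 * J.s x t * (-(J.γ + 1) * J.qt x t * J.r x t + J.u x t * (1 + J.q x t)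
    + J.r x t * J.qt x t)

theorem hasDt_A : HasDt J.T (fun x t => J.s x t * J.r x t ^ 4) J.At := fun x hx t ht => by
  have hr0 := J.r_ne x t
  have hq0 := J.one_add_q_ne x t
  refine ((J.hasDt_s x hx t ht).fun_mul ((J.hasDt_r x hx t ht).fun_pow 4)).congr_deriv ?_
  unfold At α
  field_simp
  push_cast
  ring

theorem hasDt_B : HasDt J.T (fun x t => 4 * J.s x t * (J.r x t * (1 + J.q x t))) J.Bt :=
  fun x hx t ht => by
    have hq0 := J.one_add_q_ne x t
    refine (((J.hasDt_s x hx t ht).const_mul 4).fun_mul ((J.hasDt_r x hx t ht).fun_mul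
      ((J.hasDt_q x hx t ht).const_add 1))).congr_deriv ?_
    unfold Bt
    field_simp
    ring

theorem continuous_At : Continuous fun z : ℝ × ℝ => J.At z.1 z.2 := by
  unfold At α
  fun_prop (disch := intro z; first | exact J.r_ne _ _ | exact J.one_add_q_ne _ _)

theorem continuous_Bt : Continuous fun z : ℝ × ℝ => J.Bt z.1 z.2 := by
  unfold Bt; fun_prop

section Weight

variable {J} {g g' : ℝ → ℝ} (hg : Continuous g) (hg' : Continuous g')
  (hgd : ∀ x, 0 < x → HasDerivAt g (g' x) x) {X T' : ℝ} (hX : 0 ≤ X) (hT' : 0 ≤ T')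
include hg hg' hgd hX hT'

theorem multiplierIdentity_φ (hTT : T' ≤ J.T) :
    J.MultiplierIdentity g g' X T' J.φ J.φt J.φx 0 :=
  multiplierIdentity hT' hTT hg hg' hgd J.cont_φ J.cont_φt J.cont_φx J.cont_φtx J.cont_φxx
    continuous_const (J.hasDt_φ.mono hTT) (J.hasDt_φt.mono hTT) (J.hasDt_φx.mono hTT)
    (J.hasDx_φ.mono hTT) (J.hasDx_φt.mono hTT) (J.hasDx_φx.mono hTT)
    (fun _ _ _ _ => by rw [J.wave']; simp) hX

theorem multiplierIdentity_φt (hTT : T' ≤ J.T) :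
    J.MultiplierIdentity g g' X T' J.φt J.φtt J.φtx J.F₁ :=
  multiplierIdentity hT' hTT hg hg' hgd J.cont_φt J.cont_φtt J.cont_φtx J.cont_φttx J.cont_φtxx
    J.continuous_F₁ (J.hasDt_φt.mono hTT) (J.hasDt_φtt.mono hTT) (J.hasDt_φtx.mono hTT)
    (J.hasDx_φt.mono hTT) (J.hasDx_φtt.mono hTT) (J.hasDx_φtx.mono hTT)
    (fun _ hx _ ht => J.wave_φt hx ⟨ht.1.le, ht.2.le.trans hTT⟩) hX

/-- For `v = ∂_t² φ` the identity would require `φ_tttt` and `φ_ttxx`, which a `C³` function need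
not have. The difference quotient of `∂_t φ` with step `h` has all derivatives that are needed, and
the identity itself involves only derivatives of `φ` of order at most three, so it survives `h → 0`.
The strict inequality `T' < T` leaves room for the step. -/
theorem multiplierIdentity_φtt (hTT : T' < J.T) :
    J.MultiplierIdentity g g' X T' J.φtt J.φttt J.φttx J.F₂ := by
  -- The source of the differenced equation by the discrete product rule: coefficients are averaged,
  -- while `φ_tx` and `φ_txx` are taken at the later time `t + h`.
  let F : ℝ → ℝ → ℝ → ℝ := fun h x t => timeAv J.F₁t h x t
    + timeAv J.At h x t * J.φtxx x (t + h) + timeAv J.Bt h x t * J.φtx x (t + h)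
  have cF : Continuous fun z : ℝ × ℝ × ℝ => F z.1 z.2.1 z.2.2 :=
    ((continuous_timeAv J.continuous_F₁t (by fun_prop) (by fun_prop) (by fun_prop)).add
      ((continuous_timeAv J.continuous_At (by fun_prop) (by fun_prop) (by fun_prop)).mul
        (by fun_prop))).add
      ((continuous_timeAv J.continuous_Bt (by fun_prop) (by fun_prop) (by fun_prop)).mul
        (by fun_prop))
  have key : J.MultiplierIdentity g g' X T' (timeAv J.φtt 0) (timeAv J.φttt 0) (timeAv J.φttx 0)
      (F 0) := by
    refine MultiplierIdentity.of_continuous hg hg' (sub_pos.2 hTT) (F := F)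
      (continuous_timeAv J.cont_φtt (by fun_prop) (by fun_prop) (by fun_prop))
      (continuous_timeAv J.cont_φttt (by fun_prop) (by fun_prop) (by fun_prop))
      (continuous_timeAv J.cont_φttx (by fun_prop) (by fun_prop) (by fun_prop)) cF fun h hh => ?_
    have hhT : T' + h ≤ J.T := by linarith [hh.2]
    have cFh : Continuous fun z : ℝ × ℝ => F h z.1 z.2 :=
      cF.comp (f := fun z : ℝ × ℝ => (h, z.1, z.2)) (by fun_prop)
    have hav : ∀ {f f' : ℝ → ℝ → ℝ}, (Continuous fun z : ℝ × ℝ => f z.1 z.2) →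
        (Continuous fun z : ℝ × ℝ => f' z.1 z.2) → HasDt J.T f f' → ∀ x, 0 ≤ x → ∀ t ∈ Icc 0 T',
        timeDiff f h x t = timeAv f' h x t := fun hf hf' hd x hx t ht =>
      timeDiff_eq_timeAv hf hf' hd hh.1 hx ht.1 (by linarith [ht.2])
    refine (multiplierIdentity hT' hTT.le hg hg' hgd (continuous_timeDiff J.cont_φt h)
      (continuous_timeDiff J.cont_φtt h) (continuous_timeDiff J.cont_φtx h)
      (continuous_timeDiff J.cont_φttx h) (continuous_timeDiff J.cont_φtxx h) cFh
      (J.hasDt_φt.timeDiff hh.1 hhT) (J.hasDt_φtt.timeDiff hh.1 hhT)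
      (J.hasDt_φtx.timeDiff hh.1 hhT) (J.hasDx_φt.timeDiff hh.1 hhT)
      (J.hasDx_φtt.timeDiff hh.1 hhT) (J.hasDx_φtx.timeDiff hh.1 hhT) ?_ hX).congr hX hT'
      (hav J.cont_φt J.cont_φtt J.hasDt_φt) (hav J.cont_φtt J.cont_φttt J.hasDt_φtt)
      (hav J.cont_φtx J.cont_φttx J.hasDt_φtx) (fun _ _ _ _ => rfl)
    intro x hx t ht
    have ht' := Ioo_subset_Icc_self ht
    simp only [F]
    rw [← hav J.continuous_F₁ J.continuous_F₁t J.hasDt_F₁ x hx t ht',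
      ← hav (by fun_prop) J.continuous_At J.hasDt_A x hx t ht',
      ← hav (by fun_prop) J.continuous_Bt J.hasDt_B x hx t ht']
    simp only [timeDiff]
    rw [J.wave_φt hx ⟨by linarith [ht.1, hh.1], by linarith [ht.2]⟩,
      J.wave_φt hx ⟨ht.1.le, ht.2.le.trans hTT.le⟩]
    have := hh.1.ne'
    field_simp
    ring
  refine key.congr hX hT' (fun x _ t _ => timeAv_zero _ x t) (fun x _ t _ => timeAv_zero _ x t)
    (fun x _ t _ => timeAv_zero _ x t) fun x hx t ht => ?_
  have hr0 := J.r_ne x t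
  have hq0 := J.one_add_q_ne x t
  have h1 := J.wave_φt hx (t := t) ⟨ht.1, ht.2.trans hTT.le⟩
  simp only [F, timeAv_zero, add_zero]
  have h2 : J.α x t * (J.φttt x t - J.F₁ x t) = J.α x t * (J.s x t
      * (J.r x t ^ 4 * J.φtxx x t + 4 * J.r x t * (1 + J.q x t) * J.φtx x t)) := by rw [h1]; ring
  -- With this splitting the commutator at `h = 0` becomes `α (φ_ttt - F₁) + β r² φ_tx`, and `φ_txx`
  -- disappears from the source.
  have h3 : J.Bt x t = J.α x t * (J.s x t * (4 * J.r x t * (1 + J.q x t)))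
      + J.β x t * J.r x t ^ 2 := by
    unfold Bt α β; field_simp; ring
  unfold F₁t F₂ At
  rw [h3]
  field_simp
  linear_combination -h2

end Weight

end Jet

/-! ### Bookkeeping for bounds with unspecified constants -/

section Bd

variable {a b A B w w' : ℝ}

/-- The bounds have the shape "constant times size". Composing these lemmas along the structure of
an expression makes unification assemble the constant, so that it need not be written out. -/
theorem bd_add (ha : |a| ≤ A * w) (hb : |b| ≤ B * w) : |a + b| ≤ (A + B) * w := by
  rw [add_mul]; exact abs_add_le_of_le ha hb

theorem bd_sub (ha : |a| ≤ A * w) (hb : |b| ≤ B * w) : |a - b| ≤ (A + B) * w := by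
  rw [add_mul]; exact abs_sub_le_of_le ha hb

theorem bd_mul (ha : |a| ≤ A * w) (hb : |b| ≤ B * w') : |a * b| ≤ A * B * (w * w') := by
  rw [mul_mul_mul_comm]; exact abs_mul_le_of_le ha hb

theorem bd_mul_left (ha : |a| ≤ A) (hb : |b| ≤ B * w) : |a * b| ≤ A * B * w := by
  rw [mul_assoc]; exact abs_mul_le_of_le ha hb

theorem bd_mul_right (ha : |a| ≤ A * w) (hb : |b| ≤ B) : |a * b| ≤ A * B * w := by
  rw [mul_right_comm]; exact abs_mul_le_of_le ha hb

theorem bd_div (ha : |a| ≤ A * w) (hb : 0 < b) (hB : 1 ≤ B * b) : |a / b| ≤ A * B * w := by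
  rw [mul_right_comm]; exact abs_div_le_of_le ha hb hB

theorem bd_mono (ha : |a| ≤ A * w) (hA : A ≤ B) (hw : 0 ≤ w) : |a| ≤ B * w :=
  ha.trans (mul_le_mul_of_nonneg_right hA hw)

theorem abs_nat_le (n : ℕ) [n.AtLeastTwo] : |(OfNat.ofNat n : ℝ)| ≤ OfNat.ofNat n := by
  rw [abs_of_nonneg (Nat.ofNat_nonneg n)]

end Bd

namespace Jet

variable (J : Jet)

/-- Energy bounds together with pointwise bounds, in the regime where `ε` is small. -/
structure Bound (K ε : ℝ) : Prop extends J.EnergyBound K ε, J.PointBound K ε where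
  small : 8 * K ^ 3 * ε ^ 2 ≤ 1

/-- `(∂_t v)² + (r² ∂_x v)² + ξ⁻² v²`. -/
def fullDensity (v vt vx : ℝ → ℝ → ℝ) (x t : ℝ) : ℝ :=
  vt x t ^ 2 + (J.r x t ^ 2 * vx x t) ^ 2 + (v x t / wt x) ^ 2

variable {J} {K ε : ℝ} {x t : ℝ}

theorem fullDensity_nonneg (v vt vx : ℝ → ℝ → ℝ) : 0 ≤ J.fullDensity v vt vx x t := by
  unfold fullDensity; positivity

section Components

variable {v vt vx : ℝ → ℝ → ℝ} {N : ℝ} (h : J.fullDensity v vt vx x t ≤ N)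
include h

theorem abs_vt_le : |vt x t| ≤ 1 * √N := by
  rw [one_mul]; refine Real.abs_le_sqrt (le_trans ?_ h)
  unfold fullDensity
  nlinarith [sq_nonneg (J.r x t ^ 2 * vx x t), sq_nonneg (v x t / wt x)]

theorem abs_r_sq_mul_vx_le : |J.r x t ^ 2 * vx x t| ≤ 1 * √N := by
  rw [one_mul]; refine Real.abs_le_sqrt (le_trans ?_ h)
  unfold fullDensity
  nlinarith [sq_nonneg (vt x t), sq_nonneg (v x t / wt x)]

theorem abs_v_div_wt_le : |v x t / wt x| ≤ 1 * √N := by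
  rw [one_mul]; refine Real.abs_le_sqrt (le_trans ?_ h)
  unfold fullDensity
  nlinarith [sq_nonneg (vt x t), sq_nonneg (J.r x t ^ 2 * vx x t)]

theorem EnergyBound.abs_v_div_r_le (hb : J.EnergyBound K ε) (hx : 0 ≤ x) (ht : t ∈ Icc 0 J.T) :
    |v x t / J.r x t| ≤ 1 * K * √N := by
  have h1 := abs_v_div_wt_le h
  have h2 : |wt x / J.r x t| ≤ K := by
    rw [abs_of_pos (div_pos (wt_pos x) (J.r_pos x t)), div_le_iff₀ (J.r_pos x t)]
    exact hb.wt_le x hx t ht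
  have e : v x t / J.r x t = v x t / wt x * (wt x / J.r x t) := by
    have := wt_ne x
    field_simp
  rw [e]
  exact bd_mul_right h1 h2

theorem EnergyBound.abs_radial_le (hb : J.EnergyBound K ε) (hx : 0 ≤ x) (ht : t ∈ Icc 0 J.T) :
    |J.radial v vx x t| ≤ (1 + 2 * (1 * K)) * √N := by
  rw [radial, mul_div_assoc]
  exact bd_add (abs_r_sq_mul_vx_le h) (bd_mul_left (J.abs_one_add_q_le x t)
    (hb.abs_v_div_r_le h hx ht))

end Components

theorem EnergyBound.abs_γ_le (hb : J.EnergyBound K ε) : |J.γ + 1| ≤ K := by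
  rw [abs_of_nonneg (by have := J.one_lt_γ; linarith)]; exact hb.γ_le

theorem EnergyBound.abs_s_le (hb : J.EnergyBound K ε) (hx : 0 ≤ x) (ht : t ∈ Icc 0 J.T) :
    |J.s x t| ≤ K := by
  rw [abs_of_pos (J.s_pos x t)]; exact hb.s_le x hx t ht

/-- After elimination of `q_x` and `u_x` by the momentum and continuity equations, every term except
the source is a coefficient built from `u`, `u_t`, `q_t` times a product of two components of the
full density. -/
theorem mulError_eq (v vt vx F : ℝ → ℝ → ℝ) : J.mulError v vt vx F x t =
    J.radial v vx x t * F x t - J.ut x t * (v x t / J.r x t * J.radial v vx x t)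
    + J.u x t / J.r x t * (vt x t * J.radial v vx x t)
    + (J.qt x t - 2 * (1 + J.q x t) / J.r x t * J.u x t) * (v x t / J.r x t * vt x t)
    + J.u x t / J.r x t * (vt x t * (J.r x t ^ 2 * vx x t))
    + 1 / 2 * (J.γ + 1) * J.ut x t / (1 + J.q x t)
      * (J.radial v vx x t * J.radial v vx x t) := by
  rw [mulError, J.momentum', J.continuity]
  have := J.r_ne x t
  have := J.one_add_q_ne x t
  field_simp
  ring

/-- The coefficients decay like `ε/ξ`, and `ξ⁻¹` is exactly the weight of the space-time norm. The
errors are therefore `ε` times the quantity being estimated. -/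
theorem exists_abs_mulError_le (K CF : ℝ) : ∃ C, ∀ (J : Jet) (ε : ℝ), J.Bound K ε →
    ∀ (v vt vx F : ℝ → ℝ → ℝ) (x t : ℝ), 0 ≤ x → t ∈ Icc 0 J.T → ∀ N : ℝ,
    J.fullDensity v vt vx x t ≤ N → |F x t| ≤ CF * (ε / wt x * √N) →
    |J.mulError v vt vx F x t| ≤ C * (ε / wt x * (√N * √N)) := by
  -- The constant is a metavariable fixed by the final `exact`. As it is created before the flow is
  -- introduced, it can depend on `K` and `CF` only. The same device is used in the estimates below.
  apply Exists.intro
  intro J ε hb v vt vx F x t hx ht N hN hF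
  have hZ := hb.abs_radial_le hN hx ht
  have hvt := abs_vt_le hN
  have hy := abs_r_sq_mul_vx_le hN
  have hv := hb.abs_v_div_r_le hN hx ht
  have hu := hb.abs_u x hx t ht
  have hut := hb.abs_ut x hx t ht
  have hqt := hb.abs_qt x hx t ht
  have hur := bd_div hu (J.r_pos x t) (hb.one_le_mul_r hx ht)
  have hF' := bd_mul hF hZ
  rw [mulError_eq, mul_comm (J.radial v vx x t) (F x t)]
  rw [mul_assoc (ε / wt x)] at hF'
  exact bd_add (bd_add (bd_add (bd_add (bd_sub hF' (bd_mul hut (bd_mul hv hZ)))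
    (bd_mul hur (bd_mul hvt hZ)))
    (bd_mul (bd_sub hqt (bd_mul_left (hb.abs_two_mul_one_add_q_div_r_le hx ht) hu))
      (bd_mul hv hvt)))
    (bd_mul hur (bd_mul hvt hy)))
    (bd_mul (bd_div (bd_mul_left (abs_mul_le_of_le (by norm_num : |(1 / 2 : ℝ)| ≤ 1)
      hb.abs_γ_le) hut) (J.one_add_q_pos x t) (J.one_le_mul_one_add_q x t)) (bd_mul hZ hZ))

/-! ### Bounds for the sources -/

theorem EnergyBound.σ_nonneg (hb : J.EnergyBound K ε) (x : ℝ) : 0 ≤ ε / wt x :=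
  div_nonneg hb.ε_pos.le (wt_pos x).le

theorem Bound.abs_u_le_const (hb : J.Bound K ε) (hx : 0 ≤ x) (ht : t ∈ Icc 0 J.T) :
    |J.u x t| ≤ K := (hb.abs_u x hx t ht).trans
  (mul_le_of_le_one_right hb.K_nonneg (div_wt_le_one hb.toEnergyBound x))

theorem Bound.abs_ut_le_const (hb : J.Bound K ε) (hx : 0 ≤ x) (ht : t ∈ Icc 0 J.T) :
    |J.ut x t| ≤ K := (hb.abs_ut x hx t ht).trans
  (mul_le_of_le_one_right hb.K_nonneg (div_wt_le_one hb.toEnergyBound x))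

theorem Bound.abs_qt_le_const (hb : J.Bound K ε) (hx : 0 ≤ x) (ht : t ∈ Icc 0 J.T) :
    |J.qt x t| ≤ K := (hb.abs_qt x hx t ht).trans
  (mul_le_of_le_one_right hb.K_nonneg (div_wt_le_one hb.toEnergyBound x))

theorem exists_abs_α_le (K : ℝ) : ∃ C, ∀ (J : Jet) (ε : ℝ), J.Bound K ε → ∀ x t : ℝ, 0 ≤ x →
    t ∈ Icc 0 J.T → |J.α x t| ≤ C * (ε / wt x) := by
  apply Exists.intro
  intro J ε hb x t hx ht
  have hγ : |-(J.γ + 1)| ≤ K := by rw [abs_neg]; exact hb.abs_γ_le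
  exact bd_add (bd_div (bd_mul_left hγ (hb.abs_qt x hx t ht)) (J.one_add_q_pos x t)
    (J.one_le_mul_one_add_q x t)) (bd_div (bd_mul_left (abs_nat_le 4) (hb.abs_u x hx t ht))
      (J.r_pos x t) (hb.one_le_mul_r hx ht))

theorem exists_abs_β_le (K : ℝ) : ∃ C, ∀ (J : Jet) (ε : ℝ), J.Bound K ε → ∀ x t : ℝ, 0 ≤ x →
    t ∈ Icc 0 J.T → |J.β x t| ≤ C * (ε / wt x) := by
  apply Exists.intro
  intro J ε hb x t hx ht
  have hr := hb.one_le_mul_r hx ht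
  have hr2 : 1 ≤ K ^ 2 * J.r x t ^ 2 := by rw [← mul_pow]; exact one_le_pow₀ hr
  exact bd_mul_left (hb.abs_s_le hx ht) (bd_sub (bd_div (bd_mul_left (abs_nat_le 4)
    (hb.abs_qt x hx t ht)) (J.r_pos x t) hr) (bd_div (bd_mul_left (abs_mul_le_of_le
      (abs_nat_le 12) (J.abs_one_add_q_le x t)) (hb.abs_u x hx t ht))
      (pow_pos (J.r_pos x t) 2) hr2))

theorem exists_abs_φtt_le (K : ℝ) : ∃ C, ∀ (J : Jet) (ε : ℝ), J.Bound K ε → ∀ x t : ℝ, 0 ≤ x →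
    t ∈ Icc 0 J.T → |J.φtt x t| ≤ C * (ε / wt x) := by
  apply Exists.intro
  intro J ε hb x t hx ht
  rw [J.φtt_eq hx ht]
  exact bd_add (bd_mul_left (abs_mul_le_of_le (hb.abs_s_le hx ht) (J.abs_one_add_q_le x t))
    (hb.abs_qt x hx t ht)) (bd_mul_left (hb.abs_u_le_const hx ht) (hb.abs_ut x hx t ht))

/-- The source for `∂_t φ` is quadratic. -/
theorem exists_abs_F₁_le (K : ℝ) : ∃ C, ∀ (J : Jet) (ε : ℝ), J.Bound K ε → ∀ x t : ℝ, 0 ≤ x →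
    t ∈ Icc 0 J.T → ∀ N, J.fullDensity J.φ J.φt J.φx x t ≤ N →
    J.fullDensity J.φt J.φtt J.φtx x t ≤ N → |J.F₁ x t| ≤ C * (ε / wt x * √N) := by
  obtain ⟨Ca, hα⟩ := exists_abs_α_le K
  obtain ⟨Cb, hβ⟩ := exists_abs_β_le K
  exact ⟨_, fun J ε hb x t hx ht N h0 h1 => bd_add
    (bd_mul (hα J ε hb x t hx ht) (abs_vt_le h1))
    (bd_mul (hβ J ε hb x t hx ht) (abs_r_sq_mul_vx_le h0))⟩

theorem u_eq_div : J.u x t = J.r x t ^ 2 * J.φx x t / (1 + J.q x t) := by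
  rw [J.velocity, mul_div_cancel_left₀ _ (J.one_add_q_ne x t)]

/-- `∂_t² q` is controlled by the derivatives of `φ`. -/
theorem exists_abs_qtt_le (K : ℝ) : ∃ C, ∀ (J : Jet) (ε : ℝ), J.Bound K ε → ∀ x t : ℝ, 0 ≤ x →
    t ∈ Icc 0 J.T → ∀ N, J.fullDensity J.φ J.φt J.φx x t ≤ N →
    J.fullDensity J.φt J.φtt J.φtx x t ≤ N → J.fullDensity J.φtt J.φttt J.φttx x t ≤ N →
    |J.qtt x t| ≤ C * √N := by
  apply Exists.intro
  intro J ε hb x t hx ht N h0 h1 h2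
  have hK := hb.K_nonneg
  have hr := hb.one_le_mul_r hx ht
  have hr2 : 1 ≤ K ^ 2 * J.r x t ^ 2 := by rw [← mul_pow]; exact one_le_pow₀ hr
  have hq1 := J.one_add_q_pos x t
  have hq2 := J.one_le_mul_one_add_q x t
  have hqq := J.abs_one_add_q_le x t
  have y0 := abs_r_sq_mul_vx_le h0
  have y1 := abs_r_sq_mul_vx_le h1
  have y2 := abs_r_sq_mul_vx_le h2
  have p2 := abs_vt_le h1
  have p3 := abs_vt_le h2
  have hu : |J.u x t| ≤ 1 * 2 * √N := by
    rw [u_eq_div]; exact bd_div y0 hq1 hq2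
  have huc := hb.abs_u_le_const hx ht
  have hutc := hb.abs_ut_le_const hx ht
  have hqtc := hb.abs_qt_le_const hx ht
  have hur := abs_div_le_of_le (abs_mul_le_of_le (abs_nat_le 2) huc) (J.r_pos x t) hr
  -- The formula for `φ_tt` is solved for `q_t`; the formulas for `φ_tx` and `φ_x` are used in the
  -- same way for `u_t` and `u`.
  have hqt : |J.qt x t| ≤ (1 + K * (1 * 2)) * (K * 2) * √N := by
    have e : J.qt x t = (J.φtt x t - J.ut x t * J.u x t) / (J.s x t * (1 + J.q x t)) := by
      rw [J.φtt_eq hx ht]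
      have := J.s_ne x t
      have := J.one_add_q_ne x t
      field_simp
      ring
    rw [e]
    refine bd_div (bd_sub p2 (bd_mul_left hutc hu)) (mul_pos (J.s_pos x t) hq1) ?_
    rw [mul_mul_mul_comm]
    exact one_le_mul_of_one_le_of_one_le (hb.one_le_s x hx t ht) hq2
  have hut : |J.ut x t| ≤ (1 + K * (1 * 2) + 2 * K * K * 1) * 2 * √N := by
    have e : J.ut x t = (J.r x t ^ 2 * J.φtx x t - J.qt x t * J.u x t
        + 2 * J.u x t / J.r x t * (J.r x t ^ 2 * J.φx x t)) / (1 + J.q x t) := by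
      rw [J.r_sq_mul_φtx hx ht]
      have := J.one_add_q_ne x t
      field_simp
      ring
    rw [e]
    exact bd_div (bd_add (bd_sub y1 (bd_mul_left hqtc hu)) (bd_mul_left hur y0)) hq1 hq2
  -- The formulas for `φ_ttt` and `r² φ_ttx` form a linear system for `q_tt` and `u_tt`. Elimination
  -- of `u_tt` leaves the determinant `c² (1 + q)² - u²`. It is bounded below because the flow is
  -- strictly subsonic for small `ε`; this is the use of `small`.
  have hd : 1 ≤ 8 * K * (J.s x t * (1 + J.q x t) ^ 2 - J.u x t ^ 2) := by
    have h1 := hb.one_le_s x hx t ht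
    have h2 : J.u x t ^ 2 ≤ K ^ 2 * ε ^ 2 := by
      rw [← mul_pow, ← sq_abs]
      have := hb.abs_u x hx t ht
      have h3 : ε / wt x ≤ ε := div_le_self hb.ε_pos.le (one_le_wt x)
      have h4 : K * (ε / wt x) ≤ K * ε := by gcongr
      have := abs_nonneg (J.u x t)
      gcongr
      linarith
    have h3 : K * J.u x t ^ 2 ≤ K * (K ^ 2 * ε ^ 2) := by gcongr
    have h4 : 1 ≤ 4 * (1 + J.q x t) ^ 2 := by nlinarith
    have h5 : 1 ≤ K * J.s x t * (4 * (1 + J.q x t) ^ 2) :=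
      one_le_mul_of_one_le_of_one_le h1 h4
    have := hb.small
    nlinarith
  have e : J.qtt x t = ((1 + J.q x t) * (J.φttt x t + J.γ * J.s x t * J.qt x t * J.qt x t
      - J.ut x t * J.ut x t) - J.u x t * (J.r x t ^ 2 * J.φttx x t
      - 2 * J.qt x t * J.ut x t + 4 * J.u x t / J.r x t * (J.r x t ^ 2 * J.φtx x t)
      + (2 * J.ut x t / J.r x t + 2 * J.u x t ^ 2 / J.r x t ^ 2) * (J.r x t ^ 2 * J.φx x t)))
      / (J.s x t * (1 + J.q x t) ^ 2 - J.u x t ^ 2) := by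
    have hd0 : J.s x t * (1 + J.q x t) ^ 2 - J.u x t ^ 2 ≠ 0 := fun h0 => by
      rw [h0] at hd; norm_num at hd
    rw [eq_div_iff hd0, J.r_sq_mul_φttx hx ht, J.φttt_eq hx ht]
    ring
  have hγ : |J.γ| ≤ K := by
    have := J.one_lt_γ
    rw [abs_of_pos (by linarith)]; linarith [hb.γ_le]
  have hKpos : 0 < K := lt_of_lt_of_le one_pos hb.one_le
  rw [e]
  refine bd_div (bd_sub (bd_mul_left hqq (bd_sub (bd_add p3 (bd_mul_left (abs_mul_le_of_le
    (abs_mul_le_of_le hγ (hb.abs_s_le hx ht)) hqtc) hqt)) (bd_mul_left hutc hut)))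
    (bd_mul_left huc (bd_add (bd_add (bd_sub y2 (bd_mul_left (abs_mul_le_of_le (abs_nat_le 2)
      hqtc) hut)) (bd_mul_left (abs_div_le_of_le (abs_mul_le_of_le (abs_nat_le 4) huc)
        (J.r_pos x t) hr) y1)) (bd_mul_left (abs_add_le_of_le (abs_div_le_of_le
          (abs_mul_le_of_le (abs_nat_le 2) hutc) (J.r_pos x t) hr) (abs_div_le_of_le
          (abs_mul_le_of_le (abs_nat_le 2) (b := J.u x t ^ 2) (B := K ^ 2)
            (by rw [abs_pow]; gcongr)) (pow_pos (J.r_pos x t) 2) hr2)) y0)))) ?_ hd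
  nlinarith

/-- The source for `∂_t² φ` is quadratic. -/
theorem exists_abs_F₂_le (K : ℝ) : ∃ C, ∀ (J : Jet) (ε : ℝ), J.Bound K ε → ∀ x t : ℝ, 0 ≤ x →
    t ∈ Icc 0 J.T → ∀ N, J.fullDensity J.φ J.φt J.φx x t ≤ N →
    J.fullDensity J.φt J.φtt J.φtx x t ≤ N → J.fullDensity J.φtt J.φttt J.φttx x t ≤ N →
    |J.F₂ x t| ≤ C * (ε / wt x * √N) := by
  obtain ⟨Ca, hα⟩ := exists_abs_α_le K
  obtain ⟨Cb, hβ⟩ := exists_abs_β_le K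
  obtain ⟨Cp, hp⟩ := exists_abs_φtt_le K
  obtain ⟨C1, hF1⟩ := exists_abs_F₁_le K
  obtain ⟨Cq, hq⟩ := exists_abs_qtt_le K
  apply Exists.intro
  intro J ε hb x t hx ht N h0 h1 h2
  have hα := hα J ε hb x t hx ht
  have hβ := hβ J ε hb x t hx ht
  have hp := hp J ε hb x t hx ht
  have hF1 := hF1 J ε hb x t hx ht N h0 h1
  have hqtt := hq J ε hb x t hx ht N h0 h1 h2
  have hK := hb.K_nonneg
  have hr := hb.one_le_mul_r hx ht
  have hr2 : 1 ≤ K ^ 2 * J.r x t ^ 2 := by rw [← mul_pow]; exact one_le_pow₀ hr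
  have hr3 : 1 ≤ K ^ 3 * J.r x t ^ 3 := by rw [← mul_pow]; exact one_le_pow₀ hr
  have hq1 := J.one_add_q_pos x t
  have hq2 := J.one_le_mul_one_add_q x t
  have hq3 : 1 ≤ 2 ^ 2 * (1 + J.q x t) ^ 2 := by rw [← mul_pow]; exact one_le_pow₀ hq2
  have hqq := J.abs_one_add_q_le x t
  have hrp := J.r_pos x t
  have y0 := abs_r_sq_mul_vx_le h0
  have y1 := abs_r_sq_mul_vx_le h1
  have p2 := abs_vt_le h1
  have p3 := abs_vt_le h2
  have hu := hb.abs_u x hx t ht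
  have hut := hb.abs_ut x hx t ht
  have hqt := hb.abs_qt x hx t ht
  have huc := hb.abs_u_le_const hx ht
  have hqtc := hb.abs_qt_le_const hx ht
  have hs := hb.abs_s_le hx ht
  have hγ := hb.abs_γ_le
  have hγ' : |-(J.γ + 1)| ≤ K := by rw [abs_neg]; exact hb.abs_γ_le
  have y0' : |J.r x t ^ 2 * J.φx x t| ≤ 2 * K * (ε / wt x) := by
    rw [J.velocity]; exact bd_mul_left hqq hu
  have hαc : |J.α x t| ≤ |Ca| := hα.trans ((mul_le_mul_of_nonneg_right (le_abs_self Ca)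
    (hb.σ_nonneg x)).trans (mul_le_of_le_one_right (abs_nonneg _)
      (div_wt_le_one hb.toEnergyBound x)))
  -- Each term is arranged as a factor of size `ε/ξ` times a factor controlled by `√N`. The
  -- derivative `q_tt` has no pointwise decay, but it occurs only next to `φ_tt` or `r² φ_x`, which
  -- do decay.
  have e : J.F₂ x t = 2 * J.α x t * J.φttt x t
      + (-(J.γ + 1) / (1 + J.q x t) * (J.φtt x t * J.qtt x t)
        + ((J.γ + 1) * J.qt x t * J.qt x t / (1 + J.q x t) ^ 2 + 4 * J.ut x t / J.r x t
          - 4 * J.u x t * J.u x t / J.r x t ^ 2) * J.φtt x t)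
      - J.α x t * J.F₁ x t
      + (4 * J.s x t / J.r x t * (J.r x t ^ 2 * J.φx x t * J.qtt x t)
        + (-(J.γ + 1) * J.qt x t / (1 + J.q x t) * J.β x t
          - J.s x t * (16 * J.u x t * J.qt x t / J.r x t ^ 2
            + 12 * (1 + J.q x t) * J.ut x t / J.r x t ^ 2
            - 24 * (1 + J.q x t) * J.u x t * J.u x t / J.r x t ^ 3)
          + 2 * J.u x t / J.r x t * J.β x t) * (J.r x t ^ 2 * J.φx x t))
      + 2 * J.β x t * (J.r x t ^ 2 * J.φtx x t) := by
    rw [F₂, αt, βt]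
    have := J.r_ne x t
    have := J.one_add_q_ne x t
    field_simp
    ring
  rw [e]
  exact bd_add (bd_add (bd_sub (bd_add
    (bd_mul (bd_mul_left (abs_nat_le 2) hα) p3)
    (bd_add (bd_mul_left (abs_div_le_of_le hγ' hq1 hq2) (bd_mul hp hqtt))
      (bd_mul (bd_sub (bd_add (bd_div (bd_mul_left (abs_mul_le_of_le hγ hqtc) hqt)
        (pow_pos hq1 2) hq3) (bd_div (bd_mul_left (abs_nat_le 4) hut) hrp hr))
        (bd_div (bd_mul_left (abs_mul_le_of_le (abs_nat_le 4) huc) hu) (pow_pos hrp 2) hr2)) p2)))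
    (bd_mul_left hαc hF1))
    (bd_add (bd_mul_left (abs_div_le_of_le (abs_mul_le_of_le (abs_nat_le 4) hs) hrp hr)
        (bd_mul y0' hqtt))
      (bd_mul (bd_add (bd_sub (bd_mul_left
        (abs_div_le_of_le (abs_mul_le_of_le hγ' hqtc) hq1 hq2) hβ)
        (bd_mul_left hs (bd_sub (bd_add (bd_div (bd_mul_left (abs_mul_le_of_le (abs_nat_le 16) huc)
          hqt) (pow_pos hrp 2) hr2) (bd_div (bd_mul_left (abs_mul_le_of_le (abs_nat_le 12) hqq) hut)
            (pow_pos hrp 2) hr2)) (bd_div (bd_mul_left (abs_mul_le_of_le (abs_mul_le_of_le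
              (abs_nat_le 24) hqq) huc) hu) (pow_pos hrp 3) hr3))))
        (bd_mul_left (abs_div_le_of_le (abs_mul_le_of_le (abs_nat_le 2) huc) hrp hr) hβ)) y0)))
    (bd_mul (bd_mul_left (abs_nat_le 2) hβ) y1)

end Jet

/-! ### The logarithmic weight -/

@[fun_prop] theorem continuous_wt_inv : Continuous fun x => (wt x)⁻¹ :=
  continuous_wt.inv₀ wt_ne

/-- A bounded increasing weight with `∂_ξ g = 1 / ξ - 1 / (τ + ξ)`. -/
def logWeight (τ x : ℝ) : ℝ := 1 + Real.log (wt x) + Real.log (1 + τ) - Real.log (τ + wt x)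

def logWeight' (τ x : ℝ) : ℝ := ((wt x)⁻¹ - (τ + wt x)⁻¹) * (wt x ^ 2)⁻¹

section LogWeight

variable {τ : ℝ} (hτ : 0 < τ)
include hτ

theorem continuous_logWeight : Continuous (logWeight τ) := by
  have h1 : Continuous fun x => Real.log (wt x) := continuous_wt.log wt_ne
  have h2 : Continuous fun x => Real.log (τ + wt x) :=
    Continuous.log (by fun_prop) fun x => (add_pos hτ (wt_pos x)).ne'
  unfold logWeight
  fun_prop

theorem continuous_logWeight' : Continuous (logWeight' τ) := by
  unfold logWeight'
  refine Continuous.mul (Continuous.sub (by fun_prop) (Continuous.inv₀ (by fun_prop) fun x => ?_))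
    (Continuous.inv₀ (by fun_prop) fun x => pow_ne_zero _ (wt_ne x))
  exact (add_pos hτ (wt_pos x)).ne'

theorem hasDerivAt_logWeight {x : ℝ} (hx : 0 < x) :
    HasDerivAt (logWeight τ) (logWeight' τ x) x := by
  have h := hasDerivAt_wt hx
  have h1 := h.log (wt_ne x)
  have h2 := (h.const_add τ).log (add_pos hτ (wt_pos x)).ne'
  refine (((h1.const_add 1).add_const (Real.log (1 + τ))).sub h2).congr_deriv ?_
  unfold logWeight'
  ring

/-- Equivalent to `τ + ξ ≤ ξ (1 + τ)`, which is `ξ ≥ 1`. The additive constant in the weight is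
chosen so that equality holds at `ξ = 1`. -/
theorem one_le_logWeight (x : ℝ) : 1 ≤ logWeight τ x := by
  have h1 := one_le_wt x
  have h2 : Real.log (τ + wt x) ≤ Real.log (wt x * (1 + τ)) :=
    Real.log_le_log (by linarith) (by nlinarith)
  rw [Real.log_mul (wt_ne x) (by linarith)] at h2
  unfold logWeight
  linarith

theorem logWeight_le (x : ℝ) : logWeight τ x ≤ 1 + Real.log (1 + τ) := by
  have h1 := wt_pos x
  have h2 : Real.log (wt x) ≤ Real.log (τ + wt x) := Real.log_le_log h1 (by linarith)
  unfold logWeight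
  linarith

/-- The gain `1/ξ` is kept up to the constant loss `1/τ`, affordable on time intervals of length at
most `τ`. -/
theorem logWeight'_ge (x : ℝ) : ((wt x)⁻¹ - τ⁻¹) * (wt x ^ 2)⁻¹ ≤ logWeight' τ x := by
  have h1 := wt_pos x
  unfold logWeight'
  gcongr
  linarith

theorem logWeight'_nonneg (x : ℝ) : 0 ≤ logWeight' τ x := by
  have h1 := wt_pos x
  have h2 : (τ + wt x)⁻¹ ≤ (wt x)⁻¹ := inv_anti₀ h1 (by linarith)
  unfold logWeight'
  exact mul_nonneg (by linarith) (by positivity)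

end LogWeight

/-! ### Iterated integrals of continuous functions -/

/-- The integral over `[0, X] × [0, T]`. -/
def iint (X T : ℝ) (f : ℝ → ℝ → ℝ) : ℝ := ∫ t in (0 : ℝ)..T, ∫ x in (0 : ℝ)..X, f x t

section Iint

variable {X T : ℝ} {f g : ℝ → ℝ → ℝ} (hf : Continuous fun z : ℝ × ℝ => f z.1 z.2)
  (hg : Continuous fun z : ℝ × ℝ => g z.1 z.2)

theorem continuous_fst_slice (hf : Continuous fun z : ℝ × ℝ => f z.1 z.2) (t : ℝ) :
    Continuous fun x => f x t := hf.comp (f := fun x => (x, t)) (by fun_prop)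

theorem continuous_snd_slice (hf : Continuous fun z : ℝ × ℝ => f z.1 z.2) (x : ℝ) :
    Continuous fun t => f x t := hf.comp (f := fun t => (x, t)) (by fun_prop)

include hf hg in
theorem iint_mono (hX : 0 ≤ X) (hT : 0 ≤ T)
    (h : ∀ x ∈ Icc 0 X, ∀ t ∈ Icc 0 T, f x t ≤ g x t) : iint X T f ≤ iint X T g :=
  integral_mono_of_le (continuous_integral hf _ _) (continuous_integral hg _ _) hT fun t ht =>
    integral_mono_of_le (continuous_fst_slice hf t) (continuous_fst_slice hg t) hX
      fun x hx => h x hx t ht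

theorem iint_const_mul (c : ℝ) : iint X T (fun x t => c * f x t) = c * iint X T f := by
  simp only [iint, intervalIntegral.integral_const_mul]

include hf hg in
theorem iint_add : iint X T (fun x t => f x t + g x t) = iint X T f + iint X T g := by
  unfold iint
  rw [← intervalIntegral.integral_add ((continuous_integral hf _ _).intervalIntegrable _ _)
    ((continuous_integral hg _ _).intervalIntegrable _ _)]
  refine intervalIntegral.integral_congr fun t _ => ?_
  exact intervalIntegral.integral_add ((continuous_fst_slice hf t).intervalIntegrable _ _)
    ((continuous_fst_slice hg t).intervalIntegrable _ _)

include hf in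
theorem iint_le (hT : 0 ≤ T) {S : ℝ} (h : ∀ t ∈ Icc 0 T, ∫ x in (0 : ℝ)..X, f x t ≤ S) :
    iint X T f ≤ T * S := by
  refine (integral_mono_of_le (continuous_integral hf _ _) continuous_const hT h).trans ?_
  rw [intervalIntegral.integral_const, smul_eq_mul, sub_zero]

theorem iint_nonneg (hX : 0 ≤ X) (hT : 0 ≤ T) (h : ∀ x ∈ Icc 0 X, ∀ t ∈ Icc 0 T, 0 ≤ f x t) :
    0 ≤ iint X T f :=
  intervalIntegral.integral_nonneg hT fun t ht =>
    intervalIntegral.integral_nonneg hX fun x hx => h x hx t ht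

end Iint

namespace Jet

variable {J : Jet} {K ε : ℝ}

/-! ### Comparison of densities and the Hardy inequality -/

section Density

variable {v vt vx F : ℝ → ℝ → ℝ} (cv : Continuous fun z : ℝ × ℝ => v z.1 z.2)
  (cvt : Continuous fun z : ℝ × ℝ => vt z.1 z.2) (cvx : Continuous fun z : ℝ × ℝ => vx z.1 z.2)
  (cF : Continuous fun z : ℝ × ℝ => F z.1 z.2)

include cv cvx in
theorem continuous_radial' : Continuous fun z : ℝ × ℝ => J.radial v vx z.1 z.2 :=
  continuous_radial (v := fun _ => v) (vx := fun _ => vx) continuous_fst continuous_snd cv cvx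

include cv cvt cvx in
theorem continuous_mulDensity : Continuous fun z : ℝ × ℝ => J.mulDensity v vt vx z.1 z.2 := by
  have := continuous_radial' (J := J) cv cvx
  unfold mulDensity
  fun_prop

include cv cvt cvx cF in
theorem continuous_mulError : Continuous fun z : ℝ × ℝ => J.mulError v vt vx F z.1 z.2 := by
  have := continuous_radial' (J := J) cv cvx
  unfold mulError
  fun_prop (disch := intro z; first | exact J.r_ne _ _ | exact J.one_add_q_ne _ _)

include cv cvt cvx in
theorem continuous_fullDensity : Continuous fun z : ℝ × ℝ => J.fullDensity v vt vx z.1 z.2 := by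
  unfold fullDensity
  fun_prop (disch := intro z; exact wt_ne _)

theorem mulDensity_nonneg (x t : ℝ) : 0 ≤ J.mulDensity v vt vx x t := by
  have := J.s_pos x t
  unfold mulDensity; positivity

theorem EnergyBound.abs_vt_mul_radial_le (hb : J.EnergyBound K ε) {x t : ℝ} (hx : 0 ≤ x)
    (ht : t ∈ Icc 0 J.T) :
    |vt x t * J.radial v vx x t| ≤ (1 + 2 * K) * J.fullDensity v vt vx x t := by
  have hN := fullDensity_nonneg (J := J) (x := x) (t := t) v vt vx
  have h := bd_mul (abs_vt_le (le_refl (J.fullDensity v vt vx x t)))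
    (hb.abs_radial_le (le_refl (J.fullDensity v vt vx x t)) hx ht)
  rw [Real.mul_self_sqrt hN] at h
  simpa using h

theorem EnergyBound.mulDensity_le (hb : J.EnergyBound K ε) {x t : ℝ} (hx : 0 ≤ x)
    (ht : t ∈ Icc 0 J.T) :
    J.mulDensity v vt vx x t ≤ (1 + K * (1 + 2 * K) ^ 2) * J.fullDensity v vt vx x t := by
  have hN := fullDensity_nonneg (J := J) (x := x) (t := t) v vt vx
  have h1 := abs_vt_le (le_refl (J.fullDensity v vt vx x t))
  have h2 := hb.abs_radial_le (le_refl (J.fullDensity v vt vx x t)) hx ht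
  have e1 : vt x t ^ 2 ≤ J.fullDensity v vt vx x t := by
    unfold fullDensity; nlinarith [sq_nonneg (J.r x t ^ 2 * vx x t), sq_nonneg (v x t / wt x)]
  have e2 : J.radial v vx x t ^ 2 ≤ (1 + 2 * K) ^ 2 * J.fullDensity v vt vx x t := by
    have := pow_le_pow_left₀ (abs_nonneg _) h2 2
    rw [sq_abs, mul_pow, Real.sq_sqrt hN, one_mul] at this
    exact this
  have hs := hb.s_le x hx t ht
  have hs0 := (J.s_pos x t).le
  unfold mulDensity
  calc vt x t ^ 2 + J.s x t * J.radial v vx x t ^ 2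
      ≤ J.fullDensity v vt vx x t + K * ((1 + 2 * K) ^ 2 * J.fullDensity v vt vx x t) := by
        have := sq_nonneg (J.radial v vx x t)
        gcongr
        exact hb.K_nonneg
    _ = _ := by ring

include cv cvx in
/-- Hardy's inequality on `[0, X]`, with a boundary term at `x = 0`. -/
theorem hardy {t : ℝ} (ht : t ∈ Icc 0 J.T) (xv : HasDx J.T v vx) {X : ℝ} (hX : 0 ≤ X) :
    ∫ x in (0 : ℝ)..X, v x t ^ 2 / J.r x t ^ 3
      ≤ 2 * v 0 t ^ 2 + 4 * ∫ x in (0 : ℝ)..X, J.radial v vx x t ^ 2 / J.r x t := by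
  have cZ := continuous_radial' (J := J) cv cvx
  have lv := continuous_fst_slice cv t
  have lvx := continuous_fst_slice cvx t
  have lZ := continuous_fst_slice cZ t
  have h1 := integral_eq_sub_of_pos (f := fun x => v x t ^ 2) (f' := fun x => 2 * v x t * vx x t)
    (by fun_prop) (by fun_prop) (fun x hx => ((xv x hx t ht).fun_pow 2).congr_deriv
      (by push_cast; ring)) le_rfl hX
  have c1 : Continuous fun x => v x t ^ 2 / J.r x t ^ 3 := by
    fun_prop (disch := intro z; exact pow_ne_zero _ (J.r_ne _ _))
  have c2 : Continuous fun x => J.radial v vx x t ^ 2 / J.r x t := by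
    fun_prop (disch := intro z; exact J.r_ne _ _)
  -- Pointwise, `-(v²)_x = 2 (1 + q) v² / r³ - 2 v Z / r²` with `Z` the radial derivative. The
  -- assumption `q ≥ -1/2` makes the first coefficient at least one, and half of it pays for the
  -- cross term.
  have h2 : ∫ x in (0 : ℝ)..X, (v x t ^ 2 / J.r x t ^ 3 / 2 - 2 * (J.radial v vx x t ^ 2 / J.r x t))
      ≤ ∫ x in (0 : ℝ)..X, -(2 * v x t * vx x t) := by
    refine integral_mono_of_le (by fun_prop) (by fun_prop) hX fun x _ => ?_
    have hr := J.r_pos x t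
    have e : vx x t = (J.radial v vx x t - (1 + J.q x t) * v x t / J.r x t) / J.r x t ^ 2 := by
      unfold radial; field_simp; ring
    have e2 : -(2 * v x t * vx x t) - (v x t ^ 2 / J.r x t ^ 3 / 2
        - 2 * (J.radial v vx x t ^ 2 / J.r x t))
        = ((1 + 2 * J.q x t) * v x t ^ 2 + (v x t - 2 * J.r x t * J.radial v vx x t) ^ 2 / 2)
          / J.r x t ^ 3 := by
      rw [e]; field_simp; ring
    have hq : 0 ≤ 1 + 2 * J.q x t := by linarith [(J.q_mem x t).1]
    have : 0 ≤ ((1 + 2 * J.q x t) * v x t ^ 2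
        + (v x t - 2 * J.r x t * J.radial v vx x t) ^ 2 / 2) / J.r x t ^ 3 := by positivity
    linarith
  rw [intervalIntegral.integral_neg, h1, intervalIntegral.integral_sub
    ((c1.div_const 2).intervalIntegrable _ _) ((c2.const_mul 2).intervalIntegrable _ _),
    intervalIntegral.integral_div, intervalIntegral.integral_const_mul] at h2
  nlinarith [sq_nonneg (v X t)]

include cv cvt cvx in
-- Hardy's inequality bounds `v² / r³`. Subtracting `(1 + q) v / r` from the radial derivative then
-- recovers `r² v_x`, and `r` is exchanged for `ξ` at the cost of powers of `K`.
theorem EnergyBound.integral_fullDensity_le (hb : J.EnergyBound K ε) {t : ℝ} (ht : t ∈ Icc 0 J.T)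
    (xv : HasDx J.T v vx) {X : ℝ} (hX : 0 ≤ X) :
    ∫ x in (0 : ℝ)..X, (wt x)⁻¹ * J.fullDensity v vt vx x t
      ≤ (1 + 2 * K + 4 * K ^ 2 * (8 * K + K ^ 3))
          * (∫ x in (0 : ℝ)..X, (wt x)⁻¹ * J.mulDensity v vt vx x t)
        + 2 * (8 * K + K ^ 3) * v 0 t ^ 2 := by
  have hK := hb.K_nonneg
  have hH := hardy cv cvx ht xv hX
  have cZ := continuous_radial' (J := J) cv cvx
  have lv := continuous_fst_slice cv t
  have lZ := continuous_fst_slice cZ t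
  have lm := continuous_fst_slice (continuous_mulDensity (J := J) cv cvt cvx) t
  have lf := continuous_fst_slice (continuous_fullDensity (J := J) cv cvt cvx) t
  have c1 : Continuous fun x => v x t ^ 2 / J.r x t ^ 3 := by
    fun_prop (disch := intro z; exact pow_ne_zero _ (J.r_ne _ _))
  have c2 : Continuous fun x => J.radial v vx x t ^ 2 / J.r x t := by
    fun_prop (disch := intro z; exact J.r_ne _ _)
  have c3 : Continuous fun x => (wt x)⁻¹ * J.mulDensity v vt vx x t := by fun_prop
  have hinv : ∀ x, 0 ≤ x → 1 / J.r x t ≤ K * (wt x)⁻¹ ∧ (wt x)⁻¹ ≤ K * (1 / J.r x t) := by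
    intro x hx
    have hr := J.r_pos x t
    have hw := wt_pos x
    constructor
    · rw [div_le_iff₀ hr, ← div_eq_mul_inv, div_mul_eq_mul_div, le_div_iff₀ hw, one_mul]
      exact hb.wt_le x hx t ht
    · rw [mul_one_div, le_div_iff₀ hr, inv_mul_le_iff₀ hw, mul_comm]
      exact hb.r_le x hx t ht
  have hZ : ∀ x, 0 ≤ x → J.radial v vx x t ^ 2 ≤ K * J.mulDensity v vt vx x t := by
    intro x hx
    have h1 := hb.one_le_s x hx t ht
    have h2 := sq_nonneg (J.radial v vx x t)
    have h3 := mul_nonneg hK (sq_nonneg (vt x t))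
    unfold mulDensity
    nlinarith
  have h1 : ∫ x in (0 : ℝ)..X, J.radial v vx x t ^ 2 / J.r x t
      ≤ K ^ 2 * ∫ x in (0 : ℝ)..X, (wt x)⁻¹ * J.mulDensity v vt vx x t := by
    rw [← intervalIntegral.integral_const_mul]
    refine integral_mono_of_le c2 (by fun_prop) hX fun x hx => ?_
    have hr := J.r_pos x t
    have hw := wt_pos x
    have := mulDensity_nonneg (J := J) (v := v) (vt := vt) (vx := vx) x t
    calc J.radial v vx x t ^ 2 / J.r x t = 1 / J.r x t * J.radial v vx x t ^ 2 := by ring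
      _ ≤ K * (wt x)⁻¹ * (K * J.mulDensity v vt vx x t) := by
          have h1 := (hinv x hx.1).1
          have h2 := hZ x hx.1
          gcongr
      _ = _ := by ring
  have h2 : ∫ x in (0 : ℝ)..X, (wt x)⁻¹ * J.fullDensity v vt vx x t
      ≤ ∫ x in (0 : ℝ)..X, ((1 + 2 * K) * ((wt x)⁻¹ * J.mulDensity v vt vx x t)
        + (8 * K + K ^ 3) * (v x t ^ 2 / J.r x t ^ 3)) := by
    refine integral_mono_of_le (by fun_prop) (by fun_prop) hX fun x hx => ?_
    have hr := J.r_pos x t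
    have hw := wt_pos x
    have hw' : 0 < (wt x)⁻¹ := inv_pos.2 hw
    have e : J.r x t ^ 2 * vx x t = J.radial v vx x t - (1 + J.q x t) * v x t / J.r x t := by
      unfold radial; ring
    have hq := abs_le.1 (J.abs_one_add_q_le x t)
    have hv3 : 0 ≤ v x t ^ 2 / J.r x t ^ 3 := by positivity
    have hi := (hinv x hx.1).2
    have a1 : (J.r x t ^ 2 * vx x t) ^ 2 ≤ 2 * (K * J.mulDensity v vt vx x t)
        + 8 * (v x t ^ 2 / J.r x t ^ 2) := by
      have b1 : ((1 + J.q x t) * v x t / J.r x t) ^ 2 ≤ 4 * (v x t ^ 2 / J.r x t ^ 2) := by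
        rw [div_pow, mul_pow, mul_div_assoc]
        have : 0 ≤ v x t ^ 2 / J.r x t ^ 2 := by positivity
        gcongr
        nlinarith
      rw [e]
      nlinarith [hZ x hx.1,
        sq_nonneg (J.radial v vx x t + (1 + J.q x t) * v x t / J.r x t)]
    have a2 : vt x t ^ 2 ≤ J.mulDensity v vt vx x t := by
      have := J.s_pos x t
      have : 0 ≤ J.s x t * J.radial v vx x t ^ 2 := by positivity
      unfold mulDensity; linarith
    have a3 : (wt x)⁻¹ * (8 * (v x t ^ 2 / J.r x t ^ 2)) ≤ 8 * K * (v x t ^ 2 / J.r x t ^ 3) := by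
      calc (wt x)⁻¹ * (8 * (v x t ^ 2 / J.r x t ^ 2))
          ≤ K * (1 / J.r x t) * (8 * (v x t ^ 2 / J.r x t ^ 2)) := by gcongr
        _ = _ := by field_simp
    have a4 : (wt x)⁻¹ * (v x t / wt x) ^ 2 ≤ K ^ 3 * (v x t ^ 2 / J.r x t ^ 3) := by
      calc (wt x)⁻¹ * (v x t / wt x) ^ 2 = ((wt x)⁻¹) ^ 3 * v x t ^ 2 := by field_simp
        _ ≤ (K * (1 / J.r x t)) ^ 3 * v x t ^ 2 := by gcongr
        _ = _ := by field_simp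
    calc (wt x)⁻¹ * J.fullDensity v vt vx x t
        = (wt x)⁻¹ * vt x t ^ 2 + (wt x)⁻¹ * (J.r x t ^ 2 * vx x t) ^ 2
          + (wt x)⁻¹ * (v x t / wt x) ^ 2 := by unfold fullDensity; ring
      _ ≤ (wt x)⁻¹ * J.mulDensity v vt vx x t
          + (wt x)⁻¹ * (2 * (K * J.mulDensity v vt vx x t) + 8 * (v x t ^ 2 / J.r x t ^ 2))
          + K ^ 3 * (v x t ^ 2 / J.r x t ^ 3) := by gcongr
      _ ≤ _ := by linarith
  rw [intervalIntegral.integral_add (Continuous.intervalIntegrable (by fun_prop) _ _)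
    (Continuous.intervalIntegrable (by fun_prop) _ _), intervalIntegral.integral_const_mul,
    intervalIntegral.integral_const_mul] at h2
  have h3 : 0 ≤ 8 * K + K ^ 3 := by positivity
  have h4 := mul_le_mul_of_nonneg_left h1 h3
  have h5 := mul_le_mul_of_nonneg_left hH h3
  linarith

end Density

end Jet

namespace Jet

/-! ### The weighted space-time estimate -/

/-- The weight function for a flow on `[0, T]`. -/
def weight (J : Jet) : ℝ → ℝ := logWeight (1 + J.T)

def weight' (J : Jet) : ℝ → ℝ := logWeight' (1 + J.T)

/-- An upper bound for the weight. -/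
def weightSup (J : Jet) : ℝ := 1 + Real.log (1 + (1 + J.T))

/-- The flux through `{x = X}` in the multiplier identity. -/
def outerFlux (J : Jet) (X T' : ℝ) (v vt vx : ℝ → ℝ → ℝ) : ℝ :=
  ∫ t in (0 : ℝ)..T', 1 / 2 * J.weight X * J.r X t ^ 2 * J.mulDensity v vt vx X t

theorem one_add_T_pos (J : Jet) : 0 < 1 + J.T := add_pos one_pos J.T_pos

theorem one_le_weightSup (J : Jet) : 1 ≤ J.weightSup :=
  (one_le_logWeight J.one_add_T_pos 0).trans (logWeight_le J.one_add_T_pos 0)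

/-- The multiplier identity with the logarithmic weight. The interior and inner-boundary terms have
a sign and move to the left; what remains is the time-boundary term, the loss `1/τ`, the errors and
the outer flux. The density `N` may exceed that of `v`, because the sources at higher levels also
involve lower levels. -/
theorem exists_weighted_le (K CF : ℝ) : ∃ C, 0 ≤ C ∧ ∀ (J : Jet) (ε : ℝ), J.Bound K ε →
    ∀ v vt vx F N : ℝ → ℝ → ℝ, (Continuous fun z : ℝ × ℝ => v z.1 z.2) →
    (Continuous fun z : ℝ × ℝ => vt z.1 z.2) → (Continuous fun z : ℝ × ℝ => vx z.1 z.2) →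
    (Continuous fun z : ℝ × ℝ => F z.1 z.2) → (Continuous fun z : ℝ × ℝ => N z.1 z.2) →
    ∀ X T', 0 ≤ X → 0 ≤ T' → T' ≤ J.T →
    J.MultiplierIdentity J.weight J.weight' X T' v vt vx F →
    (∀ x, 0 ≤ x → ∀ t ∈ Icc 0 J.T, J.fullDensity v vt vx x t ≤ N x t) →
    (∀ x, 0 ≤ x → ∀ t ∈ Icc 0 J.T, |F x t| ≤ CF * (ε / wt x * √(N x t))) →
    ∀ S, (∀ t ∈ Icc 0 J.T, ∫ x in (0 : ℝ)..X, J.fullDensity v vt vx x t ≤ S) →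
    iint X T' (fun x t => (wt x)⁻¹ * J.mulDensity v vt vx x t)
      + ∫ t in (0 : ℝ)..T', J.mulDensity v vt vx 0 t
      ≤ C * (J.weightSup * S + ε * J.weightSup * iint X T' (fun x t => (wt x)⁻¹ * N x t)
        + J.outerFlux X T' v vt vx) := by
  obtain ⟨CE, hCE⟩ := exists_abs_mulError_le K CF
  by_cases hK : 0 ≤ K
  swap
  · exact ⟨0, le_rfl, fun J ε hb => absurd hb.K_nonneg hK⟩
  set C1 := 1 + K * (1 + 2 * K) ^ 2 with hC1
  have hC1' : 0 ≤ C1 := by positivity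
  refine ⟨C1 + 2 * K ^ 2 * (2 * (1 + 2 * K) + |CE| + 1), by positivity, ?_⟩
  intro J ε hb v vt vx F N cv cvt cvx cF cN X T' hX hT' hTT hm hN hF S hS
  -- The summand `1` keeps `τ` positive and bounded away from zero for small `T`, while `T ≤ τ`
  -- always.
  set τ := 1 + J.T with hτ
  have hτ0 : 0 < τ := J.one_add_T_pos
  set G := J.weightSup with hG
  have hG1 : 1 ≤ G := J.one_le_weightSup
  have cg : Continuous J.weight := continuous_logWeight hτ0
  have cg' : Continuous J.weight' := continuous_logWeight' hτ0
  have g1 : ∀ x, 1 ≤ J.weight x := one_le_logWeight hτ0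
  have gG : ∀ x, J.weight x ≤ G := logWeight_le hτ0
  have cm := continuous_mulDensity (J := J) cv cvt cvx
  have cf := continuous_fullDensity (J := J) cv cvt cvx
  have cZ := continuous_radial' (J := J) cv cvx
  have ce := continuous_mulError (J := J) cv cvt cvx cF
  have hmem : ∀ t ∈ Icc 0 T', t ∈ Icc 0 J.T := fun t ht => ⟨ht.1, ht.2.trans hTT⟩
  have hS0 : 0 ≤ S := (intervalIntegral.integral_nonneg hX fun x _ =>
    fullDensity_nonneg v vt vx).trans (hS 0 ⟨le_rfl, J.T_pos.le⟩)
  have hε := hb.ε_pos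
  -- the time boundary
  have i1 : -(∫ x in (0 : ℝ)..X, (J.weight x * vt x T' * J.radial v vx x T'
      - J.weight x * vt x 0 * J.radial v vx x 0)) ≤ 2 * (G * (1 + 2 * K)) * S := by
    have lf := fun t => continuous_fst_slice cf t
    have lvt := fun t => continuous_fst_slice cvt t
    have lZ := fun t => continuous_fst_slice cZ t
    have hp : ∀ x, 0 ≤ x → ∀ t ∈ Icc 0 J.T, |J.weight x * vt x t * J.radial v vx x t|
        ≤ G * (1 + 2 * K) * J.fullDensity v vt vx x t := fun x hx t ht => by
      rw [mul_assoc, mul_assoc G]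
      refine abs_mul_le_of_le ?_ (hb.abs_vt_mul_radial_le hx ht)
      rw [abs_of_nonneg (zero_le_one.trans (g1 x))]
      exact gG x
    rw [← intervalIntegral.integral_neg]
    have i := integral_mono_of_le (a := 0) (b := X)
      (f := fun x => -(J.weight x * vt x T' * J.radial v vx x T'
        - J.weight x * vt x 0 * J.radial v vx x 0))
      (g := fun x => G * (1 + 2 * K) * J.fullDensity v vt vx x T'
        + G * (1 + 2 * K) * J.fullDensity v vt vx x 0)
      (by
        have := lvt T'
        have := lvt 0
        have := lZ T'
        have := lZ 0
        fun_prop)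
      (by
        have := lf T'
        have := lf 0
        fun_prop) hX fun x hx => by
      have h1 := abs_le.1 (hp x hx.1 T' ⟨hT', hTT⟩)
      have h2 := abs_le.1 (hp x hx.1 0 ⟨le_rfl, J.T_pos.le⟩)
      linarith [h1.1, h2.2]
    rw [intervalIntegral.integral_add (((lf T').const_mul _).intervalIntegrable _ _)
      (((lf 0).const_mul _).intervalIntegrable _ _), intervalIntegral.integral_const_mul,
      intervalIntegral.integral_const_mul] at i
    have h3 := hS T' ⟨hT', hTT⟩
    have h4 := hS 0 ⟨le_rfl, J.T_pos.le⟩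
    have h5 : 0 ≤ G * (1 + 2 * K) := by positivity
    nlinarith [mul_le_mul_of_nonneg_left h3 h5, mul_le_mul_of_nonneg_left h4 h5]
  -- the interior
  have i2 : iint X T' (fun x t => (wt x)⁻¹ * J.mulDensity v vt vx x t)
      ≤ τ⁻¹ * iint X T' (J.mulDensity v vt vx)
        + 2 * K ^ 2 * iint X T' (fun x t =>
          1 / 2 * J.weight' x * J.r x t ^ 2 * J.mulDensity v vt vx x t) := by
    rw [← iint_const_mul, ← iint_const_mul, ← iint_add (by fun_prop) (by fun_prop)]
    refine iint_mono (by fun_prop (disch := intro z; exact wt_ne _)) (by fun_prop) hX hT'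
      fun x hx t ht => ?_
    have h1 := logWeight'_ge hτ0 x
    have h2 := logWeight'_nonneg hτ0 x
    have h3 := mulDensity_nonneg (J := J) (v := v) (vt := vt) (vx := vx) x t
    have h4 : wt x ^ 2 ≤ K ^ 2 * J.r x t ^ 2 := by
      rw [← mul_pow]
      have := hb.wt_le x hx.1 t (hmem t ht)
      have := (wt_pos x).le
      gcongr
    have h5 : (wt x)⁻¹ - τ⁻¹ ≤ J.weight' x * (K ^ 2 * J.r x t ^ 2) := by
      have h6 : logWeight' τ x * wt x ^ 2 ≤ logWeight' τ x * (K ^ 2 * J.r x t ^ 2) := by gcongr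
      refine le_trans ?_ h6
      have h7 := mul_le_mul_of_nonneg_right h1 (sq_nonneg (wt x))
      rwa [inv_mul_cancel_right₀ (pow_ne_zero _ (wt_ne x))] at h7
    have h6 := mul_le_mul_of_nonneg_right h5 h3
    linarith
  -- The loss `1/τ` integrated over a time at most `τ` costs one energy, without a logarithm.
  have i3 : τ⁻¹ * iint X T' (J.mulDensity v vt vx) ≤ C1 * S := by
    have h1 : iint X T' (J.mulDensity v vt vx) ≤ T' * (C1 * S) := by
      refine iint_le cm hT' fun t ht => ?_
      refine (integral_mono_of_le (continuous_fst_slice cm t)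
        ((continuous_fst_slice cf t).const_mul C1) hX
        fun x hx => hb.mulDensity_le hx.1 (hmem t ht)).trans ?_
      rw [intervalIntegral.integral_const_mul]
      exact mul_le_mul_of_nonneg_left (hS t (hmem t ht)) hC1'
    rw [inv_mul_le_iff₀ hτ0]
    refine h1.trans (mul_le_mul_of_nonneg_right ?_ (by positivity))
    linarith
  -- the inner boundary
  have i4 : ∫ t in (0 : ℝ)..T', J.mulDensity v vt vx 0 t ≤ 2 * K ^ 2 * ∫ t in (0 : ℝ)..T',
      1 / 2 * J.weight 0 * J.r 0 t ^ 2 * J.mulDensity v vt vx 0 t := by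
    have lm := continuous_snd_slice cm 0
    rw [← intervalIntegral.integral_const_mul]
    refine integral_mono_of_le lm (by fun_prop) hT' fun t ht => ?_
    have h3 := mulDensity_nonneg (J := J) (v := v) (vt := vt) (vx := vx) 0 t
    have h4 : 1 ≤ K ^ 2 * J.r 0 t ^ 2 := by
      rw [← mul_pow]; exact one_le_pow₀ (hb.one_le_mul_r le_rfl (hmem t ht))
    have h5 : 1 ≤ J.weight 0 * (K ^ 2 * J.r 0 t ^ 2) :=
      one_le_mul_of_one_le_of_one_le (g1 0) h4
    have h6 := mul_le_mul_of_nonneg_right h5 h3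
    linarith
  -- the error
  have i5 : iint X T' (fun x t => J.weight x * J.mulError v vt vx F x t)
      ≤ G * |CE| * ε * iint X T' (fun x t => (wt x)⁻¹ * N x t) := by
    rw [← iint_const_mul]
    refine iint_mono (by fun_prop) (by fun_prop (disch := intro z; exact wt_ne _)) hX hT'
      fun x hx t ht => ?_
    have ht' := hmem t ht
    have hN0 : 0 ≤ N x t := (fullDensity_nonneg v vt vx).trans (hN x hx.1 t ht')
    have h1 := hCE J ε hb v vt vx F x t hx.1 ht' (N x t) (hN x hx.1 t ht') (hF x hx.1 t ht')
    rw [Real.mul_self_sqrt hN0] at h1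
    have h2 : 0 ≤ ε / wt x * N x t := mul_nonneg (hb.σ_nonneg x) hN0
    have h3 := bd_mono h1 (le_abs_self CE) h2
    have h4 : |J.weight x| ≤ G := by
      rw [abs_of_nonneg (zero_le_one.trans (g1 x))]; exact gG x
    refine (le_abs_self _).trans ((abs_mul_le_of_le h4 h3).trans_eq ?_)
    rw [div_eq_mul_inv]; ring
  have lm := continuous_snd_slice cm
  have hsub : (∫ t in (0 : ℝ)..T', (1 / 2 * J.weight X * J.r X t ^ 2 * J.mulDensity v vt vx X t
      - 1 / 2 * J.weight 0 * J.r 0 t ^ 2 * J.mulDensity v vt vx 0 t))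
      = J.outerFlux X T' v vt vx - ∫ t in (0 : ℝ)..T',
        1 / 2 * J.weight 0 * J.r 0 t ^ 2 * J.mulDensity v vt vx 0 t :=
    intervalIntegral.integral_sub
      (Continuous.intervalIntegrable (by have := lm X; fun_prop) _ _)
      (Continuous.intervalIntegrable (by have := lm 0; fun_prop) _ _)
  have hm' := hm
  rw [MultiplierIdentity, hsub] at hm'
  change _ = J.outerFlux X T' v vt vx - _ - iint X T' (fun x t =>
    1 / 2 * J.weight' x * J.r x t ^ 2 * J.mulDensity v vt vx x t)
    + iint X T' (fun x t => J.weight x * J.mulError v vt vx F x t) at hm'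
  have hO : 0 ≤ J.outerFlux X T' v vt vx := intervalIntegral.integral_nonneg hT' fun t _ => by
    have := mulDensity_nonneg (J := J) (v := v) (vt := vt) (vx := vx) X t
    have := zero_le_one.trans (g1 X)
    positivity
  have hI : 0 ≤ iint X T' (fun x t => (wt x)⁻¹ * N x t) := iint_nonneg hX hT' fun x hx t ht =>
    mul_nonneg (inv_pos.2 (wt_pos x)).le
      ((fullDensity_nonneg v vt vx).trans (hN x hx.1 t (hmem t ht)))
  have hGS : S ≤ G * S := le_mul_of_one_le_left hS0 hG1
  set O := J.outerFlux X T' v vt vx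
  set I := iint X T' (fun x t => (wt x)⁻¹ * N x t)
  have hK2 : 0 ≤ 2 * K ^ 2 := by positivity
  have m1 : 2 * K ^ 2 * (iint X T' (fun x t =>
      1 / 2 * J.weight' x * J.r x t ^ 2 * J.mulDensity v vt vx x t) + ∫ t in (0 : ℝ)..T',
      1 / 2 * J.weight 0 * J.r 0 t ^ 2 * J.mulDensity v vt vx 0 t)
      ≤ 2 * K ^ 2 * (O + 2 * (G * (1 + 2 * K)) * S + G * |CE| * ε * I) :=
    mul_le_mul_of_nonneg_left (by linarith) hK2
  have m2 : C1 * S ≤ C1 * (G * S) := mul_le_mul_of_nonneg_left hGS hC1'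
  have p1 : 0 ≤ ε * G * I := by positivity
  have p2 : 0 ≤ G * S := by positivity
  have q1 := mul_nonneg hC1' p1
  have q2 := mul_nonneg hC1' hO
  have q3 : 0 ≤ 2 * K ^ 2 * (2 * (1 + 2 * K) * (ε * G * I) + 2 * (1 + 2 * K) * O + |CE| * (G * S)
    + |CE| * O + G * S + ε * G * I) := by positivity
  linarith

end Jet

/-! ### Arithmetic of the absorption -/

/-- One level: `A` is the multiplier integral, `M` the full integral, `Tr` the trace gained, `b` the
trace spent by Hardy, `Mp` the sum of the lower levels. Insertion of the Hardy bound `h2` into `h1`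
leaves `D η M` on the right, at most `M / 2`, which is moved to the left. -/
theorem absorb {A M Tr b C c₁ c₂ D Y η O I Mp : ℝ} (hC : 0 ≤ C) (hc₁ : 0 ≤ c₁) (hc₂ : 0 ≤ c₂)
    (hD : (c₁ + 1) * C + c₂ ≤ D) (hη : D * η ≤ 1 / 2) (hη0 : 0 ≤ η) (hA : 0 ≤ A) (hTr : 0 ≤ Tr)
    (hb : 0 ≤ b) (hY : 0 ≤ Y) (hO : 0 ≤ O) (hM : 0 ≤ M) (hMp : 0 ≤ Mp) (hI : I ≤ Mp + M)
    (h1 : A + Tr ≤ C * (Y + η * I + O)) (h2 : M ≤ c₁ * A + c₂ * b) :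
    M + Tr ≤ 2 * D * (Y + O + b) + Mp := by
  have h3 : A + Tr ≤ C * (Y + η * (Mp + M) + O) := h1.trans (by gcongr)
  have h4 : (c₁ + 1) * (A + Tr) ≤ (c₁ + 1) * (C * (Y + η * (Mp + M) + O)) := by gcongr
  have h5 : M + Tr ≤ (c₁ + 1) * (A + Tr) + c₂ * b := by nlinarith [mul_nonneg hc₁ hTr]
  have h6 : 0 ≤ Y + η * (Mp + M) + O + b := by positivity
  have h7 := mul_le_mul_of_nonneg_right hD h6
  have h8 : 0 ≤ (c₁ + 1) * C := by positivity
  have h9 := mul_nonneg h8 hb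
  have h10 : 0 ≤ c₂ * (Y + η * (Mp + M) + O) := by positivity
  have h11 : D * η * (Mp + M) ≤ 1 / 2 * (Mp + M) := by gcongr
  nlinarith

/-- Here `t` is the trace spent by Hardy at the current level. It and the lower integral `Mp` have
already been bounded by the data through `hP`. -/
theorem absorb_step {D Y O b t Mp M Tr P : ℝ} (hD : 0 ≤ D) (hb : 0 ≤ b) (hMp : 0 ≤ Mp)
    (ht : 0 ≤ t) (h : M + Tr ≤ 2 * D * (Y + O + t) + Mp) (hP : Mp + t ≤ P * (Y + b + O)) :
    M + Tr ≤ (2 * D + (2 * D + 1) * P) * (Y + b + O) := by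
  have h1 : (2 * D + 1) * (Mp + t) ≤ (2 * D + 1) * (P * (Y + b + O)) := by gcongr
  nlinarith [mul_nonneg hD hb, mul_nonneg hD hMp]

/-- Successive absorption of the perturbative terms. -/
theorem absorb_three {B0 B1 B2 c₁ c₂ D η Y O b A0 A1 A2 M0 M1 M2 Tr0 Tr1 Tr2 t0 t1 : ℝ}
    (hB0 : 0 ≤ B0) (hB1 : 0 ≤ B1) (hB2 : 0 ≤ B2) (hc₁ : 0 ≤ c₁) (hc₂ : 0 ≤ c₂)
    (hD : D = (c₁ + 1) * (B0 + B1 + B2) + c₂) (hηD : D * η ≤ 1 / 2) (hη0 : 0 ≤ η)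
    (hY : 0 ≤ Y) (hO : 0 ≤ O) (hb : 0 ≤ b) (hA0 : 0 ≤ A0) (hA1 : 0 ≤ A1) (hA2 : 0 ≤ A2)
    (hM0 : 0 ≤ M0) (hM1 : 0 ≤ M1) (hM2 : 0 ≤ M2)
    (hTr0 : 0 ≤ Tr0) (hTr1 : 0 ≤ Tr1) (hTr2 : 0 ≤ Tr2) (ht0 : t0 ≤ Tr0) (ht1 : t1 ≤ Tr1)
    (w0 : A0 + Tr0 ≤ B0 * (Y + η * M0 + O)) (w1 : A1 + Tr1 ≤ B1 * (Y + η * (M0 + M1) + O))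
    (w2 : A2 + Tr2 ≤ B2 * (Y + η * (M0 + M1 + M2) + O)) (k0 : M0 ≤ c₁ * A0 + c₂ * b)
    (k1 : M1 ≤ c₁ * A1 + c₂ * t0) (k2 : M2 ≤ c₁ * A2 + c₂ * t1) :
    M0 + M1 + M2 + (Tr0 + Tr1 + Tr2)
      ≤ (2 * D + (2 * D + (2 * D + 1) * (2 * D)) + (2 * D + (2 * D + 1)
        * (2 * D + (2 * D + 1) * (2 * D) + 2 * D))) * (Y + b + O) := by
  have hc : 0 ≤ c₁ + 1 := by positivity
  have hD' : 0 ≤ D := by rw [hD]; positivity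
  have d0 : (c₁ + 1) * B0 + c₂ ≤ D := by rw [hD]; nlinarith [mul_nonneg hc hB1, mul_nonneg hc hB2]
  have d1 : (c₁ + 1) * B1 + c₂ ≤ D := by rw [hD]; nlinarith [mul_nonneg hc hB0, mul_nonneg hc hB2]
  have d2 : (c₁ + 1) * B2 + c₂ ≤ D := by rw [hD]; nlinarith [mul_nonneg hc hB1, mul_nonneg hc hB0]
  have r0 : M0 + Tr0 ≤ 2 * D * (Y + O + b) + 0 :=
    absorb hB0 hc₁ hc₂ d0 hηD hη0 hA0 hTr0 hb hY hO hM0 le_rfl (by linarith) w0 k0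
  -- The trace needed by Hardy at this level is dominated by the trace gained at the previous one,
  -- so no new boundary term appears.
  have r1 : M1 + Tr1 ≤ 2 * D * (Y + O + Tr0) + M0 :=
    absorb hB1 hc₁ hc₂ d1 hηD hη0 hA1 hTr1 hTr0 hY hO hM1 hM0 le_rfl w1
      (k1.trans (by gcongr))
  have r2 : M2 + Tr2 ≤ 2 * D * (Y + O + Tr1) + (M0 + M1) :=
    absorb hB2 hc₁ hc₂ d2 hηD hη0 hA2 hTr2 hTr1 hY hO hM2 (add_nonneg hM0 hM1) le_rfl w2
      (k2.trans (by gcongr))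
  have z0 : M0 + Tr0 ≤ 2 * D * (Y + b + O) := r0.trans_eq (by ring)
  have z1 := absorb_step (P := 2 * D) hD' hb hM0 hTr0 r1 (by linarith)
  have z2 := absorb_step (P := 2 * D + (2 * D + 1) * (2 * D) + 2 * D) hD' hb
    (add_nonneg hM0 hM1) hTr1 r2 (by linarith)
  linarith

/-! ### The three levels combined -/

namespace Jet

variable {J : Jet} {K ε : ℝ}

/-- The full densities of `φ`, `∂_t φ`, `∂_t² φ`. -/
def D₀ (J : Jet) : ℝ → ℝ → ℝ := J.fullDensity J.φ J.φt J.φx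

def D₁ (J : Jet) : ℝ → ℝ → ℝ := J.fullDensity J.φt J.φtt J.φtx

def D₂ (J : Jet) : ℝ → ℝ → ℝ := J.fullDensity J.φtt J.φttt J.φttx

/-- The multiplier densities of `φ`, `∂_t φ`, `∂_t² φ`. -/
def E₀ (J : Jet) : ℝ → ℝ → ℝ := J.mulDensity J.φ J.φt J.φx

def E₁ (J : Jet) : ℝ → ℝ → ℝ := J.mulDensity J.φt J.φtt J.φtx

def E₂ (J : Jet) : ℝ → ℝ → ℝ := J.mulDensity J.φtt J.φttt J.φttx

variable (J)

theorem continuous_D₀ : Continuous fun z : ℝ × ℝ => J.D₀ z.1 z.2 :=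
  continuous_fullDensity J.cont_φ J.cont_φt J.cont_φx

theorem continuous_D₁ : Continuous fun z : ℝ × ℝ => J.D₁ z.1 z.2 :=
  continuous_fullDensity J.cont_φt J.cont_φtt J.cont_φtx

theorem continuous_D₂ : Continuous fun z : ℝ × ℝ => J.D₂ z.1 z.2 :=
  continuous_fullDensity J.cont_φtt J.cont_φttt J.cont_φttx

theorem continuous_E₀ : Continuous fun z : ℝ × ℝ => J.E₀ z.1 z.2 :=
  continuous_mulDensity J.cont_φ J.cont_φt J.cont_φx

theorem continuous_E₁ : Continuous fun z : ℝ × ℝ => J.E₁ z.1 z.2 :=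
  continuous_mulDensity J.cont_φt J.cont_φtt J.cont_φtx

theorem continuous_E₂ : Continuous fun z : ℝ × ℝ => J.E₂ z.1 z.2 :=
  continuous_mulDensity J.cont_φtt J.cont_φttt J.cont_φttx

/-- The total flux through `{x = X}`. -/
def totalFlux (X T' : ℝ) : ℝ :=
  ∫ t in (0 : ℝ)..T', 1 / 2 * J.weight X * J.r X t ^ 2 * (J.E₀ X t + J.E₁ X t + J.E₂ X t)

/-- The quantity that is estimated, on `[0, X] × [0, T']`. -/
def kssInt (X T' : ℝ) : ℝ :=
  iint X T' (fun x t => (wt x)⁻¹ * (J.D₀ x t + J.D₁ x t + J.D₂ x t))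
    + ∫ t in (0 : ℝ)..T', (J.E₀ 0 t + J.E₁ 0 t + J.E₂ 0 t)

variable {J}

theorem iint_fullDensity_le (hb : J.EnergyBound K ε) {v vt vx : ℝ → ℝ → ℝ}
    (cv : Continuous fun z : ℝ × ℝ => v z.1 z.2) (cvt : Continuous fun z : ℝ × ℝ => vt z.1 z.2)
    (cvx : Continuous fun z : ℝ × ℝ => vx z.1 z.2) (xv : HasDx J.T v vx) {X T' : ℝ} (hX : 0 ≤ X)
    (hT' : 0 ≤ T') (hTT : T' ≤ J.T) :
    iint X T' (fun x t => (wt x)⁻¹ * J.fullDensity v vt vx x t)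
      ≤ (1 + 2 * K + 4 * K ^ 2 * (8 * K + K ^ 3))
          * iint X T' (fun x t => (wt x)⁻¹ * J.mulDensity v vt vx x t)
        + 2 * (8 * K + K ^ 3) * ∫ t in (0 : ℝ)..T', v 0 t ^ 2 := by
  have cm := continuous_mulDensity (J := J) cv cvt cvx
  have cf := continuous_fullDensity (J := J) cv cvt cvx
  have lv := continuous_snd_slice cv 0
  have c1 : Continuous fun z : ℝ × ℝ => (wt z.1)⁻¹ * J.fullDensity v vt vx z.1 z.2 := by
    fun_prop (disch := intro z; exact wt_ne _)
  have c2 : Continuous fun z : ℝ × ℝ => (wt z.1)⁻¹ * J.mulDensity v vt vx z.1 z.2 := by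
    fun_prop (disch := intro z; exact wt_ne _)
  have c3 := continuous_integral (f := fun x t => (wt x)⁻¹ * J.fullDensity v vt vx x t) c1 0 X
  have c4 := continuous_integral (f := fun x t => (wt x)⁻¹ * J.mulDensity v vt vx x t) c2 0 X
  unfold iint
  rw [← intervalIntegral.integral_const_mul, ← intervalIntegral.integral_const_mul,
    ← intervalIntegral.integral_add (Continuous.intervalIntegrable (by fun_prop) _ _)
      (Continuous.intervalIntegrable (by fun_prop) _ _)]
  exact integral_mono_of_le c3 (by fun_prop) hT' fun t ht =>
    hb.integral_fullDensity_le cv cvt cvx ⟨ht.1, ht.2.trans hTT⟩ xv hX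

theorem vt_sq_le_mulDensity (v vt vx : ℝ → ℝ → ℝ) (x t : ℝ) :
    vt x t ^ 2 ≤ J.mulDensity v vt vx x t := by
  have := J.s_pos x t
  have : 0 ≤ J.s x t * J.radial v vx x t ^ 2 := by positivity
  unfold mulDensity; linarith

/-- The estimate on a truncated region with the outer flux still present. The condition on `ε *
J.weightSup` is what remains of the restriction on the length of the time interval. -/
theorem exists_kssInt_le (K : ℝ) : ∃ C δ, 0 ≤ C ∧ 0 < δ ∧ ∀ (J : Jet) (ε : ℝ), J.Bound K ε →
    ε * J.weightSup ≤ δ → ∀ X T', 0 ≤ X → 0 ≤ T' → T' < J.T → ∀ S,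
    (∀ t ∈ Icc 0 J.T, ∫ x in (0 : ℝ)..X, J.D₀ x t ≤ S) →
    (∀ t ∈ Icc 0 J.T, ∫ x in (0 : ℝ)..X, J.D₁ x t ≤ S) →
    (∀ t ∈ Icc 0 J.T, ∫ x in (0 : ℝ)..X, J.D₂ x t ≤ S) →
    J.kssInt X T' ≤ C * (J.weightSup * S + (∫ t in (0 : ℝ)..T', J.φ 0 t ^ 2)
      + J.totalFlux X T') := by
  by_cases hK : 0 ≤ K
  swap
  · exact ⟨0, 1, le_rfl, one_pos, fun J ε hb => absurd hb.K_nonneg hK⟩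
  obtain ⟨CF1, hF1⟩ := exists_abs_F₁_le K
  obtain ⟨CF2, hF2⟩ := exists_abs_F₂_le K
  -- The source constant is `0` at the lowest level, since `φ` solves the homogeneous equation.
  obtain ⟨B0, hB0, h0⟩ := exists_weighted_le K 0
  obtain ⟨B1, hB1, h1⟩ := exists_weighted_le K CF1
  obtain ⟨B2, hB2, h2⟩ := exists_weighted_le K CF2
  obtain ⟨c₁, hc₁⟩ : ∃ c, c = 1 + 2 * K + 4 * K ^ 2 * (8 * K + K ^ 3) := ⟨_, rfl⟩
  obtain ⟨c₂, hc₂⟩ : ∃ c, c = 2 * (8 * K + K ^ 3) := ⟨_, rfl⟩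
  have hc₁' : 0 ≤ c₁ := by rw [hc₁]; positivity
  have hc₂' : 0 ≤ c₂ := by rw [hc₂]; positivity
  obtain ⟨D, hD⟩ : ∃ D, D = (c₁ + 1) * (B0 + B1 + B2) + c₂ := ⟨_, rfl⟩
  have hD' : 0 ≤ D := by rw [hD]; positivity
  -- The first witness is the constant of `absorb_three`; the second makes `D ε G ≤ 1/2`, with `G`
  -- the supremum of the weight.
  refine ⟨2 * D + (2 * D + (2 * D + 1) * (2 * D)) + (2 * D + (2 * D + 1)
    * (2 * D + (2 * D + 1) * (2 * D) + 2 * D)), 1 / (2 * (D + 1)), by positivity, by positivity, ?_⟩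
  intro J ε hb hδ X T' hX hT' hTT S hS0 hS1 hS2
  have hε := hb.ε_pos
  have hG1 := J.one_le_weightSup
  have hτ0 := J.one_add_T_pos
  have cg : Continuous J.weight := continuous_logWeight hτ0
  have cg' : Continuous J.weight' := continuous_logWeight' hτ0
  have g1 : ∀ x, 1 ≤ J.weight x := one_le_logWeight hτ0
  have hgd : ∀ x, 0 < x → HasDerivAt J.weight (J.weight' x) x := fun x hx =>
    hasDerivAt_logWeight hτ0 hx
  have d0 : ∀ x t, 0 ≤ J.D₀ x t := fun x t => fullDensity_nonneg _ _ _
  have d1 : ∀ x t, 0 ≤ J.D₁ x t := fun x t => fullDensity_nonneg _ _ _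
  have d2 : ∀ x t, 0 ≤ J.D₂ x t := fun x t => fullDensity_nonneg _ _ _
  have e0 : ∀ x t, 0 ≤ J.E₀ x t := fun x t => mulDensity_nonneg x t
  have e1 : ∀ x t, 0 ≤ J.E₁ x t := fun x t => mulDensity_nonneg x t
  have e2 : ∀ x t, 0 ≤ J.E₂ x t := fun x t => mulDensity_nonneg x t
  have cd0 := J.continuous_D₀
  have cd1 := J.continuous_D₁
  have cd2 := J.continuous_D₂
  have ce0 := J.continuous_E₀
  have ce1 := J.continuous_E₁
  have ce2 := J.continuous_E₂
  have cw : ∀ {f : ℝ → ℝ → ℝ}, (Continuous fun z : ℝ × ℝ => f z.1 z.2) →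
      Continuous fun z : ℝ × ℝ => (wt z.1)⁻¹ * f z.1 z.2 := fun hf => by
    fun_prop (disch := intro z; exact wt_ne _)
  have hη0 : 0 ≤ ε * J.weightSup := by positivity
  have hηD : D * (ε * J.weightSup) ≤ 1 / 2 := by
    have h3 : (D + 1) * (ε * J.weightSup) ≤ (D + 1) * (1 / (2 * (D + 1))) := by gcongr
    have h4 : (D + 1) * (1 / (2 * (D + 1))) = 1 / 2 := by field_simp
    linarith
  have hS : 0 ≤ S := (intervalIntegral.integral_nonneg hX fun x _ => d0 x 0).trans
    (hS0 0 ⟨le_rfl, J.T_pos.le⟩)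
  have hY : 0 ≤ J.weightSup * S := by positivity
  have nn : ∀ {f : ℝ → ℝ → ℝ}, (∀ x t, 0 ≤ f x t) → 0 ≤ iint X T' fun x t => (wt x)⁻¹ * f x t :=
    fun hf => iint_nonneg hX hT' fun x _ t _ => mul_nonneg (inv_pos.2 (wt_pos x)).le (hf x t)
  have nt : ∀ {f : ℝ → ℝ → ℝ}, (∀ x t, 0 ≤ f x t) → 0 ≤ ∫ t in (0 : ℝ)..T', f 0 t :=
    fun hf => intervalIntegral.integral_nonneg hT' fun t _ => hf 0 t
  have hOle : ∀ v vt vx : ℝ → ℝ → ℝ, (Continuous fun z : ℝ × ℝ => J.mulDensity v vt vx z.1 z.2) →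
      (∀ t, J.mulDensity v vt vx X t ≤ J.E₀ X t + J.E₁ X t + J.E₂ X t) →
      J.outerFlux X T' v vt vx ≤ J.totalFlux X T' := fun v vt vx cm hle => by
    have l0 := continuous_snd_slice ce0 X
    have l1 := continuous_snd_slice ce1 X
    have l2 := continuous_snd_slice ce2 X
    have l3 := continuous_snd_slice cm X
    refine integral_mono_of_le (by fun_prop) (by fun_prop) hT' fun t _ => ?_
    have := zero_le_one.trans (g1 X)
    exact mul_le_mul_of_nonneg_left (hle t) (by positivity)
  have hO' : 0 ≤ J.totalFlux X T' := intervalIntegral.integral_nonneg hT' fun t _ => by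
    have := zero_le_one.trans (g1 X)
    have := e0 X t
    have := e1 X t
    have := e2 X t
    positivity
  have w0 :=  h0 J ε hb J.φ J.φt J.φx 0 J.D₀ J.cont_φ J.cont_φt J.cont_φx continuous_const cd0
    X T' hX hT' hTT.le (J.multiplierIdentity_φ cg cg' hgd hX hT' hTT.le)
    (fun x _ t _ => le_rfl) (fun x _ t _ => by simp) S hS0
  have w1 := h1 J ε hb J.φt J.φtt J.φtx J.F₁ (fun x t => J.D₀ x t + J.D₁ x t) J.cont_φt J.cont_φtt
    J.cont_φtx J.continuous_F₁ (by fun_prop)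
    X T' hX hT' hTT.le (J.multiplierIdentity_φt cg cg' hgd hX hT' hTT.le)
    (fun x _ t _ => le_add_of_nonneg_left (d0 x t))
    (fun x hx t ht => hF1 J ε hb x t hx ht _ (le_add_of_nonneg_right (d1 x t))
      (le_add_of_nonneg_left (d0 x t))) S hS1
  have cF2 : Continuous fun z : ℝ × ℝ => J.F₂ z.1 z.2 := by
    have := J.continuous_F₁
    unfold F₂ αt βt α β
    fun_prop (disch := intro z; first
      | exact J.r_ne _ _ | exact J.one_add_q_ne _ _ | exact pow_ne_zero _ (J.r_ne _ _)
      | exact pow_ne_zero _ (J.one_add_q_ne _ _))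
  have w2 := h2 J ε hb J.φtt J.φttt J.φttx J.F₂ (fun x t => J.D₀ x t + J.D₁ x t + J.D₂ x t)
    J.cont_φtt J.cont_φttt J.cont_φttx cF2 (by fun_prop)
    X T' hX hT' hTT.le (J.multiplierIdentity_φtt cg cg' hgd hX hT' hTT)
    (fun x _ t _ => le_add_of_nonneg_left (add_nonneg (d0 x t) (d1 x t)))
    (fun x hx t ht => hF2 J ε hb x t hx ht _
      (by change J.D₀ x t ≤ _; linarith [d1 x t, d2 x t])
      (by change J.D₁ x t ≤ _; linarith [d0 x t, d2 x t])
      (by change J.D₂ x t ≤ _; linarith [d0 x t, d1 x t])) S hS2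
  have k0 : iint X T' (fun x t => (wt x)⁻¹ * J.D₀ x t)
      ≤ c₁ * iint X T' (fun x t => (wt x)⁻¹ * J.E₀ x t)
        + c₂ * ∫ t in (0 : ℝ)..T', J.φ 0 t ^ 2 := by
    rw [hc₁, hc₂]
    exact iint_fullDensity_le hb.toEnergyBound J.cont_φ J.cont_φt J.cont_φx J.hasDx_φ hX hT' hTT.le
  have k1 : iint X T' (fun x t => (wt x)⁻¹ * J.D₁ x t)
      ≤ c₁ * iint X T' (fun x t => (wt x)⁻¹ * J.E₁ x t)
        + c₂ * ∫ t in (0 : ℝ)..T', J.φt 0 t ^ 2 := by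
    rw [hc₁, hc₂]
    exact iint_fullDensity_le hb.toEnergyBound J.cont_φt J.cont_φtt J.cont_φtx J.hasDx_φt hX
      hT' hTT.le
  have k2 : iint X T' (fun x t => (wt x)⁻¹ * J.D₂ x t)
      ≤ c₁ * iint X T' (fun x t => (wt x)⁻¹ * J.E₂ x t)
        + c₂ * ∫ t in (0 : ℝ)..T', J.φtt 0 t ^ 2 := by
    rw [hc₁, hc₂]
    exact iint_fullDensity_le hb.toEnergyBound J.cont_φtt J.cont_φttt J.cont_φttx J.hasDx_φtt hX
      hT' hTT.le
  have s1 : iint X T' (fun x t => (wt x)⁻¹ * (J.D₀ x t + J.D₁ x t))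
      = iint X T' (fun x t => (wt x)⁻¹ * J.D₀ x t)
        + iint X T' (fun x t => (wt x)⁻¹ * J.D₁ x t) := by
    simp only [mul_add]
    exact iint_add (cw cd0) (cw cd1)
  have s2 : iint X T' (fun x t => (wt x)⁻¹ * (J.D₀ x t + J.D₁ x t + J.D₂ x t))
      = iint X T' (fun x t => (wt x)⁻¹ * J.D₀ x t)
        + iint X T' (fun x t => (wt x)⁻¹ * J.D₁ x t)
        + iint X T' (fun x t => (wt x)⁻¹ * J.D₂ x t) := by
    rw [← s1]
    simp only [mul_add _ _ (J.D₂ _ _)]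
    exact iint_add (f := fun x t => (wt x)⁻¹ * (J.D₀ x t + J.D₁ x t))
      (cw (f := fun x t => J.D₀ x t + J.D₁ x t) (by fun_prop)) (cw cd2)
  -- The trace of `φ_t`, which Hardy needs at the next level, is part of the trace of the multiplier
  -- density of `φ`.
  have t1 : ∫ t in (0 : ℝ)..T', J.φt 0 t ^ 2 ≤ (∫ t in (0 : ℝ)..T', J.E₀ 0 t) :=
    integral_mono_of_le (by fun_prop) (continuous_snd_slice ce0 0) hT' fun t _ =>
      vt_sq_le_mulDensity _ _ _ _ _
  have t2 : ∫ t in (0 : ℝ)..T', J.φtt 0 t ^ 2 ≤ (∫ t in (0 : ℝ)..T', J.E₁ 0 t) :=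
    integral_mono_of_le (by fun_prop) (continuous_snd_slice ce1 0) hT' fun t _ =>
      vt_sq_le_mulDensity _ _ _ _ _
  have w0' : iint X T' (fun x t => (wt x)⁻¹ * J.E₀ x t) + (∫ t in (0 : ℝ)..T', J.E₀ 0 t)
      ≤ B0 * (J.weightSup * S + ε * J.weightSup * iint X T' (fun x t => (wt x)⁻¹ * J.D₀ x t)
        + J.totalFlux X T') := by
    have hO := hOle J.φ J.φt J.φx ce0 fun t => by
      change J.E₀ X t ≤ _
      linarith [e1 X t, e2 X t]
    exact w0.trans (mul_le_mul_of_nonneg_left (by linarith) hB0)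
  have w1' : iint X T' (fun x t => (wt x)⁻¹ * J.E₁ x t) + (∫ t in (0 : ℝ)..T', J.E₁ 0 t)
      ≤ B1 * (J.weightSup * S + ε * J.weightSup * (iint X T' (fun x t => (wt x)⁻¹ * J.D₀ x t)
        + iint X T' (fun x t => (wt x)⁻¹ * J.D₁ x t))
        + J.totalFlux X T') := by
    have hO := hOle J.φt J.φtt J.φtx ce1 fun t => by
      change J.E₁ X t ≤ _
      linarith [e0 X t, e2 X t]
    rw [s1] at w1
    exact w1.trans (mul_le_mul_of_nonneg_left (by linarith) hB1)
  have w2' : iint X T' (fun x t => (wt x)⁻¹ * J.E₂ x t) + (∫ t in (0 : ℝ)..T', J.E₂ 0 t)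
      ≤ B2 * (J.weightSup * S + ε * J.weightSup * (iint X T' (fun x t => (wt x)⁻¹ * J.D₀ x t)
        + iint X T' (fun x t => (wt x)⁻¹ * J.D₁ x t)
        + iint X T' (fun x t => (wt x)⁻¹ * J.D₂ x t))
        + J.totalFlux X T') := by
    have hO := hOle J.φtt J.φttt J.φttx ce2 fun t => by
      change J.E₂ X t ≤ _
      linarith [e0 X t, e1 X t]
    rw [s2] at w2
    exact w2.trans (mul_le_mul_of_nonneg_left (by linarith) hB2)
  have hsum : J.kssInt X T'
      = iint X T' (fun x t => (wt x)⁻¹ * J.D₀ x t)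
        + iint X T' (fun x t => (wt x)⁻¹ * J.D₁ x t)
        + iint X T' (fun x t => (wt x)⁻¹ * J.D₂ x t)
        + ((∫ t in (0 : ℝ)..T', J.E₀ 0 t) + (∫ t in (0 : ℝ)..T', J.E₁ 0 t)
          + (∫ t in (0 : ℝ)..T', J.E₂ 0 t)) := by
    unfold kssInt
    have l0 := continuous_snd_slice ce0 0
    have l1 := continuous_snd_slice ce1 0
    have l2 := continuous_snd_slice ce2 0
    rw [s2, intervalIntegral.integral_add (Continuous.intervalIntegrable (by fun_prop) _ _)
      (l2.intervalIntegrable _ _), intervalIntegral.integral_add (l0.intervalIntegrable _ _)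
      (l1.intervalIntegrable _ _)]
  rw [hsum]
  exact absorb_three hB0 hB1 hB2 hc₁' hc₂' hD hηD hη0 hY hO'
    (intervalIntegral.integral_nonneg hT' fun t _ => sq_nonneg _) (nn e0) (nn e1) (nn e2)
    (nn d0) (nn d1) (nn d2) (nt e0) (nt e1) (nt e2) t1 t2 w0' w1' w2' k0 k1 k2

end Jet

namespace Jet

/-! ### Bernoulli's law -/

/-- The enthalpy as a function of `q`, normalized to vanish at `q = 0`. -/
def enthalpy (J : Jet) (p : ℝ) : ℝ := J.κ / (1 - J.γ) * ((1 + p)⁻¹ ^ (J.γ - 1) - 1)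

variable {J : Jet} {K ε : ℝ}

theorem hasDerivAt_enthalpy (J : Jet) {p : ℝ} (hp : 0 < 1 + p) :
    HasDerivAt J.enthalpy (J.κ * (1 + p)⁻¹ ^ (J.γ + 1) * (1 + p)) p := by
  have hγ : 1 - J.γ ≠ 0 := by have := J.one_lt_γ; linarith
  have h := (((((hasDerivAt_id p).const_add 1).fun_inv hp.ne').rpow_const (p := J.γ - 1)
    (Or.inl (inv_ne_zero hp.ne'))).sub_const 1).const_mul (J.κ / (1 - J.γ))
  refine h.congr_deriv ?_
  have hi : 0 < (1 + p)⁻¹ := inv_pos.2 hp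
  simp only [id]
  have e : (1 + p)⁻¹ ^ (J.γ + 1) = (1 + p)⁻¹ ^ (J.γ - 1 - 1) * (1 + p)⁻¹ ^ 3 := by
    rw [← Real.rpow_natCast, ← Real.rpow_add hi]
    congr 1
    push_cast
    ring
  rw [e]
  field_simp
  ring

theorem enthalpy_zero (J : Jet) : J.enthalpy 0 = 0 := by simp [enthalpy]

/-- `EnergyBound` has no field for `κ`; a bound follows from that on the squared sound speed at a
single point, because `q ≤ 1/2` there. -/
theorem EnergyBound.κ_le (hb : J.EnergyBound K ε) : J.κ ≤ K * 2 ^ K := by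
  have h0 : (0 : ℝ) ∈ Icc 0 J.T := ⟨le_rfl, J.T_pos.le⟩
  have h := hb.s_le 0 le_rfl 0 h0
  have hq := J.q_mem 0 0
  have hq0 := J.one_add_q_pos 0 0
  have hγ := J.one_lt_γ
  have h1 : (1 / 2 : ℝ) ^ K ≤ (1 + J.q 0 0)⁻¹ ^ (J.γ + 1) := by
    calc (1 / 2 : ℝ) ^ K ≤ (1 / 2) ^ (J.γ + 1) :=
          Real.rpow_le_rpow_of_exponent_ge (by norm_num) (by norm_num) hb.γ_le
      _ ≤ _ := by
          refine Real.rpow_le_rpow (by norm_num) ?_ (by linarith)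
          rw [one_div]
          exact inv_anti₀ hq0 (by linarith [hq.2])
  have h2 := (mul_le_mul_of_nonneg_left h1 J.κ_pos.le).trans h
  rw [one_div, Real.inv_rpow (by norm_num), ← div_eq_mul_inv, div_le_iff₀ (by positivity)] at h2
  exact h2

theorem EnergyBound.abs_enthalpy_le (hb : J.EnergyBound K ε) (x t : ℝ) :
    |J.enthalpy (J.q x t)| ≤ K * 2 ^ K * 2 ^ K * 2 * |J.q x t| := by
  have hγ := J.one_lt_γ
  have hK := hb.K_nonneg
  have h := Convex.norm_image_sub_le_of_norm_hasDerivWithin_le (f := J.enthalpy)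
    (f' := fun p => J.κ * (1 + p)⁻¹ ^ (J.γ + 1) * (1 + p)) (s := Icc (-1 / 2 : ℝ) (1 / 2))
    (C := K * 2 ^ K * 2 ^ K * 2) (x := 0) (y := J.q x t)
    (fun p hp => (J.hasDerivAt_enthalpy (by linarith [hp.1])).hasDerivWithinAt)
    (fun p hp => by
      have hp1 : 0 < 1 + p := by linarith [hp.1]
      have h1 := J.κ_pos
      rw [Real.norm_of_nonneg (by positivity)]
      have h2 : (1 + p)⁻¹ ^ (J.γ + 1) ≤ 2 ^ K := by
        calc (1 + p)⁻¹ ^ (J.γ + 1) ≤ 2 ^ (J.γ + 1) := by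
              refine Real.rpow_le_rpow (by positivity) ?_ (by linarith)
              rw [inv_le_comm₀ hp1 (by norm_num)]
              linarith [hp.1]
          _ ≤ 2 ^ K := Real.rpow_le_rpow_of_exponent_le (by norm_num) hb.γ_le
      have h3 := hb.κ_le
      have h4 : 1 + p ≤ 2 := by linarith [hp.2]
      gcongr)
    (convex_Icc _ _) ⟨by norm_num, by norm_num⟩ (J.q_mem x t)
  rwa [enthalpy_zero, sub_zero, sub_zero, Real.norm_eq_abs, Real.norm_eq_abs] at h

theorem continuous_enthalpy (J : Jet) : Continuous fun z : ℝ × ℝ => J.enthalpy (J.q z.1 z.2) := by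
  unfold enthalpy
  have h : Continuous fun z : ℝ × ℝ => (1 + J.q z.1 z.2)⁻¹ ^ (J.γ - 1) :=
    Continuous.rpow_const (by fun_prop (disch := intro z; exact J.one_add_q_ne _ _))
      fun z => Or.inr (by have := J.one_lt_γ; linarith)
  fun_prop

/-- Bernoulli's law: `∂_t φ = u² / 2 + h(q)` for a potential that vanishes at infinity. -/
theorem bernoulli (hb : J.PointBound K ε) (he : J.EnergyBound K ε)
    (hφ : ∀ t ∈ Icc 0 J.T, Tendsto (fun x => J.φ x t) atTop (𝓝 0)) {x t : ℝ} (hx : 0 ≤ x)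
    (ht : t ∈ Icc 0 J.T) : J.φt x t = 1 / 2 * J.u x t ^ 2 + J.enthalpy (J.q x t) := by
  have cH := J.continuous_enthalpy
  have hT := J.T_pos
  -- The Bernoulli defect. It is constant in `x` by the momentum equation and constant in `t` by
  -- `φtt_eq`.
  obtain ⟨N, hN⟩ : ∃ N : ℝ → ℝ → ℝ, N = fun x t => J.φt x t - 1 / 2 * J.u x t ^ 2
    - J.enthalpy (J.q x t) := ⟨_, rfl⟩
  have cN : Continuous fun z : ℝ × ℝ => N z.1 z.2 := by
    rw [hN]
    fun_prop
  have dX : ∀ t ∈ Icc 0 J.T, ∀ x, 0 < x → HasDerivAt (fun y => N y t) 0 x := fun t ht x hx => by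
    rw [hN]
    have hr := J.r_ne x t
    refine (((J.hasDx_φt x hx t ht).fun_sub (((J.hasDx_u x hx t ht).fun_pow 2).const_mul _)).fun_sub
      ((J.hasDerivAt_enthalpy (J.one_add_q_pos x t)).comp x (J.hasDx_q x hx t ht))).congr_deriv ?_
    have h1 := J.r_sq_mul_φtx hx.le ht
    rw [J.velocity, J.momentum', J.continuity] at h1
    change _ - J.s x t * (1 + J.q x t) * J.qx x t = 0
    push_cast
    refine mul_left_cancel₀ (pow_ne_zero 3 hr) ?_
    field_simp at h1
    linear_combination h1
  have dT : ∀ x, 0 ≤ x → ∀ t ∈ Ioo 0 J.T, HasDerivAt (fun s => N x s) 0 t := fun x hx t ht => by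
    rw [hN]
    refine (((J.hasDt_φt x hx t ht).fun_sub (((J.hasDt_u x hx t ht).fun_pow 2).const_mul _)).fun_sub
      ((J.hasDerivAt_enthalpy (J.one_add_q_pos x t)).comp t (J.hasDt_q x hx t ht))).congr_deriv ?_
    have h1 := J.φtt_eq hx (Ioo_subset_Icc_self ht)
    change _ - J.s x t * (1 + J.q x t) * J.qt x t = 0
    push_cast
    linear_combination h1
  have eX : ∀ t ∈ Icc 0 J.T, ∀ x, 0 ≤ x → N x t = N 0 t := fun t ht x hx => by
    have h := integral_eq_sub_of_pos (continuous_fst_slice cN t) continuous_const (dX t ht)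
      le_rfl hx
    rw [intervalIntegral.integral_zero] at h
    linarith
  have eT : ∀ t ∈ Icc 0 J.T, N 0 t = N 0 0 := fun t ht => by
    have h := intervalIntegral.integral_eq_sub_of_hasDerivAt_of_le ht.1
      (continuous_snd_slice cN 0).continuousOn
      (fun s hs => dT 0 le_rfl s ⟨hs.1, hs.2.trans_le ht.2⟩)
      (continuous_const.intervalIntegrable _ _)
    rw [intervalIntegral.integral_zero] at h
    linarith
  have eN : ∀ x, 0 ≤ x → ∀ t ∈ Icc 0 J.T, J.φt x t = N 0 0 + (1 / 2 * J.u x t ^ 2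
      + J.enthalpy (J.q x t)) := fun x hx t ht => by
    have h := (eX t ht x hx).trans (eT t ht)
    rw [← h, hN]
    ring
  suffices h0 : N 0 0 = 0 by rw [eN x hx t ht, h0, zero_add]
  obtain ⟨C, hC⟩ : ∃ C, C = 1 / 2 * (K * K) + K * 2 ^ K * 2 ^ K * 2 * K := ⟨_, rfl⟩
  have hK := he.K_nonneg
  have hσ := he.σ_nonneg
  have hrem : ∀ x, 0 ≤ x → ∀ t ∈ Icc 0 J.T,
      |1 / 2 * J.u x t ^ 2 + J.enthalpy (J.q x t)| ≤ C * (ε / wt x) := fun x hx t ht => by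
    have h1 := hb.abs_u x hx t ht
    have h2 := h1.trans (mul_le_of_le_one_right hK (div_wt_le_one he x))
    have h3 := (he.abs_enthalpy_le x t).trans
      (mul_le_mul_of_nonneg_left (hb.abs_q x hx t ht) (by positivity))
    rw [← mul_assoc] at h3
    rw [hC, sq, ← mul_assoc, ← mul_assoc]
    refine bd_add (bd_mul_left ?_ h1) h3
    refine abs_mul_le_of_le ?_ h2
    norm_num
  -- Only `φ`, not `φ_t`, is assumed to vanish at infinity. Hence the constant is found by
  -- integrating over `[0, T]`: the increment of `φ` equals `T N` up to `O(ε/ξ)`, and it tends to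
  -- zero as `x → ∞`.
  have hint : ∀ x, 0 ≤ x → |J.φ x J.T - J.φ x 0 - J.T * N 0 0| ≤ J.T * (C * (ε / wt x)) :=
      fun x hx => by
    have lφ := continuous_snd_slice J.cont_φ x
    have lφt := continuous_snd_slice J.cont_φt x
    have h1 := intervalIntegral.integral_eq_sub_of_hasDerivAt_of_le hT.le lφ.continuousOn
      (fun s hs => J.hasDt_φ x hx s hs) (lφt.intervalIntegrable _ _)
    have h2 := integral_mono_of_le lφt (continuous_const (y := N 0 0 + C * (ε / wt x))) hT.le
      fun t ht => by
        rw [eN x hx t ht]; linarith [(abs_le.1 (hrem x hx t ht)).2]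
    have h3 := integral_mono_of_le (continuous_const (y := N 0 0 - C * (ε / wt x))) lφt hT.le
      fun t ht => by
        rw [eN x hx t ht]; linarith [(abs_le.1 (hrem x hx t ht)).1]
    rw [intervalIntegral.integral_const, smul_eq_mul, sub_zero] at h2 h3
    rw [abs_le]
    constructor <;> linarith
  have l1 : Tendsto (fun x => |J.φ x J.T - J.φ x 0 - J.T * N 0 0|) atTop
      (𝓝 |0 - 0 - J.T * N 0 0|) :=
    (((hφ J.T ⟨hT.le, le_rfl⟩).sub (hφ 0 ⟨le_rfl, hT.le⟩)).sub_const _).abs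
  have l2 : Tendsto (fun x => J.T * (C * (ε / wt x))) atTop (𝓝 (J.T * (C * 0))) :=
    ((tendsto_wt.const_div_atTop ε).const_mul C).const_mul J.T
  have h4 := le_of_tendsto_of_tendsto l1 l2 (by
    filter_upwards [eventually_ge_atTop 0] with x hx using hint x hx)
  rw [mul_zero, mul_zero, sub_zero, zero_sub, abs_neg, abs_mul] at h4
  have h5 : J.T * N 0 0 = 0 := by
    rw [← abs_eq_zero, abs_mul]
    exact le_antisymm h4 (by positivity)
  exact (mul_eq_zero.1 h5).resolve_left hT.ne'

end Jet

namespace Jet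

/-! ### The wave energy -/

/-- The density `(∂_t v)² + (c r² ∂_x v)²`. -/
def waveDensity (J : Jet) (vt vx : ℝ → ℝ → ℝ) (x t : ℝ) : ℝ :=
  vt x t ^ 2 + J.s x t * (J.r x t ^ 2 * vx x t) ^ 2

/-- A bound for the wave energies of `φ`, `∂_t φ`, `∂_t² φ`. -/
structure WaveBound (J : Jet) (S : ℝ) : Prop where
  left : ∀ t ∈ Icc 0 J.T, ∀ X, 0 ≤ X → ∫ x in (0 : ℝ)..X, J.waveDensity J.φt J.φx x t ≤ S
  mid : ∀ t ∈ Icc 0 J.T, ∀ X, 0 ≤ X → ∫ x in (0 : ℝ)..X, J.waveDensity J.φtt J.φtx x t ≤ S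
  right : ∀ t ∈ Icc 0 J.T, ∀ X, 0 ≤ X →
    ∫ x in (0 : ℝ)..X, J.waveDensity J.φttt J.φttx x t ≤ S

variable {J : Jet} {K ε : ℝ}

section

variable {v vt vx : ℝ → ℝ → ℝ}

theorem continuous_waveDensity (cvt : Continuous fun z : ℝ × ℝ => vt z.1 z.2)
    (cvx : Continuous fun z : ℝ × ℝ => vx z.1 z.2) :
    Continuous fun z : ℝ × ℝ => J.waveDensity vt vx z.1 z.2 := by
  unfold waveDensity
  fun_prop

theorem waveDensity_nonneg (x t : ℝ) : 0 ≤ J.waveDensity vt vx x t := by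
  have := J.s_pos x t
  unfold waveDensity
  positivity

theorem vt_sq_le_waveDensity (x t : ℝ) : vt x t ^ 2 ≤ J.waveDensity vt vx x t := by
  have := J.s_pos x t
  have : 0 ≤ J.s x t * (J.r x t ^ 2 * vx x t) ^ 2 := by positivity
  unfold waveDensity
  linarith

theorem EnergyBound.waveDensity_le (hb : J.EnergyBound K ε) {x t : ℝ} (hx : 0 ≤ x)
    (ht : t ∈ Icc 0 J.T) : J.waveDensity vt vx x t ≤ K * J.fullDensity v vt vx x t := by
  have h1 := hb.s_le x hx t ht
  have h2 := mul_le_mul_of_nonneg_right h1 (sq_nonneg (J.r x t ^ 2 * vx x t))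
  have h3 := mul_le_mul_of_nonneg_right hb.one_le (sq_nonneg (vt x t))
  have h4 := mul_nonneg hb.K_nonneg (sq_nonneg (v x t / wt x))
  unfold waveDensity fullDensity
  linarith

theorem EnergyBound.fullDensity_le (hb : J.EnergyBound K ε) {x t : ℝ} (hx : 0 ≤ x)
    (ht : t ∈ Icc 0 J.T) :
    J.fullDensity v vt vx x t ≤ K * J.waveDensity vt vx x t + (v x t / wt x) ^ 2 := by
  have h1 := hb.one_le_s x hx t ht
  have h2 := mul_le_mul_of_nonneg_right h1 (sq_nonneg (J.r x t ^ 2 * vx x t))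
  have h3 := mul_le_mul_of_nonneg_right hb.one_le (sq_nonneg (vt x t))
  unfold waveDensity fullDensity
  linarith

end

/-- The wave energies are controlled by the energy of the flow. -/
theorem exists_waveBound (K : ℝ) : ∃ C, ∀ (J : Jet) (ε : ℝ), J.Bound K ε →
    (∀ t ∈ Icc 0 J.T, Tendsto (fun x => J.φ x t) atTop (𝓝 0)) → J.WaveBound (C * ε ^ 2) := by
  have key : ∃ C, ∀ (J : Jet) (ε : ℝ), J.Bound K ε →
      (∀ t ∈ Icc 0 J.T, Tendsto (fun x => J.φ x t) atTop (𝓝 0)) → ∀ x t, 0 ≤ x → t ∈ Icc 0 J.T →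
      |J.φt x t| ≤ C * √(J.energyDensity x t) ∧ |J.φtt x t| ≤ C * √(J.energyDensity x t) ∧
      |J.φttt x t| ≤ C * √(J.energyDensity x t) ∧
      |J.r x t ^ 2 * J.φx x t| ≤ C * √(J.energyDensity x t) ∧
      |J.r x t ^ 2 * J.φtx x t| ≤ C * √(J.energyDensity x t) ∧
      |J.r x t ^ 2 * J.φttx x t| ≤ C * √(J.energyDensity x t) := by
    have h : ∃ C0 C1 C2 C3 C4 C5, ∀ (J : Jet) (ε : ℝ), J.Bound K ε →
        (∀ t ∈ Icc 0 J.T, Tendsto (fun x => J.φ x t) atTop (𝓝 0)) → ∀ x t, 0 ≤ x → t ∈ Icc 0 J.T →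
        |J.φt x t| ≤ C0 * √(J.energyDensity x t) ∧ |J.φtt x t| ≤ C1 * √(J.energyDensity x t) ∧
        |J.φttt x t| ≤ C2 * √(J.energyDensity x t) ∧
        |J.r x t ^ 2 * J.φx x t| ≤ C3 * √(J.energyDensity x t) ∧
        |J.r x t ^ 2 * J.φtx x t| ≤ C4 * √(J.energyDensity x t) ∧
        |J.r x t ^ 2 * J.φttx x t| ≤ C5 * √(J.energyDensity x t) := by
      -- Six constants, one per quantity, again fixed by unification at the end; they are then
      -- merged into a single one.
      apply Exists.intro; apply Exists.intro; apply Exists.intro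
      apply Exists.intro; apply Exists.intro; apply Exists.intro
      intro J ε hb hφ x t hx ht
      have hK := hb.K_nonneg
      have he := hb.toEnergyBound
      have hr := hb.one_le_mul_r hx ht
      have hr2 : 1 ≤ K ^ 2 * J.r x t ^ 2 := by rw [← mul_pow]; exact one_le_pow₀ hr
      have hrp := J.r_pos x t
      have hqq := J.abs_one_add_q_le x t
      have sq' : ∀ {a : ℝ}, a ^ 2 ≤ J.energyDensity x t → |a| ≤ 1 * √(J.energyDensity x t) :=
        fun ha => by rw [one_mul]; exact Real.abs_le_sqrt ha
      have u0 := sq' (J.u_sq_le x t)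
      have u1 := sq' (J.ut_sq_le x t)
      have u2 := sq' (J.utt_sq_le x t)
      have q0 := sq' (J.q_sq_le x t)
      have q1 := sq' (J.qt_sq_le x t)
      have q2 := sq' (J.qtt_sq_le x t)
      have U := hb.abs_u_le_const hx ht
      have U1 := hb.abs_ut_le_const hx ht
      have Q1 := hb.abs_qt_le_const hx ht
      have hs := he.abs_s_le hx ht
      have hγ : |J.γ| ≤ K := by
        rw [abs_of_pos (by linarith [J.one_lt_γ])]
        linarith [hb.γ_le]
      have hU2 : |J.u x t ^ 2| ≤ K * K := by rw [sq]; exact abs_mul_le_of_le U U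
      have y0 := bd_mul_left hqq u0
      rw [← J.velocity] at y0
      have y1 := bd_sub (bd_add (bd_mul_left hqq u1) (bd_mul_left Q1 u0))
        (bd_mul_left (abs_div_le_of_le (abs_mul_le_of_le (abs_nat_le 2) U) hrp hr) y0)
      rw [← J.r_sq_mul_φtx hx ht] at y1
      have y2 := bd_sub (bd_sub (bd_add (bd_add (bd_mul_left hqq u2)
        (bd_mul_left (abs_mul_le_of_le (abs_nat_le 2) Q1) u1)) (bd_mul_right q2 U))
        (bd_mul_left (abs_div_le_of_le (abs_mul_le_of_le (abs_nat_le 4) U) hrp hr) y1))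
        (bd_mul_left (abs_add_le_of_le (abs_div_le_of_le (abs_mul_le_of_le (abs_nat_le 2) U1)
          hrp hr) (abs_div_le_of_le (abs_mul_le_of_le (abs_nat_le 2) hU2) (pow_pos hrp 2) hr2)) y0)
      rw [← J.r_sq_mul_φttx hx ht] at y2
      have hH := mul_le_mul_of_nonneg_left q0 (by positivity : 0 ≤ K * 2 ^ K * 2 ^ K * 2)
      rw [← mul_assoc] at hH
      -- The only quantity that the differentiated equations do not express is `φ_t` itself;
      -- Bernoulli's law writes it through `u` and `q`.
      have z0 := bd_add (bd_mul_left (abs_mul_le_of_le (by norm_num : |(1 / 2 : ℝ)| ≤ 1) U) u0)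
        ((he.abs_enthalpy_le x t).trans hH)
      rw [mul_assoc (1 / 2), ← sq, ← bernoulli hb.toPointBound he hφ hx ht] at z0
      have z1 := bd_add (bd_mul_left (abs_mul_le_of_le hs hqq) q1) (bd_mul_left U u1)
      rw [← J.φtt_eq hx ht] at z1
      have z2 := bd_add (bd_add (bd_sub (bd_mul_left (abs_mul_le_of_le hs hqq) q2)
        (bd_mul_left (abs_mul_le_of_le (abs_mul_le_of_le hγ hs) Q1) q1)) (bd_mul_left U1 u1))
        (bd_mul_left U u2)
      rw [mul_assoc (J.γ * J.s x t), ← sq, ← sq, ← J.φttt_eq hx ht] at z2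
      exact ⟨z0, z1, z2, y0, y1, y2⟩
    obtain ⟨C0, C1, C2, C3, C4, C5, h⟩ := h
    refine ⟨|C0| + |C1| + |C2| + |C3| + |C4| + |C5|, fun J ε hb hφ x t hx ht => ?_⟩
    obtain ⟨h0, h1, h2, h3, h4, h5⟩ := h J ε hb hφ x t hx ht
    have w := Real.sqrt_nonneg (J.energyDensity x t)
    have a0 := abs_nonneg C0
    have a1 := abs_nonneg C1
    have a2 := abs_nonneg C2
    have a3 := abs_nonneg C3
    have a4 := abs_nonneg C4
    have a5 := abs_nonneg C5
    exact ⟨bd_mono h0 (by linarith [le_abs_self C0]) w, bd_mono h1 (by linarith [le_abs_self C1]) w,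
      bd_mono h2 (by linarith [le_abs_self C2]) w, bd_mono h3 (by linarith [le_abs_self C3]) w,
      bd_mono h4 (by linarith [le_abs_self C4]) w, bd_mono h5 (by linarith [le_abs_self C5]) w⟩
  obtain ⟨C, hC⟩ := key
  refine ⟨C ^ 2 * (1 + K) * K, fun J ε hb hφ => ?_⟩
  have hK := hb.K_nonneg
  have cD : Continuous fun z : ℝ × ℝ => J.energyDensity z.1 z.2 := by
    unfold energyDensity
    fun_prop
  have main : ∀ vt vx : ℝ → ℝ → ℝ, (Continuous fun z : ℝ × ℝ => vt z.1 z.2) →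
      (Continuous fun z : ℝ × ℝ => vx z.1 z.2) → ∀ t ∈ Icc 0 J.T,
      (∀ x, 0 ≤ x → |vt x t| ≤ C * √(J.energyDensity x t)
        ∧ |J.r x t ^ 2 * vx x t| ≤ C * √(J.energyDensity x t)) → ∀ X, 0 ≤ X →
      ∫ x in (0 : ℝ)..X, J.waveDensity vt vx x t ≤ C ^ 2 * (1 + K) * K * ε ^ 2 := by
    intro vt vx cvt cvx t ht h X hX
    refine (integral_mono_of_le (g := fun x => C ^ 2 * (1 + K) * J.energyDensity x t)
      (continuous_fst_slice (continuous_waveDensity cvt cvx) t)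
      ((continuous_fst_slice cD t).const_mul _) hX fun x hx => ?_).trans ?_
    · have hN : 0 ≤ J.energyDensity x t := (sq_nonneg _).trans (J.u_sq_le x t)
      have sq' : ∀ {a : ℝ}, |a| ≤ C * √(J.energyDensity x t) →
          a ^ 2 ≤ C ^ 2 * J.energyDensity x t :=
        fun {a} ha => by
          have := pow_le_pow_left₀ (abs_nonneg a) ha 2
          rwa [sq_abs, mul_pow, Real.sq_sqrt hN] at this
      have h1 := sq' (h x hx.1).1
      have h2 := mul_le_mul (hb.s_le x hx.1 t ht) (sq' (h x hx.1).2) (sq_nonneg _) hK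
      unfold waveDensity
      linarith
    · rw [intervalIntegral.integral_const_mul]
      have := mul_le_mul_of_nonneg_left (hb.energy_le t ht X hX)
        (by positivity : 0 ≤ C ^ 2 * (1 + K))
      linarith
  constructor
  · exact fun t ht X hX => main J.φt J.φx J.cont_φt J.cont_φx t ht (fun x hx =>
      ⟨(hC J ε hb hφ x t hx ht).1, (hC J ε hb hφ x t hx ht).2.2.2.1⟩) X hX
  · exact fun t ht X hX => main J.φtt J.φtx J.cont_φtt J.cont_φtx t ht (fun x hx =>
      ⟨(hC J ε hb hφ x t hx ht).2.1, (hC J ε hb hφ x t hx ht).2.2.2.2.1⟩) X hX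
  · exact fun t ht X hX => main J.φttt J.φttx J.cont_φttt J.cont_φttx t ht (fun x hx =>
      ⟨(hC J ε hb hφ x t hx ht).2.2.1, (hC J ε hb hφ x t hx ht).2.2.2.2.2⟩) X hX

/-! ### Control of `φ / ξ` -/

/-- Decay at infinity of a function with `ξ² ∂_x v ∈ L²`. -/
theorem sq_mul_wt_le {v vx : ℝ → ℝ} (cv : Continuous v) (cvx : Continuous vx)
    (xv : ∀ x, 0 < x → HasDerivAt v (vx x) x) (hv : Tendsto v atTop (𝓝 0)) {A : ℝ}
    (hA : ∀ X, 0 ≤ X → ∫ x in (0 : ℝ)..X, (wt x ^ 2 * vx x) ^ 2 ≤ A) {X : ℝ} (hX : 0 ≤ X) :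
    wt X * v X ^ 2 ≤ A := by
  have hw := wt_pos X
  have cw : Continuous fun x => (wt x ^ 2)⁻¹ :=
    Continuous.inv₀ (by fun_prop) fun x => pow_ne_zero _ (wt_ne x)
  -- Cauchy–Schwarz on `[X, ∞)` in the form of Young's inequality with a free parameter; the tail of
  -- `∫ ξ⁻⁴ dx` beyond `X` equals `1/ξ(X)`.
  have key : ∀ l : ℝ, 0 < l → |v X| ≤ l / 2 * (wt X)⁻¹ + 1 / (2 * l) * A := by
    intro l hl
    have hY : ∀ Y, X ≤ Y → |v Y - v X| ≤ l / 2 * (wt X)⁻¹ + 1 / (2 * l) * A := by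
      intro Y hY
      have e1 := integral_eq_sub_of_pos cv cvx xv hX hY
      have e2 := integral_eq_sub_of_pos (f := fun x => -(wt x)⁻¹)
        (f' := fun x => (wt x ^ 2)⁻¹ * (wt x ^ 2)⁻¹) continuous_wt_inv.neg (cw.mul cw)
        (fun x hx => ((hasDerivAt_wt hx).fun_inv (wt_ne x)).fun_neg.congr_deriv (by
          have := wt_ne x
          field_simp)) hX hY
      have e3 := integral_le_integral_of_le (f := fun x => (wt x ^ 2 * vx x) ^ 2) (by fun_prop)
        hY hX le_rfl fun x _ => sq_nonneg _
      have e4 := e3.trans (hA Y (hX.trans hY))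
      have hpt : ∀ x, |vx x| ≤ l / 2 * ((wt x ^ 2)⁻¹ * (wt x ^ 2)⁻¹)
          + 1 / (2 * l) * (wt x ^ 2 * vx x) ^ 2 := by
        intro x
        have hx := wt_pos x
        have e : l / 2 * ((wt x ^ 2)⁻¹ * (wt x ^ 2)⁻¹)
            + 1 / (2 * l) * (wt x ^ 2 * vx x) ^ 2 - |vx x|
            = (l * (wt x ^ 2)⁻¹ - wt x ^ 2 * |vx x|) ^ 2 / (2 * l) := by
          rw [← sq_abs (wt x ^ 2 * vx x), abs_mul, abs_of_pos (by positivity : 0 < wt x ^ 2)]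
          field_simp
          ring
        have : 0 ≤ (l * (wt x ^ 2)⁻¹ - wt x ^ 2 * |vx x|) ^ 2 / (2 * l) := by positivity
        linarith
      have e5 : ∫ x in X..Y, |vx x| ≤ ∫ x in X..Y, (l / 2 * ((wt x ^ 2)⁻¹ * (wt x ^ 2)⁻¹)
          + 1 / (2 * l) * (wt x ^ 2 * vx x) ^ 2) :=
        integral_mono_of_le cvx.abs (by fun_prop) hY fun x _ => hpt x
      rw [intervalIntegral.integral_add (Continuous.intervalIntegrable (by fun_prop) _ _)
        (Continuous.intervalIntegrable (by fun_prop) _ _), intervalIntegral.integral_const_mul,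
        intervalIntegral.integral_const_mul, e2] at e5
      have e6 := intervalIntegral.abs_integral_le_integral_abs (f := vx) (μ := volume) hY
      rw [e1] at e6
      have e7 : l / 2 * (-(wt Y)⁻¹ - -(wt X)⁻¹) ≤ l / 2 * (wt X)⁻¹ := by
        have := inv_pos.2 (wt_pos Y)
        gcongr
        linarith
      have e8 : 1 / (2 * l) * ∫ x in X..Y, (wt x ^ 2 * vx x) ^ 2 ≤ 1 / (2 * l) * A := by gcongr
      linarith
    have hl := (hv.sub_const (v X)).abs
    rw [zero_sub, abs_neg] at hl
    exact le_of_tendsto hl (by filter_upwards [eventually_ge_atTop X] with Y h using hY Y h)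
  by_cases h0 : v X = 0
  · rw [h0]
    have := hA 0 le_rfl
    rw [intervalIntegral.integral_same] at this
    simpa using this
  · have hp : 0 < |v X| := abs_pos.2 h0
    -- With this `l` the first term is half of the left-hand side.
    have h1 := key (|v X| * wt X) (by positivity)
    have e1 : |v X| * wt X / 2 * (wt X)⁻¹ = |v X| / 2 := by field_simp
    have e2 : 1 / (2 * (|v X| * wt X)) * A = A / (|v X| * wt X) / 2 := by field_simp
    rw [e1, e2] at h1
    have h2 : |v X| ≤ A / (|v X| * wt X) := by linarith
    rw [le_div_iff₀ (by positivity)] at h2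
    rw [← sq_abs]
    linarith

/-- Hardy's inequality for functions vanishing at infinity. -/
theorem integral_div_wt_sq_le {v vx : ℝ → ℝ} (cv : Continuous v) (cvx : Continuous vx)
    (xv : ∀ x, 0 < x → HasDerivAt v (vx x) x) (hv : Tendsto v atTop (𝓝 0)) {A : ℝ}
    (hA : ∀ X, 0 ≤ X → ∫ x in (0 : ℝ)..X, (wt x ^ 2 * vx x) ^ 2 ≤ A) {X : ℝ} (hX : 0 ≤ X) :
    ∫ x in (0 : ℝ)..X, (v x / wt x) ^ 2 ≤ 6 * A := by
  have h1 := sq_mul_wt_le cv cvx xv hv hA hX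
  have cw : Continuous fun x => (wt x ^ 2)⁻¹ :=
    Continuous.inv₀ (by fun_prop) fun x => pow_ne_zero _ (wt_ne x)
  have c1 : Continuous fun x => (v x / wt x) ^ 2 := by fun_prop (disch := exact wt_ne)
  have e := integral_eq_sub_of_pos (f := fun x => wt x * v x ^ 2)
    (f' := fun x => (wt x ^ 2)⁻¹ * v x ^ 2 + wt x * (2 * v x * vx x)) (by fun_prop) (by fun_prop)
    (fun x hx => ((hasDerivAt_wt hx).fun_mul ((xv x hx).fun_pow 2)).congr_deriv (by
      push_cast; ring)) le_rfl hX
  -- The integrand on the right is the derivative of `ξ v²`, and the difference of the integrands is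
  -- half a perfect square. The decay at `X` bounds the boundary term by `A`, which gives `A + 2 A`
  -- for half the integral, hence the factor `6`.
  have h2 : ∫ x in (0 : ℝ)..X, (1 / 2 * (v x / wt x) ^ 2 - 2 * (wt x ^ 2 * vx x) ^ 2)
      ≤ ∫ x in (0 : ℝ)..X, ((wt x ^ 2)⁻¹ * v x ^ 2 + wt x * (2 * v x * vx x)) := by
    refine integral_mono_of_le (by fun_prop) (by fun_prop) hX fun x _ => ?_
    have hw := wt_ne x
    have e1 : (wt x ^ 2)⁻¹ * v x ^ 2 + wt x * (2 * v x * vx x)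
        - (1 / 2 * (v x / wt x) ^ 2 - 2 * (wt x ^ 2 * vx x) ^ 2)
        = 1 / 2 * (v x / wt x + 2 * (wt x ^ 2 * vx x)) ^ 2 := by
      field_simp
      ring
    have : 0 ≤ 1 / 2 * (v x / wt x + 2 * (wt x ^ 2 * vx x)) ^ 2 := by positivity
    linarith
  rw [e, intervalIntegral.integral_sub (Continuous.intervalIntegrable (by fun_prop) _ _)
    (Continuous.intervalIntegrable (by fun_prop) _ _), intervalIntegral.integral_const_mul,
    intervalIntegral.integral_const_mul] at h2
  have h3 := hA X hX
  have h4 : 0 ≤ wt 0 * v 0 ^ 2 := mul_nonneg (wt_pos 0).le (sq_nonneg _)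
  linarith

end Jet

namespace Jet

variable {J : Jet} {K ε S : ℝ}

theorem EnergyBound.integral_fullDensity_le_of_le (hb : J.EnergyBound K ε) {v vt vx : ℝ → ℝ → ℝ}
    (cv : Continuous fun z : ℝ × ℝ => v z.1 z.2) (cvt : Continuous fun z : ℝ × ℝ => vt z.1 z.2)
    (cvx : Continuous fun z : ℝ × ℝ => vx z.1 z.2) {t X A : ℝ} (ht : t ∈ Icc 0 J.T) (hX : 0 ≤ X)
    (h : ∫ x in (0 : ℝ)..X, J.waveDensity vt vx x t ≤ S)
    (h' : ∫ x in (0 : ℝ)..X, (v x t / wt x) ^ 2 ≤ A) :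
    ∫ x in (0 : ℝ)..X, J.fullDensity v vt vx x t ≤ K * S + A := by
  have lv := continuous_fst_slice cv t
  have lw := continuous_fst_slice (continuous_waveDensity (J := J) cvt cvx) t
  have c1 : Continuous fun x => (v x t / wt x) ^ 2 := by fun_prop (disch := exact wt_ne)
  refine (integral_mono_of_le (continuous_fst_slice (continuous_fullDensity cv cvt cvx) t)
    (g := fun x => K * J.waveDensity vt vx x t + (v x t / wt x) ^ 2) (by fun_prop) hX
    fun x hx => hb.fullDensity_le hx.1 ht).trans ?_
  rw [intervalIntegral.integral_add (Continuous.intervalIntegrable (by fun_prop) _ _)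
    (c1.intervalIntegrable _ _), intervalIntegral.integral_const_mul]
  have := mul_le_mul_of_nonneg_left h hb.K_nonneg
  linarith

/-- For `∂_t φ` and `∂_t² φ` no Hardy inequality is needed: the function is itself a component of
the wave density one level below, and `ξ ≥ 1`. -/
theorem integral_div_wt_sq_le_of_le {v w wx : ℝ → ℝ → ℝ}
    (cv : Continuous fun z : ℝ × ℝ => v z.1 z.2) (cwx : Continuous fun z : ℝ × ℝ => wx z.1 z.2)
    {t X : ℝ} (hX : 0 ≤ X) (hw : w = v)
    (h : ∫ x in (0 : ℝ)..X, J.waveDensity w wx x t ≤ S) :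
    ∫ x in (0 : ℝ)..X, (v x t / wt x) ^ 2 ≤ S := by
  subst hw
  have lv := continuous_fst_slice cv t
  refine (integral_mono_of_le (by fun_prop (disch := exact wt_ne))
    (continuous_fst_slice (continuous_waveDensity (J := J) cv cwx) t) hX fun x _ => ?_).trans h
  refine le_trans ?_ (vt_sq_le_waveDensity x t)
  rw [div_pow]
  exact div_le_self (sq_nonneg _) (one_le_pow₀ (one_le_wt x))

section

variable (hb : J.EnergyBound K ε) (hS : J.WaveBound S)
  (hφ : ∀ t ∈ Icc 0 J.T, Tendsto (fun x => J.φ x t) atTop (𝓝 0))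
include hS

theorem WaveBound.nonneg : 0 ≤ S :=
  (intervalIntegral.integral_same (μ := volume)).symm.le.trans
    (hS.left 0 ⟨le_rfl, J.T_pos.le⟩ 0 le_rfl)

include hb

/-- The constant is larger than necessary here, so that all three levels share the one required by
`φ`. -/
theorem WaveBound.integral_D₁_le {t X : ℝ} (ht : t ∈ Icc 0 J.T) (hX : 0 ≤ X) :
    ∫ x in (0 : ℝ)..X, J.D₁ x t ≤ (K + 6 * K ^ 5) * S := by
  have h1 := hb.one_le
  have h2 : 1 ≤ K ^ 5 := one_le_pow₀ h1
  refine (hb.integral_fullDensity_le_of_le J.cont_φt J.cont_φtt J.cont_φtx ht hX (hS.mid t ht X hX)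
    (integral_div_wt_sq_le_of_le J.cont_φt J.cont_φx hX rfl (hS.left t ht X hX))).trans ?_
  nlinarith [hS.nonneg]

theorem WaveBound.integral_D₂_le {t X : ℝ} (ht : t ∈ Icc 0 J.T) (hX : 0 ≤ X) :
    ∫ x in (0 : ℝ)..X, J.D₂ x t ≤ (K + 6 * K ^ 5) * S := by
  have h1 := hb.one_le
  have h2 : 1 ≤ K ^ 5 := one_le_pow₀ h1
  refine (hb.integral_fullDensity_le_of_le J.cont_φtt J.cont_φttt J.cont_φttx ht hX
    (hS.right t ht X hX)
    (integral_div_wt_sq_le_of_le J.cont_φtt J.cont_φtx hX rfl (hS.mid t ht X hX))).trans ?_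
  nlinarith [hS.nonneg]

include hφ

/-- For `φ` itself, `φ/ξ` is controlled by Hardy's inequality from infinity, through the decay
assumption. The factor `K ^ 5` converts `ξ² φ_x` into `r² φ_x` and then into the wave density. -/
theorem WaveBound.integral_D₀_le {t X : ℝ} (ht : t ∈ Icc 0 J.T) (hX : 0 ≤ X) :
    ∫ x in (0 : ℝ)..X, J.D₀ x t ≤ (K + 6 * K ^ 5) * S := by
  have hK := hb.K_nonneg
  have lx := continuous_fst_slice J.cont_φx t
  have h := integral_div_wt_sq_le (continuous_fst_slice J.cont_φ t) lx
    (fun x hx => J.hasDx_φ x hx t ht) (hφ t ht) (A := K ^ 5 * S) (fun Y hY => by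
      refine (integral_mono_of_le (g := fun x => K ^ 5 * J.waveDensity J.φt J.φx x t) (by fun_prop)
        ((continuous_fst_slice (continuous_waveDensity J.cont_φt J.cont_φx) t).const_mul _)
        hY fun x hx => ?_).trans ?_
      · have h1 := hb.wt_le x hx.1 t ht
        have h2 := wt_pos x
        have h3 := hb.one_le_s x hx.1 t ht
        have h4 := mul_le_mul_of_nonneg_right h3 (sq_nonneg (J.r x t ^ 2 * J.φx x t))
        have h5 : K * (J.s x t * (J.r x t ^ 2 * J.φx x t) ^ 2)
            ≤ K * J.waveDensity J.φt J.φx x t := by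
          unfold waveDensity
          have := sq_nonneg (J.φt x t)
          gcongr
          linarith
        calc (wt x ^ 2 * J.φx x t) ^ 2 = wt x ^ 4 * J.φx x t ^ 2 := by ring
          _ ≤ (K * J.r x t) ^ 4 * J.φx x t ^ 2 := by gcongr
          _ = K ^ 4 * (J.r x t ^ 2 * J.φx x t) ^ 2 := by ring
          _ ≤ K ^ 4 * (K * J.waveDensity J.φt J.φx x t) := by gcongr; linarith
          _ = _ := by ring
      · rw [intervalIntegral.integral_const_mul]
        exact mul_le_mul_of_nonneg_left (hS.left t ht Y hY) (by positivity)) hX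
  refine (hb.integral_fullDensity_le_of_le J.cont_φ J.cont_φt J.cont_φx ht hX (hS.left t ht X hX)
    h).trans_eq ?_
  ring

end

/-! ### The outer flux -/

theorem continuous_totalFlux (J : Jet) (T' : ℝ) : Continuous fun X => J.totalFlux X T' := by
  have cg : Continuous J.weight := continuous_logWeight J.one_add_T_pos
  have ce0 : Continuous fun z : ℝ × ℝ => J.E₀ z.2 z.1 := J.continuous_E₀.comp continuous_swap
  have ce1 : Continuous fun z : ℝ × ℝ => J.E₁ z.2 z.1 := J.continuous_E₁.comp continuous_swap
  have ce2 : Continuous fun z : ℝ × ℝ => J.E₂ z.2 z.1 := J.continuous_E₂.comp continuous_swap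
  exact continuous_integral (f := fun t X => 1 / 2 * J.weight X * J.r X t ^ 2
    * (J.E₀ X t + J.E₁ X t + J.E₂ X t)) (by fun_prop) 0 T'

theorem totalFlux_nonneg (J : Jet) (X : ℝ) {T' : ℝ} (hT' : 0 ≤ T') : 0 ≤ J.totalFlux X T' :=
  intervalIntegral.integral_nonneg hT' fun t _ => by
    have h0 : 0 ≤ J.weight X := zero_le_one.trans (one_le_logWeight J.one_add_T_pos X)
    have h1 : 0 ≤ J.E₀ X t := mulDensity_nonneg X t
    have h2 : 0 ≤ J.E₁ X t := mulDensity_nonneg X t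
    have h3 : 0 ≤ J.E₂ X t := mulDensity_nonneg X t
    positivity

/-- The flux density carries `r²`, which `ξ⁻²` compensates. By Fubini the flux is integrable against
`ξ⁻² dx`, with a bound by time times energy. Since this measure has infinite mass, the flux is small
at arbitrarily distant points. -/
theorem EnergyBound.exists_totalFlux_le (hb : J.EnergyBound K ε) {S' : ℝ}
    (h0 : ∀ t ∈ Icc 0 J.T, ∀ X, 0 ≤ X → ∫ x in (0 : ℝ)..X, J.D₀ x t ≤ S')
    (h1 : ∀ t ∈ Icc 0 J.T, ∀ X, 0 ≤ X → ∫ x in (0 : ℝ)..X, J.D₁ x t ≤ S')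
    (h2 : ∀ t ∈ Icc 0 J.T, ∀ X, 0 ≤ X → ∫ x in (0 : ℝ)..X, J.D₂ x t ≤ S') {T' : ℝ} (hT' : 0 ≤ T')
    (hTT : T' ≤ J.T) {δ : ℝ} (hδ : 0 < δ) (N : ℝ) : ∃ X, N ≤ X ∧ 0 ≤ X ∧ J.totalFlux X T' ≤ δ := by
  have hK := hb.K_nonneg
  have hG := zero_le_one.trans J.one_le_weightSup
  have cg : Continuous J.weight := continuous_logWeight J.one_add_T_pos
  have ce0 := J.continuous_E₀
  have ce1 := J.continuous_E₁
  have ce2 := J.continuous_E₂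
  have cd0 := J.continuous_D₀
  have cd1 := J.continuous_D₁
  have cd2 := J.continuous_D₂
  have cw : Continuous fun x => (wt x ^ 2)⁻¹ :=
    Continuous.inv₀ (by fun_prop) fun x => pow_ne_zero _ (wt_ne x)
  obtain ⟨M, hM⟩ : ∃ M, M = 1 / 2 * J.weightSup * K ^ 2 * (1 + K * (1 + 2 * K) ^ 2) := ⟨_, rfl⟩
  have hM0 : 0 ≤ M := by rw [hM]; positivity
  have cF : Continuous fun z : ℝ × ℝ => (wt z.1 ^ 2)⁻¹ * (1 / 2 * J.weight z.1 * J.r z.1 z.2 ^ 2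
      * (J.E₀ z.1 z.2 + J.E₁ z.1 z.2 + J.E₂ z.1 z.2)) := by
    fun_prop (disch := intro z; exact pow_ne_zero _ (wt_ne _))
  refine exists_le_of_integral_le (J.continuous_totalFlux T') (fun X _ => J.totalFlux_nonneg X hT')
    (A := T' * (M * (S' + S' + S'))) (fun X hX => ?_) hδ N
  have e : ∫ x in (0 : ℝ)..X, (wt x ^ 2)⁻¹ * J.totalFlux x T' = iint X T' fun x t =>
      (wt x ^ 2)⁻¹ * (1 / 2 * J.weight x * J.r x t ^ 2 * (J.E₀ x t + J.E₁ x t + J.E₂ x t)) := by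
    unfold totalFlux iint
    simp only [← intervalIntegral.integral_const_mul]
    exact intervalIntegral_comm (f := fun x t => (wt x ^ 2)⁻¹ * (1 / 2 * J.weight x * J.r x t ^ 2
      * (J.E₀ x t + J.E₁ x t + J.E₂ x t))) cF _ _ _ _
  rw [e]
  refine iint_le cF hT' fun t ht => ?_
  have ht' : t ∈ Icc 0 J.T := ⟨ht.1, ht.2.trans hTT⟩
  have l0 := continuous_fst_slice cd0 t
  have l1 := continuous_fst_slice cd1 t
  have l2 := continuous_fst_slice cd2 t
  have k0 := continuous_fst_slice ce0 t
  have k1 := continuous_fst_slice ce1 t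
  have k2 := continuous_fst_slice ce2 t
  refine (integral_mono_of_le (g := fun x => M * (J.D₀ x t + J.D₁ x t + J.D₂ x t))
    (by fun_prop) (by fun_prop) hX fun x hx => ?_).trans ?_
  · have e0 : J.E₀ x t ≤ _ := hb.mulDensity_le hx.1 ht'
    have e1 : J.E₁ x t ≤ _ := hb.mulDensity_le hx.1 ht'
    have e2 : J.E₂ x t ≤ _ := hb.mulDensity_le hx.1 ht'
    change J.E₀ x t ≤ (1 + K * (1 + 2 * K) ^ 2) * J.D₀ x t at e0
    change J.E₁ x t ≤ (1 + K * (1 + 2 * K) ^ 2) * J.D₁ x t at e1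
    change J.E₂ x t ≤ (1 + K * (1 + 2 * K) ^ 2) * J.D₂ x t at e2
    have n0 : 0 ≤ J.E₀ x t := mulDensity_nonneg x t
    have n1 : 0 ≤ J.E₁ x t := mulDensity_nonneg x t
    have n2 : 0 ≤ J.E₂ x t := mulDensity_nonneg x t
    have hw := wt_pos x
    have hr : (wt x ^ 2)⁻¹ * J.r x t ^ 2 ≤ K ^ 2 := by
      rw [inv_mul_le_iff₀ (by positivity), mul_comm, ← mul_pow]
      exact pow_le_pow_left₀ (J.r_pos x t).le (hb.r_le x hx.1 t ht') 2
    have hg : J.weight x ≤ J.weightSup := logWeight_le J.one_add_T_pos x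
    have hg0 : 0 ≤ J.weight x := zero_le_one.trans (one_le_logWeight J.one_add_T_pos x)
    calc (wt x ^ 2)⁻¹ * (1 / 2 * J.weight x * J.r x t ^ 2 * (J.E₀ x t + J.E₁ x t + J.E₂ x t))
        = 1 / 2 * J.weight x * ((wt x ^ 2)⁻¹ * J.r x t ^ 2)
          * (J.E₀ x t + J.E₁ x t + J.E₂ x t) := by ring
      _ ≤ 1 / 2 * J.weightSup * K ^ 2 * ((1 + K * (1 + 2 * K) ^ 2)
          * (J.D₀ x t + J.D₁ x t + J.D₂ x t)) := by
          gcongr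
          linarith
      _ = M * (J.D₀ x t + J.D₁ x t + J.D₂ x t) := by rw [hM]; ring
  · rw [intervalIntegral.integral_const_mul, intervalIntegral.integral_add
      (Continuous.intervalIntegrable (by fun_prop) _ _) (l2.intervalIntegrable _ _),
      intervalIntegral.integral_add (l0.intervalIntegrable _ _) (l1.intervalIntegrable _ _)]
    have := h0 t ht' X hX
    have := h1 t ht' X hX
    have := h2 t ht' X hX
    gcongr

theorem iint_mono_right {X Y T' : ℝ} {f : ℝ → ℝ → ℝ} (hf : Continuous fun z : ℝ × ℝ => f z.1 z.2)
    (h : ∀ x, 0 ≤ x → ∀ t, 0 ≤ f x t) (hX : 0 ≤ X) (hXY : X ≤ Y) (hT' : 0 ≤ T') :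
    iint X T' f ≤ iint Y T' f :=
  integral_mono_of_le (continuous_integral hf _ _) (continuous_integral hf _ _) hT' fun t _ =>
    integral_le_integral_of_le (continuous_fst_slice hf t) hX le_rfl hXY fun x hx => h x hx.1 t

/-- The weighted space-time estimate. -/
theorem exists_kss (K : ℝ) : ∃ C δ, 0 ≤ C ∧ 0 < δ ∧ ∀ (J : Jet) (ε S : ℝ), J.Bound K ε →
    ε * J.weightSup ≤ δ → J.WaveBound S →
    (∀ t ∈ Icc 0 J.T, Tendsto (fun x => J.φ x t) atTop (𝓝 0)) →
    ∀ X T', 0 ≤ X → 0 ≤ T' → T' < J.T →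
    J.kssInt X T' ≤ C * (J.weightSup * S + ∫ t in (0 : ℝ)..J.T, J.φ 0 t ^ 2) := by
  by_cases hK : 0 ≤ K
  swap
  · exact ⟨0, 1, le_rfl, one_pos, fun J ε S hb => absurd hb.K_nonneg hK⟩
  obtain ⟨C, δ, hC, hδ, h⟩ := exists_kssInt_le K
  refine ⟨C * (K + 6 * K ^ 5 + 1), δ, by positivity, hδ, ?_⟩
  intro J ε S hb hεδ hS hφ X T' hX hT' hTT
  have he := hb.toEnergyBound
  have hG := J.one_le_weightSup
  have cφ := continuous_snd_slice J.cont_φ 0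
  have h0 := fun t ht X hX => hS.integral_D₀_le he hφ (t := t) (X := X) ht hX
  have h1 := fun t ht X hX => hS.integral_D₁_le he (t := t) (X := X) ht hX
  have h2 := fun t ht X hX => hS.integral_D₂_le he (t := t) (X := X) ht hX
  have hmono : ∀ Y, X ≤ Y → J.kssInt X T' ≤ J.kssInt Y T' := fun Y hY => by
    have cd0 := J.continuous_D₀
    have cd1 := J.continuous_D₁
    have cd2 := J.continuous_D₂
    refine add_le_add_left (iint_mono_right
      (by fun_prop (disch := intro z; exact wt_ne _)) (fun x _ t => ?_) hX hY hT') _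
    have n0 : 0 ≤ J.D₀ x t := fullDensity_nonneg _ _ _
    have n1 : 0 ≤ J.D₁ x t := fullDensity_nonneg _ _ _
    have n2 : 0 ≤ J.D₂ x t := fullDensity_nonneg _ _ _
    have := inv_pos.2 (wt_pos x)
    positivity
  have hb0 : ∫ t in (0 : ℝ)..T', J.φ 0 t ^ 2 ≤ ∫ t in (0 : ℝ)..J.T, J.φ 0 t ^ 2 :=
    integral_le_integral_of_le (by fun_prop) hT' le_rfl hTT.le fun t _ => sq_nonneg _
  have hb0' : 0 ≤ ∫ t in (0 : ℝ)..J.T, J.φ 0 t ^ 2 :=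
    intervalIntegral.integral_nonneg J.T_pos.le fun t _ => sq_nonneg _
  have hS0 := hS.nonneg
  -- The truncated quantity increases with `X`, so the region may be enlarged to one whose outer
  -- flux is negligible.
  have key : J.kssInt X T' ≤ C * (J.weightSup * ((K + 6 * K ^ 5) * S)
      + ∫ t in (0 : ℝ)..J.T, J.φ 0 t ^ 2) := by
    refine le_of_forall_pos_le_add fun η hη => ?_
    obtain ⟨Y, hXY, hY, hfl⟩ := he.exists_totalFlux_le h0 h1 h2 hT' hTT.le
      (δ := η / (C + 1)) (by positivity) X
    have h3 := h J ε hb hεδ Y T' hY hT' hTT _ (fun t ht => h0 t ht Y hY) (fun t ht => h1 t ht Y hY)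
      (fun t ht => h2 t ht Y hY)
    have h4 : C * (η / (C + 1)) ≤ η := by
      rw [mul_div_assoc', div_le_iff₀ (by positivity)]
      nlinarith
    have h5 := mul_le_mul_of_nonneg_left (add_le_add hb0 hfl) hC
    linarith [hmono Y hXY]
  refine key.trans ?_
  rw [mul_assoc C]
  refine mul_le_mul_of_nonneg_left ?_ hC
  have h6 : 0 ≤ J.weightSup * S := by positivity
  have h7 : 0 ≤ (K + 6 * K ^ 5) * ∫ t in (0 : ℝ)..J.T, J.φ 0 t ^ 2 := by positivity
  nlinarith

end Jet

/-! ### Lower integrals -/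

theorem ofReal_intervalIntegral {f : ℝ → ℝ} (hf : Continuous f) (h0 : ∀ x, 0 ≤ f x) {a b : ℝ}
    (hab : a ≤ b) :
    ENNReal.ofReal (∫ x in a..b, f x) = ∫⁻ x in Ioc a b, ENNReal.ofReal (f x) := by
  rw [intervalIntegral.integral_of_le hab]
  exact ofReal_integral_eq_lintegral_ofReal (hf.integrableOn_Ioc) (Eventually.of_forall h0)

/-- Lower integrals over the half-line are suprema over bounded intervals, where they agree with
integrals of continuous functions. Estimates uniform in the truncation therefore transfer without
any integrability hypothesis. -/
theorem lintegral_Ioi_eq_iSup (f : ℝ → ℝ≥0∞) :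
    ∫⁻ x in Ioi (0 : ℝ), f x = ⨆ n : ℕ, ∫⁻ x in Ioc (0 : ℝ) n, f x := by
  have e : Ioi (0 : ℝ) = ⋃ n : ℕ, Ioc (0 : ℝ) n := by
    ext x
    simp only [mem_Ioi, mem_iUnion, mem_Ioc]
    exact ⟨fun hx => ⟨⌈x⌉₊, hx, Nat.le_ceil x⟩, fun ⟨_, hx, _⟩ => hx⟩
  rw [e]
  exact setLIntegral_iUnion_of_directed _ (Monotone.directed_le fun m n hmn =>
    Ioc_subset_Ioc_right (by exact_mod_cast hmn))

theorem lintegral_Ioi_le {f : ℝ → ℝ} (hf : Continuous f) (h0 : ∀ x, 0 ≤ f x) {A : ℝ}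
    (h : ∀ X, 0 ≤ X → ∫ x in (0 : ℝ)..X, f x ≤ A) :
    ∫⁻ x in Ioi (0 : ℝ), ENNReal.ofReal (f x) ≤ ENNReal.ofReal A := by
  rw [lintegral_Ioi_eq_iSup]
  refine iSup_le fun n => ?_
  rw [← ofReal_intervalIntegral hf h0 n.cast_nonneg]
  exact ENNReal.ofReal_le_ofReal (h n n.cast_nonneg)

theorem integral_le_of_lintegral_Ioi_le {f : ℝ → ℝ} (hf : Continuous f) (h0 : ∀ x, 0 ≤ f x)
    {A : ℝ} (hA : 0 ≤ A)
    (h : ∫⁻ x in Ioi (0 : ℝ), ENNReal.ofReal (f x) ≤ ENNReal.ofReal A) {X : ℝ} (hX : 0 ≤ X) :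
    ∫ x in (0 : ℝ)..X, f x ≤ A := by
  rw [← ENNReal.ofReal_le_ofReal_iff hA, ofReal_intervalIntegral hf h0 hX]
  exact (lintegral_mono_set Ioc_subset_Ioi_self).trans h

theorem lintegral_lintegral_Ioi_le {f : ℝ → ℝ → ℝ} (hf : Continuous fun z : ℝ × ℝ => f z.1 z.2)
    (h0 : ∀ x t, 0 ≤ f x t) {T A : ℝ} (hT : 0 ≤ T) (h : ∀ X, 0 ≤ X → iint X T f ≤ A) :
    ∫⁻ t in Icc 0 T, ∫⁻ x in Ioi (0 : ℝ), ENNReal.ofReal (f x t) ≤ ENNReal.ofReal A := by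
  have e : ∀ (n : ℕ) t, ∫⁻ x in Ioc (0 : ℝ) n, ENNReal.ofReal (f x t)
      = ENNReal.ofReal (∫ x in (0 : ℝ)..n, f x t) := fun n t =>
    (ofReal_intervalIntegral (continuous_fst_slice hf t) (fun x => h0 x t) n.cast_nonneg).symm
  simp only [lintegral_Ioi_eq_iSup]
  rw [lintegral_iSup (fun n => ?_) fun m n hmn t => ?_]
  · refine iSup_le fun n => ?_
    simp only [e]
    rw [← restrict_Ioc_eq_restrict_Icc, ← ofReal_intervalIntegral (continuous_integral hf _ _)
      (fun t => intervalIntegral.integral_nonneg n.cast_nonneg fun x _ => h0 x t) hT]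
    exact ENNReal.ofReal_le_ofReal (h n n.cast_nonneg)
  · simp only [e]
    exact (continuous_integral hf _ _).measurable.ennreal_ofReal
  · exact lintegral_mono_set (Ioc_subset_Ioc_right (by exact_mod_cast hmn))

theorem lintegral_Icc_eq {f : ℝ → ℝ} (hf : Continuous f) (h0 : ∀ x, 0 ≤ f x) {T : ℝ}
    (hT : 0 ≤ T) :
    ∫⁻ t in Icc 0 T, ENNReal.ofReal (f t) = ENNReal.ofReal (∫ t in (0 : ℝ)..T, f t) := by
  rw [ofReal_intervalIntegral hf h0 hT, restrict_Ioc_eq_restrict_Icc]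

/-! ### Constants -/

namespace Params

variable (P : Params)

theorem Rbar_pos : 0 < P.Rbar := by
  have := P.Ca_pos
  have := P.We_pos
  unfold Rbar
  positivity

/-- If `R < 2 ^ (-γ) < 1`, the bracket in `f` is at least `R⁻¹ > 2 ^ γ`, because `R ^ (-3γ₀)`
dominates `R⁻¹`. Then `f (R) + 1 < 1/2`, a contradiction. The bound on `f (R)` thus keeps the bubble
from collapsing. -/
theorem le_radius {R : ℝ} (hR : 0 < R) (hf : -1 / 2 ≤ P.f R) : (1 / 2 : ℝ) ^ P.γ ≤ R := by
  have hγ := P.one_lt_γ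
  by_contra! hlt
  have hR1 : R < 1 := hlt.trans_le (Real.rpow_le_one (by norm_num) (by norm_num) (by linarith))
  obtain ⟨a, ha⟩ : ∃ a, a = 2 / P.Ca * (2 / P.We) := ⟨_, rfl⟩
  have ha0 : 0 ≤ a := by
    rw [ha]
    have := P.Ca_pos
    have := P.We_pos
    positivity
  have h1 : R ^ (-1 : ℝ) ≤ R ^ (-3 * P.γ₀) :=
    Real.rpow_le_rpow_of_exponent_ge hR hR1.le (by linarith [P.one_lt_γ₀])
  have h2 : R ^ (-1 : ℝ) ≤ (1 + a) * R ^ (-3 * P.γ₀) - a * R ^ (-1 : ℝ) := by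
    nlinarith [mul_le_mul_of_nonneg_left h1 ha0]
  have h3 : ((1 / 2 : ℝ) ^ P.γ) ^ (-1 : ℝ) < R ^ (-1 : ℝ) :=
    Real.rpow_lt_rpow_of_neg hR hlt (by norm_num)
  have h4 := h3.trans_le h2
  have h5 : ((1 / 2 : ℝ) ^ P.γ) ^ (-1 : ℝ) = 2 ^ P.γ := by
    rw [← Real.rpow_mul (by norm_num), mul_neg_one, one_div, Real.inv_rpow (by norm_num),
      Real.rpow_neg (by norm_num), inv_inv]
  rw [h5] at h4
  have h6 := Real.rpow_lt_rpow_of_neg (z := -1 / P.γ) (by positivity) h4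
    (div_neg_of_neg_of_pos (by norm_num) (by linarith))
  rw [← Real.rpow_mul (by norm_num), mul_div_cancel₀ _ (by linarith : P.γ ≠ 0),
    show ((2 : ℝ) ^ (-1 : ℝ)) = 1 / 2 by rw [Real.rpow_neg_one]; norm_num] at h6
  unfold f at hf
  rw [← ha] at hf
  linarith

/-- A constant that dominates everything that depends on the flow only through the bootstrap
bounds. -/
def bound (B : ℝ) : ℝ :=
  2 + P.γ + 2 ^ P.γ + P.Rbar + 2 ^ (P.γ + 1) / (P.Ca * P.γ / 2)
    + P.Ca * P.γ / 2 * 2 ^ (P.γ + 1) + 8 * B * (1 + 2 ^ (P.γ + 1) / (P.Ca * P.γ / 2))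

end Params

/-! ### Verification of the bounds for the given flow -/

section OfFlow

variable {P : Params} {T B ε : ℝ} {u q : ℝ → ℝ → ℝ} {R : ℝ → ℝ} {φ : ℝ → ℝ → ℝ}

theorem IsEulerFlow.rad_cube (h : IsEulerFlow P T u q R)
    (hq : ∀ x, 0 ≤ x → ∀ t ∈ Icc 0 T, q x t ∈ Icc (-1 / 2 : ℝ) (1 / 2)) {x t : ℝ} (hx : 0 ≤ x)
    (ht : t ∈ Icc 0 T) : rad q R x t ^ 3 = radCube q R x t := by
  change (radCube q R x t ^ (1 / 3 : ℝ)) ^ 3 = _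
  rw [← Real.rpow_natCast, ← Real.rpow_mul (h.radCube_pos hq hx ht).le]
  norm_num

/-- Compare cubes: `K R ≥ 1` takes care of the constant `1` in `ξ³`, and `K³ ≥ 8` with `q ≥ -1/2`
takes care of the linear part. -/
theorem wt_le_mul_rad (h : IsEulerFlow P T u q R) (hb : Bootstrap P T B ε u q R) {K : ℝ}
    (hK : 2 ≤ K) (hK' : 2 ^ P.γ ≤ K) {x t : ℝ} (hx : 0 ≤ x) (ht : t ∈ Icc 0 T) :
    wt x ≤ K * rad q R x t := by
  have hq := fun x hx t ht => hb.q_mem_Icc h (x := x) hx (t := t) ht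
  have hr := h.rad_pos hq hx ht
  refine le_of_pow_le_pow_left₀ three_ne_zero (by positivity) ?_
  rw [mul_pow, h.rad_cube hq hx ht, wt_cube hx]
  have h1 := h.radCube_ge hq hx ht
  have h2 := P.le_radius (h.R_mem t ht).1 (hb.f_mem t ht).1
  have h3 : 1 ≤ K * R t := by
    calc (1 : ℝ) = 2 ^ P.γ * (1 / 2) ^ P.γ := by
          rw [← Real.mul_rpow (by norm_num) (by norm_num)]; norm_num
      _ ≤ K * R t := by gcongr
  have h4 : 1 ≤ K ^ 3 * R t ^ 3 := by rw [← mul_pow]; exact one_le_pow₀ h3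
  have h5 : (2 : ℝ) ^ 3 ≤ K ^ 3 := by gcongr
  have h6 := mul_le_mul_of_nonneg_left h1 (by positivity : 0 ≤ K ^ 3)
  nlinarith [mul_le_mul_of_nonneg_right h5 hx]

theorem rad_le_mul_wt (h : IsEulerFlow P T u q R) (hb : Bootstrap P T B ε u q R) {K : ℝ}
    (hK : 2 ≤ K) (hK' : P.Rbar ≤ K) {x t : ℝ} (hx : 0 ≤ x) (ht : t ∈ Icc 0 T) :
    rad q R x t ≤ K * wt x := by
  have hq := fun x hx t ht => hb.q_mem_Icc h (x := x) hx (t := t) ht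
  have hw := wt_pos x
  refine le_of_pow_le_pow_left₀ three_ne_zero (by positivity) ?_
  rw [mul_pow, h.rad_cube hq hx ht, wt_cube hx]
  have h1 := h.radCube_le hq hx ht
  have h2 := h.R_mem t ht
  have h3 : R t ^ 3 ≤ K ^ 3 := pow_le_pow_left₀ h2.1.le (h2.2.le.trans hK') 3
  have h5 : (2 : ℝ) ^ 3 ≤ K ^ 3 := by gcongr
  nlinarith [mul_le_mul_of_nonneg_right h5 hx]

theorem Jet.s_mem (J : Jet) (x t : ℝ) :
    J.s x t ≤ J.κ * 2 ^ (J.γ + 1) ∧ 1 ≤ 2 ^ (J.γ + 1) / J.κ * J.s x t := by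
  have hκ := J.κ_pos
  have hγ := J.one_lt_γ
  have hq := J.q_mem x t
  have hq0 := J.one_add_q_pos x t
  have h1 : (1 + J.q x t)⁻¹ ^ (J.γ + 1) ≤ 2 ^ (J.γ + 1) := by
    refine Real.rpow_le_rpow (by positivity) ?_ (by linarith)
    rw [inv_le_comm₀ hq0 (by norm_num)]
    linarith [hq.1]
  have h2 : (1 / 2 : ℝ) ^ (J.γ + 1) ≤ (1 + J.q x t)⁻¹ ^ (J.γ + 1) := by
    refine Real.rpow_le_rpow (by norm_num) ?_ (by linarith)
    rw [one_div]
    exact inv_anti₀ hq0 (by linarith [hq.2])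
  have h3 : (2 : ℝ) ^ (J.γ + 1) * (1 / 2) ^ (J.γ + 1) = 1 := by
    rw [← Real.mul_rpow (by norm_num) (by norm_num)]; norm_num
  refine ⟨mul_le_mul_of_nonneg_left h1 hκ.le, ?_⟩
  rw [Jet.s, div_mul_eq_mul_div, mul_left_comm, mul_div_cancel_left₀ _ hκ.ne']
  exact h3.symm.le.trans (mul_le_mul_of_nonneg_left h2 (by positivity))

section

variable (h : IsEulerFlow P T u q R) (hv : IsVelocityPotential T u q R φ)
  (hw : SolvesWave P T q R φ)
  (hq : ∀ x, 0 ≤ x → ∀ t ∈ Icc 0 T, q x t ∈ Icc (-1 / 2 : ℝ) (1 / 2)) (hT : 0 < T)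

theorem Jet.ofFlow_s {x t : ℝ} (hx : 0 ≤ x) (ht : t ∈ Icc 0 T) :
    (Jet.ofFlow h hv hw hq hT).s x t = P.c q x t ^ 2 := by
  have h1 : 0 < 1 + q x t := by linarith [(hq x hx t ht).1]
  rw [P.c_sq h1]
  change P.Ca * P.γ / 2 * (1 + ext T q x t)⁻¹ ^ (P.γ + 1) = _
  rw [ext_apply q hx ht]

/-- The bootstrap bounds the total energy by `4 B ε²`. Removal of the factor `1/2` and of the weight
`c²` costs `2 (1 + M)`, where `1/M` bounds `c²` from below. -/
theorem Jet.ofFlow_energyDensity_le (hb : Bootstrap P T B ε u q R) (hB : 0 < B) {t X : ℝ}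
    (ht : t ∈ Icc 0 T) (hX : 0 ≤ X) :
    ∫ x in (0 : ℝ)..X, (Jet.ofFlow h hv hw hq hT).energyDensity x t
      ≤ 8 * B * (1 + 2 ^ (P.γ + 1) / (P.Ca * P.γ / 2)) * ε ^ 2 := by
  obtain ⟨J, hJ⟩ : ∃ J, J = Jet.ofFlow h hv hw hq hT := ⟨_, rfl⟩
  obtain ⟨M, hM⟩ : ∃ M, M = 2 ^ (P.γ + 1) / (P.Ca * P.γ / 2) := ⟨_, rfl⟩
  have hM0 : 0 ≤ M := by
    have := P.Ca_pos
    have := P.one_lt_γ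
    rw [hM]
    positivity
  have hs : ∀ x, 1 ≤ M * J.s x t := fun x => by
    rw [hM, hJ]; exact ((Jet.ofFlow h hv hw hq hT).s_mem x t).2
  obtain ⟨g, hg⟩ : ∃ g : (ℝ → ℝ → ℝ) → (ℝ → ℝ → ℝ) → ℝ → ℝ, g = fun a b x =>
    1 / 2 * (a x t ^ 2 + J.s x t * b x t ^ 2) := ⟨_, rfl⟩
  have g0 : ∀ a b x, 0 ≤ g a b x := fun a b x => by
    have := J.s_pos x t
    rw [hg]
    positivity
  have cg : ∀ a b : ℝ → ℝ → ℝ, (Continuous fun z : ℝ × ℝ => a z.1 z.2) →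
      (Continuous fun z : ℝ × ℝ => b z.1 z.2) → Continuous (g a b) := fun a b ca cb => by
    have la := continuous_fst_slice ca t
    have lb := continuous_fst_slice cb t
    rw [hg]
    fun_prop
  have e : ∀ j a b, (∀ x, 0 ≤ x → dt T j u x t = a x t) → (∀ x, 0 ≤ x → dt T j q x t = b x t) →
      ∫⁻ x in Ioi (0 : ℝ), ENNReal.ofReal (g a b x) ≤ energy P T u q R j t := by
    intro j a b ha hb
    -- The boundary part of the energy is a nonnegative extended real and is dropped.
    refine le_trans (le_of_eq ?_) le_self_add
    refine setLIntegral_congr_fun measurableSet_Ioi fun x hx => ?_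
    have hx : 0 ≤ x := (mem_Ioi.1 hx).le
    simp only [hg]
    rw [ha x hx, hb x hx, hJ, Jet.ofFlow_s h hv hw hq hT hx ht]
  have c0 := cg _ _ J.cont_u J.cont_q
  have c1 := cg _ _ J.cont_ut J.cont_qt
  have c2 := cg _ _ J.cont_utt J.cont_qtt
  have d2 : ∀ g : ℝ → ℝ → ℝ, dt T 2 g = dt T 1 (dt T 1 g) := fun g => dt_succ 1 g
  have e0 := e 0 J.u J.q (fun x hx => by rw [dt_zero, hJ]; exact (ext_apply u hx ht).symm)
    (fun x hx => by rw [dt_zero, hJ]; exact (ext_apply q hx ht).symm)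
  have e1 := e 1 J.ut J.qt (fun x hx => by rw [hJ]; exact (ext_apply _ hx ht).symm)
    (fun x hx => by rw [hJ]; exact (ext_apply _ hx ht).symm)
  have e2 := e 2 J.utt J.qtt (fun x hx => by rw [d2, hJ]; exact (ext_apply _ hx ht).symm)
    (fun x hx => by rw [d2, hJ]; exact (ext_apply _ hx ht).symm)
  have hsum := (hb.energy_le t ht).trans hb.energy_init_le
  rw [Finset.sum_range_succ, Finset.sum_range_succ, Finset.sum_range_one] at hsum
  have hint := (add_le_add (add_le_add e0 e1) e2).trans hsum
  rw [← lintegral_add_left c0.measurable.ennreal_ofReal,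
    ← lintegral_add_right _ c2.measurable.ennreal_ofReal] at hint
  simp only [← ENNReal.ofReal_add (g0 _ _ _) (g0 _ _ _),
    ← ENNReal.ofReal_add (add_nonneg (g0 _ _ _) (g0 _ _ _)) (g0 _ _ _)] at hint
  have hfin := integral_le_of_lintegral_Ioi_le (by fun_prop) (fun x => by
    have := g0 J.u J.q x
    have := g0 J.ut J.qt x
    have := g0 J.utt J.qtt x
    positivity) (by positivity) hint hX
  have cD : Continuous fun x => J.energyDensity x t := by unfold Jet.energyDensity; fun_prop
  rw [← hJ, ← hM]
  refine (integral_mono_of_le cD (g := fun x => 2 * (1 + M) * (g J.u J.q x + g J.ut J.qt x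
    + g J.utt J.qtt x)) (by fun_prop) hX fun x _ => ?_).trans ?_
  · have hsx := hs x
    have hp := (J.s_pos x t).le
    have k : ∀ a b : ℝ, a ^ 2 + b ^ 2 ≤ (1 + M) * (a ^ 2 + J.s x t * b ^ 2) := fun a b => by
      have h1 := mul_le_mul_of_nonneg_right hsx (sq_nonneg b)
      have h2 := mul_nonneg hM0 (sq_nonneg a)
      have h3 := mul_nonneg hp (sq_nonneg b)
      linarith
    have k0 := k (J.u x t) (J.q x t)
    have k1 := k (J.ut x t) (J.qt x t)
    have k2 := k (J.utt x t) (J.qtt x t)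
    simp only [hg, Jet.energyDensity]
    linarith
  · rw [intervalIntegral.integral_const_mul]
    have := mul_le_mul_of_nonneg_left hfin (by positivity : 0 ≤ 2 * (1 + M))
    linarith

theorem Jet.ofFlow_energyBound (hb : Bootstrap P T B ε u q R) (hB : 0 < B) (hε : 0 < ε)
    (hε1 : ε ≤ 1) : (Jet.ofFlow h hv hw hq hT).EnergyBound (P.bound B) ε := by
  have hCa := P.Ca_pos
  have hγ := P.one_lt_γ
  have hR := P.Rbar_pos
  have p1 : (0 : ℝ) < 2 ^ P.γ := by positivity
  have p2 : 0 < 2 ^ (P.γ + 1) / (P.Ca * P.γ / 2) := by positivity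
  have p3 : 0 < P.Ca * P.γ / 2 * 2 ^ (P.γ + 1) := by positivity
  have p4 : 0 < 8 * B * (1 + 2 ^ (P.γ + 1) / (P.Ca * P.γ / 2)) := by positivity
  have hK : 2 ≤ P.bound B := by unfold Params.bound; linarith
  have hrad : ∀ {x t : ℝ}, 0 ≤ x → t ∈ Icc 0 T →
      (Jet.ofFlow h hv hw hq hT).r x t = rad q R x t := fun hx ht => ext_apply (rad q R) hx ht
  refine ⟨by linarith, hε, hε1, ?_, fun x hx t ht => ?_, fun x hx t ht => ?_, fun x hx t ht => ?_,
    fun x hx t ht => ?_, fun t ht X hX => ?_⟩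
  · change P.γ + 1 ≤ _
    unfold Params.bound
    linarith
  · rw [hrad hx ht]
    exact wt_le_mul_rad h hb hK (by unfold Params.bound; linarith) hx ht
  · rw [hrad hx ht]
    exact rad_le_mul_wt h hb hK (by unfold Params.bound; linarith) hx ht
  · refine ((Jet.ofFlow h hv hw hq hT).s_mem x t).2.trans
      (mul_le_mul_of_nonneg_right ?_ (Jet.s_pos _ x t).le)
    change 2 ^ (P.γ + 1) / (P.Ca * P.γ / 2) ≤ _
    unfold Params.bound
    linarith
  · refine ((Jet.ofFlow h hv hw hq hT).s_mem x t).1.trans ?_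
    change P.Ca * P.γ / 2 * 2 ^ (P.γ + 1) ≤ _
    unfold Params.bound
    linarith
  · refine (Jet.ofFlow_energyDensity_le h hv hw hq hT hb hB ht hX).trans
      (mul_le_mul_of_nonneg_right ?_ (sq_nonneg ε))
    unfold Params.bound
    linarith

end

end OfFlow

/-! ### Monotonicity in the constants and passage to the final time -/

namespace Jet

variable {J : Jet} {K K' ε S A : ℝ}

theorem EnergyBound.mono (hb : J.EnergyBound K ε) (hK : K ≤ K') : J.EnergyBound K' ε where
  one_le := hb.one_le.trans hK
  ε_pos := hb.ε_pos
  ε_le_one := hb.ε_le_one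
  γ_le := hb.γ_le.trans hK
  wt_le x hx t ht := (hb.wt_le x hx t ht).trans
    (mul_le_mul_of_nonneg_right hK (J.r_pos x t).le)
  r_le x hx t ht := (hb.r_le x hx t ht).trans (mul_le_mul_of_nonneg_right hK (wt_pos x).le)
  one_le_s x hx t ht := (hb.one_le_s x hx t ht).trans
    (mul_le_mul_of_nonneg_right hK (J.s_pos x t).le)
  s_le x hx t ht := (hb.s_le x hx t ht).trans hK
  energy_le t ht X hX := (hb.energy_le t ht X hX).trans
    (mul_le_mul_of_nonneg_right hK (sq_nonneg ε))

theorem PointBound.mono (hb : J.PointBound K ε) (hε : 0 < ε) (hK : K ≤ K') :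
    J.PointBound K' ε := by
  have hw : ∀ x, 0 ≤ ε / wt x := fun x => div_nonneg hε.le (wt_pos x).le
  exact ⟨fun x hx t ht => (hb.abs_u x hx t ht).trans (mul_le_mul_of_nonneg_right hK (hw x)),
    fun x hx t ht => (hb.abs_ut x hx t ht).trans (mul_le_mul_of_nonneg_right hK (hw x)),
    fun x hx t ht => (hb.abs_q x hx t ht).trans (mul_le_mul_of_nonneg_right hK (hw x)),
    fun x hx t ht => (hb.abs_qt x hx t ht).trans (mul_le_mul_of_nonneg_right hK (hw x))⟩

theorem continuous_kssInt (J : Jet) (X : ℝ) : Continuous fun T' => J.kssInt X T' := by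
  have cd0 := J.continuous_D₀
  have cd1 := J.continuous_D₁
  have cd2 := J.continuous_D₂
  have l0 := continuous_snd_slice J.continuous_E₀ 0
  have l1 := continuous_snd_slice J.continuous_E₁ 0
  have l2 := continuous_snd_slice J.continuous_E₂ 0
  have c1 := continuous_integral (f := fun x t => (wt x)⁻¹ * (J.D₀ x t + J.D₁ x t + J.D₂ x t))
    (by fun_prop (disch := intro z; exact wt_ne _)) 0 X
  have c2 : Continuous fun t => J.E₀ 0 t + J.E₁ 0 t + J.E₂ 0 t := by fun_prop
  exact (intervalIntegral.continuous_primitive (fun a b => c1.intervalIntegrable a b) 0).add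
    (intervalIntegral.continuous_primitive (fun a b => c2.intervalIntegrable a b) 0)

/-- Removes the restriction `T' < T` that the difference quotients imposed. -/
theorem kssInt_le_of_lt {X : ℝ} (h : ∀ T', 0 ≤ T' → T' < J.T → J.kssInt X T' ≤ A) :
    J.kssInt X J.T ≤ A := by
  refine le_of_tendsto (((J.continuous_kssInt X).tendsto J.T).mono_left
    (nhdsWithin_le_nhds (s := Iio J.T))) ?_
  filter_upwards [Ioo_mem_nhdsLT J.T_pos] with T' hT' using h T' hT'.1.le hT'.2

section

variable (h : ∀ X, 0 ≤ X → J.kssInt X J.T ≤ A)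
include h

theorem iint_le_of_kssInt_le {f : ℝ → ℝ → ℝ} (cf : Continuous fun z : ℝ × ℝ => f z.1 z.2)
    (hf : ∀ x, 0 ≤ x → ∀ t ∈ Icc 0 J.T, f x t ≤ (wt x)⁻¹ * (J.D₀ x t + J.D₁ x t + J.D₂ x t))
    {X : ℝ} (hX : 0 ≤ X) : iint X J.T f ≤ A := by
  have cd0 := J.continuous_D₀
  have cd1 := J.continuous_D₁
  have cd2 := J.continuous_D₂
  refine le_trans ?_ (h X hX)
  refine le_trans (iint_mono (g := fun x t => (wt x)⁻¹ * (J.D₀ x t + J.D₁ x t + J.D₂ x t)) cf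
    (by fun_prop (disch := intro z; exact wt_ne _)) hX J.T_pos.le fun x hx t ht =>
      hf x hx.1 t ht) (le_add_of_nonneg_right ?_)
  refine intervalIntegral.integral_nonneg J.T_pos.le fun t _ => ?_
  have n0 : 0 ≤ J.E₀ 0 t := mulDensity_nonneg 0 t
  have n1 : 0 ≤ J.E₁ 0 t := mulDensity_nonneg 0 t
  have n2 : 0 ≤ J.E₂ 0 t := mulDensity_nonneg 0 t
  positivity

theorem integral_le_of_kssInt_le {f : ℝ → ℝ} (cf : Continuous f)
    (hf : ∀ t, f t ≤ J.E₀ 0 t + J.E₁ 0 t + J.E₂ 0 t) : ∫ t in (0 : ℝ)..J.T, f t ≤ A := by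
  have l0 := continuous_snd_slice J.continuous_E₀ 0
  have l1 := continuous_snd_slice J.continuous_E₁ 0
  have l2 := continuous_snd_slice J.continuous_E₂ 0
  refine le_trans ?_ (h 0 le_rfl)
  refine (integral_mono_of_le cf (g := fun t => J.E₀ 0 t + J.E₁ 0 t + J.E₂ 0 t) (by fun_prop)
    J.T_pos.le fun t _ => hf t).trans (le_add_of_nonneg_left ?_)
  simp [iint]

end

end Jet

/-! ### Return to the norms of the statement -/

section OfFlow

variable {P : Params} {T : ℝ} {u q : ℝ → ℝ → ℝ} {R : ℝ → ℝ} {φ : ℝ → ℝ → ℝ}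
  (h : IsEulerFlow P T u q R) (hv : IsVelocityPotential T u q R φ)
  (hw : SolvesWave P T q R φ)
  (hq : ∀ x, 0 ≤ x → ∀ t ∈ Icc 0 T, q x t ∈ Icc (-1 / 2 : ℝ) (1 / 2)) (hT : 0 < T)

section

variable {J : Jet} (hJ : J = Jet.ofFlow h hv hw hq hT) {j : ℕ} {v vt vx : ℝ → ℝ → ℝ}
  (ev : ∀ x, 0 ≤ x → ∀ t ∈ Icc 0 T, dt T j φ x t = v x t)
  (et : ∀ x, 0 ≤ x → ∀ t ∈ Icc 0 T, dt T (1 + j) φ x t = vt x t)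
  (ex : ∀ x, 0 ≤ x → ∀ t ∈ Icc 0 T, dx (dt T j φ) x t = vx x t)
include hJ et ex

theorem density_eq {x t : ℝ} (hx : 0 ≤ x) (ht : t ∈ Icc 0 T) :
    density P T q R φ j x t = J.waveDensity vt vx x t := by
  have hs := Jet.ofFlow_s h hv hw hq hT hx ht
  have hr : (Jet.ofFlow h hv hw hq hT).r x t = rad q R x t := ext_apply (rad q R) hx ht
  rw [density, flux, Jet.waveDensity, hJ, hs, hr, et x hx t ht, ex x hx t ht]
  ring

theorem lintegral_density_eq {t : ℝ} (ht : t ∈ Icc 0 T) :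
    ∫⁻ x in Ioi (0 : ℝ), ENNReal.ofReal (density P T q R φ j x t)
      = ∫⁻ x in Ioi (0 : ℝ), ENNReal.ofReal (J.waveDensity vt vx x t) :=
  setLIntegral_congr_fun measurableSet_Ioi fun x hx => by
    simp only [density_eq h hv hw hq hT hJ et ex (le_of_lt (mem_Ioi.1 hx)) ht]

theorem supEnergy_le (cvt : Continuous fun z : ℝ × ℝ => vt z.1 z.2)
    (cvx : Continuous fun z : ℝ × ℝ => vx z.1 z.2) {S : ℝ}
    (hS : ∀ t ∈ Icc 0 T, ∀ X, 0 ≤ X → ∫ x in (0 : ℝ)..X, J.waveDensity vt vx x t ≤ S) :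
    supEnergy P T q R φ j ≤ ENNReal.ofReal S := by
  refine iSup₂_le fun t ht => ?_
  rw [lintegral_density_eq h hv hw hq hT hJ et ex ht]
  exact lintegral_Ioi_le (continuous_fst_slice (Jet.continuous_waveDensity cvt cvx) t)
    (fun x => Jet.waveDensity_nonneg x t) (hS t ht)

theorem integral_waveDensity_le (cvt : Continuous fun z : ℝ × ℝ => vt z.1 z.2)
    (cvx : Continuous fun z : ℝ × ℝ => vx z.1 z.2) {S : ℝ} (hS0 : 0 ≤ S)
    (hS : supEnergy P T q R φ j ≤ ENNReal.ofReal S) {t X : ℝ} (ht : t ∈ Icc 0 T) (hX : 0 ≤ X) :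
    ∫ x in (0 : ℝ)..X, J.waveDensity vt vx x t ≤ S := by
  refine integral_le_of_lintegral_Ioi_le
    (continuous_fst_slice (Jet.continuous_waveDensity cvt cvx) t)
    (fun x => Jet.waveDensity_nonneg x t) hS0 ?_ hX
  rw [← lintegral_density_eq h hv hw hq hT hJ et ex ht]
  exact (le_iSup₂ (f := fun t (_ : t ∈ Icc 0 T) =>
    ∫⁻ x in Ioi (0 : ℝ), ENNReal.ofReal (density P T q R φ j x t)) t ht).trans hS

include ev

/-- The wave density is at most `K` times the full density, and each of the other three terms is
part of a quantity bounded by `A`; this accounts for `K + 3`. In the last trace, `c r² v_x + c v /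
(ρ r)` is the sound speed times the radial derivative. -/
theorem kssNorm_le {K ε A : ℝ} (hb : J.EnergyBound K ε)
    (cv : Continuous fun z : ℝ × ℝ => v z.1 z.2) (cvt : Continuous fun z : ℝ × ℝ => vt z.1 z.2)
    (cvx : Continuous fun z : ℝ × ℝ => vx z.1 z.2) (hA : 0 ≤ A)
    (h1 : ∀ X, 0 ≤ X → iint X T (fun x t => (wt x)⁻¹ * J.fullDensity v vt vx x t) ≤ A)
    (h2 : ∫ t in (0 : ℝ)..T, J.mulDensity v vt vx 0 t ≤ A) :
    kssNorm P T q R φ j ≤ ENNReal.ofReal ((K + 3) * A) := by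
  have hK := hb.K_nonneg
  have hJT : J.T = T := by rw [hJ]; rfl
  have cw := Jet.continuous_waveDensity (J := J) cvt cvx
  have cf := Jet.continuous_fullDensity (J := J) cv cvt cvx
  have cm := continuous_snd_slice (Jet.continuous_mulDensity (J := J) cv cvt cvx) 0
  have hw0 : ∀ x, 0 ≤ (wt x)⁻¹ := fun x => (inv_pos.2 (wt_pos x)).le
  have i1 : ∫⁻ t in Icc 0 T, ∫⁻ x in Ioi (0 : ℝ),
      ENNReal.ofReal ((xi x)⁻¹ * density P T q R φ j x t) ≤ ENNReal.ofReal (K * A) := by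
    refine le_trans (le_of_eq ?_) (lintegral_lintegral_Ioi_le
      (f := fun x t => (wt x)⁻¹ * J.waveDensity vt vx x t)
      (by fun_prop (disch := intro z; exact wt_ne _))
      (fun x t => mul_nonneg (hw0 x) (Jet.waveDensity_nonneg x t)) hT.le fun X hX => ?_)
    · refine setLIntegral_congr_fun measurableSet_Icc fun t ht => ?_
      refine setLIntegral_congr_fun measurableSet_Ioi fun x hx => ?_
      have hx : 0 ≤ x := le_of_lt (mem_Ioi.1 hx)
      simp only [density_eq h hv hw hq hT hJ et ex hx ht, wt_of_nonneg hx]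
    · refine (iint_mono (g := fun x t => K * ((wt x)⁻¹ * J.fullDensity v vt vx x t))
        (by fun_prop (disch := intro z; exact wt_ne _))
        (by fun_prop (disch := intro z; exact wt_ne _)) hX hT.le fun x hx t ht => ?_).trans ?_
      · rw [mul_left_comm]
        exact mul_le_mul_of_nonneg_left (hb.waveDensity_le hx.1 (by rwa [hJT])) (hw0 x)
      · rw [iint_const_mul]
        exact mul_le_mul_of_nonneg_left (h1 X hX) hK
  have i2 : ∫⁻ t in Icc 0 T, ∫⁻ x in Ioi (0 : ℝ),
      ENNReal.ofReal ((xi x ^ 3)⁻¹ * dt T j φ x t ^ 2) ≤ ENNReal.ofReal A := by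
    refine le_trans (le_of_eq ?_) (lintegral_lintegral_Ioi_le
      (f := fun x t => (wt x ^ 3)⁻¹ * v x t ^ 2)
      (by fun_prop (disch := intro z; exact pow_ne_zero _ (wt_ne _)))
      (fun x t => mul_nonneg (inv_pos.2 (pow_pos (wt_pos x) 3)).le (sq_nonneg _)) hT.le
      fun X hX => ?_)
    · refine setLIntegral_congr_fun measurableSet_Icc fun t ht => ?_
      refine setLIntegral_congr_fun measurableSet_Ioi fun x hx => ?_
      have hx : 0 ≤ x := le_of_lt (mem_Ioi.1 hx)
      simp only [ev x hx t ht, wt_of_nonneg hx]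
    · refine (iint_mono (g := fun x t => (wt x)⁻¹ * J.fullDensity v vt vx x t)
        (by fun_prop (disch := intro z; exact pow_ne_zero _ (wt_ne _)))
        (by fun_prop (disch := intro z; exact wt_ne _)) hX hT.le fun x hx t ht => ?_).trans
        (h1 X hX)
      have hx := wt_ne x
      have e : (wt x ^ 3)⁻¹ * v x t ^ 2 = (wt x)⁻¹ * (v x t / wt x) ^ 2 := by field_simp
      rw [e]
      refine mul_le_mul_of_nonneg_left ?_ (hw0 x)
      unfold Jet.fullDensity
      nlinarith [sq_nonneg (vt x t), sq_nonneg (J.r x t ^ 2 * vx x t)]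
  have i3 : ∫⁻ t in Icc 0 T, ENNReal.ofReal (dt T (1 + j) φ 0 t ^ 2) ≤ ENNReal.ofReal A := by
    have l := continuous_snd_slice cvt 0
    calc ∫⁻ t in Icc 0 T, ENNReal.ofReal (dt T (1 + j) φ 0 t ^ 2)
        = ∫⁻ t in Icc 0 T, ENNReal.ofReal (vt 0 t ^ 2) :=
          setLIntegral_congr_fun measurableSet_Icc fun t ht => by
            simp only [et 0 le_rfl t ht]
      _ = ENNReal.ofReal (∫ t in (0 : ℝ)..T, vt 0 t ^ 2) :=
          lintegral_Icc_eq (by fun_prop) (fun t => sq_nonneg _) hT.le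
      _ ≤ ENNReal.ofReal A := ENNReal.ofReal_le_ofReal (le_trans
          (integral_mono_of_le (by fun_prop) cm hT.le fun t _ =>
            Jet.vt_sq_le_mulDensity v vt vx 0 t) h2)
  have i4 : ∫⁻ t in Icc 0 T, ENNReal.ofReal ((flux P T q R φ j 0 t
      + P.c q 0 t / (rho q 0 t * rad q R 0 t) * dt T j φ 0 t) ^ 2) ≤ ENNReal.ofReal A := by
    have cZ := continuous_snd_slice (Jet.continuous_radial' (J := J) cv cvx) 0
    calc ∫⁻ t in Icc 0 T, ENNReal.ofReal ((flux P T q R φ j 0 t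
          + P.c q 0 t / (rho q 0 t * rad q R 0 t) * dt T j φ 0 t) ^ 2)
        = ∫⁻ t in Icc 0 T, ENNReal.ofReal (J.s 0 t * J.radial v vx 0 t ^ 2) :=
          setLIntegral_congr_fun measurableSet_Icc fun t ht => by
            have hs := Jet.ofFlow_s h hv hw hq hT le_rfl ht
            have hr : (Jet.ofFlow h hv hw hq hT).r 0 t = rad q R 0 t :=
              ext_apply (rad q R) le_rfl ht
            have hq' : (Jet.ofFlow h hv hw hq hT).q 0 t = q 0 t := ext_apply q le_rfl ht
            have hq0 : 1 + q 0 t ≠ 0 := by linarith [(hq 0 le_rfl t ht).1]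
            have hr0 := (h.rad_pos hq le_rfl ht).ne'
            simp only [flux, ev 0 le_rfl t ht, ex 0 le_rfl t ht, hJ, hs, Jet.radial, hr, hq', rho]
            congr 1
            field_simp
      _ = ENNReal.ofReal (∫ t in (0 : ℝ)..T, J.s 0 t * J.radial v vx 0 t ^ 2) :=
          lintegral_Icc_eq (by fun_prop) (fun t => mul_nonneg (J.s_pos 0 t).le (sq_nonneg _)) hT.le
      _ ≤ ENNReal.ofReal A := ENNReal.ofReal_le_ofReal (le_trans
          (integral_mono_of_le (by fun_prop) cm hT.le fun t _ => by
            unfold Jet.mulDensity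
            nlinarith [sq_nonneg (vt 0 t)]) h2)
  refine (add_le_add (add_le_add (add_le_add i1 i2) i3) i4).trans_eq ?_
  rw [← ENNReal.ofReal_add (by positivity) hA, ← ENNReal.ofReal_add (by positivity) hA,
    ← ENNReal.ofReal_add (by positivity) hA]
  ring_nf

end

end OfFlow

/-! ### Smallness of the logarithm -/

/-- For `T ≤ 2` the logarithm is at most `1 + T ≤ 3`; for `T > 2` one has `2 + T ≤ T²`. -/
theorem one_add_log_le {T : ℝ} (hT : 0 < T) :
    1 + Real.log (1 + (1 + T)) ≤ 4 * max (Real.logb 2 T) 1 := by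
  have h1 := le_max_right (Real.logb 2 T) 1
  by_cases h : T ≤ 2
  · have := Real.log_le_sub_one_of_pos (by linarith : 0 < 1 + (1 + T))
    linarith
  · push Not at h
    have h2 : Real.log (1 + (1 + T)) ≤ Real.log (T ^ 2) :=
      Real.log_le_log (by linarith) (by nlinarith)
    rw [Real.log_pow] at h2
    have h3 : Real.log T ≤ Real.logb 2 T := by
      rw [Real.logb, le_div_iff₀ (Real.log_pos one_lt_two)]
      have h4 := Real.log_le_sub_one_of_pos (zero_lt_two (α := ℝ))
      have h5 := Real.log_nonneg (by linarith : 1 ≤ T)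
      nlinarith
    have h6 := le_max_left (Real.logb 2 T) 1
    push_cast at h2
    linarith

/-- A lower bound on `cbar` turns the assumed bound on `1 + cbar T` into `2 + T ≤ 2 K³ exp (κ/ε)`.
After taking logarithms, `ε` times the weight is at most `ε (1 + log (2 K³)) + κ`. -/
theorem mul_one_add_log_le {K T ε κ δ cbar : ℝ} (hK : 1 ≤ K) (hT : 0 < T) (hε : 0 < ε)
    (hc : (K ^ 3)⁻¹ ≤ cbar) (hexp : 1 + cbar * T ≤ Real.exp (κ / ε)) (hκ : κ ≤ δ / 2)
    (hεδ : ε * (1 + Real.log (2 * K ^ 3)) ≤ δ / 2) : ε * (1 + Real.log (1 + (1 + T))) ≤ δ := by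
  have hK3 : 1 ≤ K ^ 3 := one_le_pow₀ hK
  have h1 : 1 + (1 + T) ≤ 2 * K ^ 3 * Real.exp (κ / ε) := by
    have h2 : (K ^ 3)⁻¹ * T ≤ cbar * T := by gcongr
    have h3 : 2 * K ^ 3 * (1 + (K ^ 3)⁻¹ * T) ≤ 2 * K ^ 3 * Real.exp (κ / ε) := by
      gcongr
      linarith
    have h4 : 2 * K ^ 3 * (1 + (K ^ 3)⁻¹ * T) = 2 * K ^ 3 + 2 * T := by field_simp
    linarith
  have h2 := Real.log_le_log (by linarith) h1
  rw [Real.log_mul (by positivity) (Real.exp_pos _).ne', Real.log_exp] at h2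
  have h3 := mul_le_mul_of_nonneg_left h2 hε.le
  rw [mul_add, mul_div_cancel₀ _ hε.ne'] at h3
  linarith

/-- Any upper bound `cbar` dominates the value at the origin, which is bounded below by the
comparison of `r` with `ξ` and of `c` with `1`. -/
theorem le_sound_speed {P : Params} {T K ε : ℝ} {u q : ℝ → ℝ → ℝ} {R : ℝ → ℝ}
    {φ : ℝ → ℝ → ℝ} (h : IsEulerFlow P T u q R) (hv : IsVelocityPotential T u q R φ)
    (hw : SolvesWave P T q R φ)
    (hq : ∀ x, 0 ≤ x → ∀ t ∈ Icc 0 T, q x t ∈ Icc (-1 / 2 : ℝ) (1 / 2)) (hT : 0 < T)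
    (hb : (Jet.ofFlow h hv hw hq hT).EnergyBound K ε) :
    (K ^ 3)⁻¹ ≤ P.c q 0 0 * rad q R 0 0 ^ 2 / xi 0 ^ 2 := by
  have h0 : (0 : ℝ) ∈ Icc 0 T := ⟨le_rfl, hT.le⟩
  have hK := hb.one_le
  have hK0 : 0 < K := zero_lt_one.trans_le hK
  have h1 := hb.one_le_s 0 le_rfl 0 h0
  rw [Jet.ofFlow_s h hv hw hq hT le_rfl h0] at h1
  have h2 := hb.wt_le 0 le_rfl 0 h0
  have hr : (Jet.ofFlow h hv hw hq hT).r 0 0 = rad q R 0 0 := ext_apply (rad q R) le_rfl h0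
  rw [hr, wt_zero] at h2
  have hx : xi 0 = 1 := by rw [← wt_of_nonneg le_rfl, wt_zero]
  have h3 : 1 ≤ K * P.c q 0 0 := by
    have hc : 0 ≤ P.c q 0 0 := Real.sqrt_nonneg _
    refine le_of_pow_le_pow_left₀ two_ne_zero (by positivity) ?_
    have := mul_le_mul_of_nonneg_right hK (by positivity : 0 ≤ K * P.c q 0 0 ^ 2)
    rw [one_pow, mul_pow]
    linarith
  have h4 := one_le_mul_of_one_le_of_one_le h3 (one_le_pow₀ h2 (n := 2))
  rw [hx, one_pow, div_one, inv_le_iff_one_le_mul₀ (by positivity)]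
  linarith

/-- The constants depend on `K` alone. The energy on the right-hand side is first shown to be
finite, and its real value is then used as the wave bound in the estimate. -/
theorem exists_kssNorm_le (K : ℝ) : ∃ C δ, 0 ≤ C ∧ 0 < δ ∧ ∀ (P : Params) (T ε : ℝ)
    (u q : ℝ → ℝ → ℝ) (R : ℝ → ℝ) (φ : ℝ → ℝ → ℝ) (h : IsEulerFlow P T u q R)
    (hv : IsVelocityPotential T u q R φ) (hw : SolvesWave P T q R φ)
    (hq : ∀ x, 0 ≤ x → ∀ t ∈ Icc 0 T, q x t ∈ Icc (-1 / 2 : ℝ) (1 / 2)) (hT : 0 < T),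
    (Jet.ofFlow h hv hw hq hT).Bound K ε → ε * (1 + Real.log (1 + (1 + T))) ≤ δ →
    ∑ j ∈ Finset.range 3, kssNorm P T q R φ j ≤ ENNReal.ofReal C * kssBound P T q R φ
      ∧ kssBound P T q R φ < ⊤ := by
  obtain ⟨C, δ, hC, hδ, hkss⟩ := Jet.exists_kss K
  obtain ⟨CW, hCW⟩ := Jet.exists_waveBound K
  by_cases hK : 0 ≤ K
  swap
  · exact ⟨0, 1, le_rfl, one_pos, fun P T ε u q R φ h hv hw hq hT hb => absurd hb.K_nonneg hK⟩
  -- Three levels, the factor of `kssNorm_le`, the constant of the space-time estimate, and `4` for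
  -- comparing the weight with `max (log₂ T) 1`.
  refine ⟨3 * ((K + 3) * (C * 4)), δ, by positivity, hδ, ?_⟩
  intro P T ε u q R φ h hv hw hq hT hb hεδ
  obtain ⟨J, hJ⟩ : ∃ J, J = Jet.ofFlow h hv hw hq hT := ⟨_, rfl⟩
  rw [← hJ] at hb
  have hJT : J.T = T := by rw [hJ]; rfl
  have d2 : ∀ g : ℝ → ℝ → ℝ, dt T 2 g = dt T 1 (dt T 1 g) := fun g => dt_succ 1 g
  have d3 : ∀ g : ℝ → ℝ → ℝ, dt T 3 g = dt T 1 (dt T 1 (dt T 1 g)) := fun g => by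
    rw [← d2 g]; exact dt_succ 2 g
  have v0 : ∀ x, 0 ≤ x → ∀ t ∈ Icc 0 T, dt T 0 φ x t = J.φ x t := fun x hx t ht => by
    rw [dt_zero, hJ]; exact (ext_apply φ hx ht).symm
  have v1 : ∀ x, 0 ≤ x → ∀ t ∈ Icc 0 T, dt T 1 φ x t = J.φt x t := fun x hx t ht => by
    rw [hJ]; exact (ext_apply _ hx ht).symm
  have v2 : ∀ x, 0 ≤ x → ∀ t ∈ Icc 0 T, dt T 2 φ x t = J.φtt x t := fun x hx t ht => by
    rw [d2, hJ]; exact (ext_apply _ hx ht).symm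
  have v3 : ∀ x, 0 ≤ x → ∀ t ∈ Icc 0 T, dt T 3 φ x t = J.φttt x t := fun x hx t ht => by
    rw [d3, hJ]; exact (ext_apply _ hx ht).symm
  have x0 : ∀ x, 0 ≤ x → ∀ t ∈ Icc 0 T, dx (dt T 0 φ) x t = J.φx x t := fun x hx t ht => by
    rw [dt_zero, hJ]; exact (ext_apply (dx φ) hx ht).symm
  have x1 : ∀ x, 0 ≤ x → ∀ t ∈ Icc 0 T, dx (dt T 1 φ) x t = J.φtx x t := fun x hx t ht => by
    rw [hJ]; exact (ext_apply _ hx ht).symm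
  have x2 : ∀ x, 0 ≤ x → ∀ t ∈ Icc 0 T, dx (dt T 2 φ) x t = J.φttx x t := fun x hx t ht => by
    rw [d2, hJ]; exact (ext_apply _ hx ht).symm
  have hφ : ∀ t ∈ Icc 0 J.T, Tendsto (fun x => J.φ x t) atTop (𝓝 0) := fun t ht => by
    rw [hJT] at ht
    refine (hv.tendsto_zero t ht).congr' ?_
    filter_upwards [eventually_ge_atTop 0] with x hx
    rw [← v0 x hx t ht, dt_zero]
  -- This bound in terms of `ε` serves only to prove finiteness; the estimate itself uses the actual
  -- supremum `S`.
  have hWB := hCW J ε hb hφ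
  have fin : ∀ j ∈ Finset.range 3, supEnergy P T q R φ j ≠ ⊤ := by
    intro j hj
    refine ne_top_of_le_ne_top ENNReal.ofReal_ne_top (b := ENNReal.ofReal (CW * ε ^ 2)) ?_
    have h3 := Finset.mem_range.1 hj
    interval_cases j
    · exact supEnergy_le h hv hw hq hT hJ v1 x0 J.cont_φt J.cont_φx (hJT ▸ hWB.left)
    · exact supEnergy_le h hv hw hq hT hJ v2 x1 J.cont_φtt J.cont_φtx (hJT ▸ hWB.mid)
    · exact supEnergy_le h hv hw hq hT hJ v3 x2 J.cont_φttt J.cont_φttx (hJT ▸ hWB.right)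
  have hfin : ∑ j ∈ Finset.range 3, supEnergy P T q R φ j ≠ ⊤ := ENNReal.sum_ne_top.2 fin
  obtain ⟨S, hS⟩ : ∃ S, S = (∑ j ∈ Finset.range 3, supEnergy P T q R φ j).toReal := ⟨_, rfl⟩
  have hS0 : 0 ≤ S := by rw [hS]; exact ENNReal.toReal_nonneg
  have hSe : ENNReal.ofReal S = ∑ j ∈ Finset.range 3, supEnergy P T q R φ j := by
    rw [hS, ENNReal.ofReal_toReal hfin]
  have hle : ∀ j ∈ Finset.range 3, supEnergy P T q R φ j ≤ ENNReal.ofReal S := fun j hj => by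
    rw [hSe]; exact Finset.single_le_sum (fun _ _ => zero_le) hj
  have hWS : J.WaveBound S := by
    constructor
    · rw [hJT]
      exact fun t ht X hX => integral_waveDensity_le h hv hw hq hT hJ v1 x0 J.cont_φt J.cont_φx hS0
        (hle 0 (by decide)) ht hX
    · rw [hJT]
      exact fun t ht X hX => integral_waveDensity_le h hv hw hq hT hJ v2 x1 J.cont_φtt J.cont_φtx
        hS0 (hle 1 (by decide)) ht hX
    · rw [hJT]
      exact fun t ht X hX => integral_waveDensity_le h hv hw hq hT hJ v3 x2 J.cont_φttt J.cont_φttx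
        hS0 (hle 2 (by decide)) ht hX
  obtain ⟨b, hb0⟩ : ∃ b, b = ∫ t in (0 : ℝ)..T, J.φ 0 t ^ 2 := ⟨_, rfl⟩
  have cb := continuous_snd_slice J.cont_φ 0
  have hbn : 0 ≤ b := by
    rw [hb0]
    exact intervalIntegral.integral_nonneg hT.le fun t _ => sq_nonneg _
  have hbe : ∫⁻ t in Icc 0 T, ENNReal.ofReal (φ 0 t ^ 2) = ENNReal.ofReal b := by
    rw [hb0, ← lintegral_Icc_eq (by fun_prop) (fun t => sq_nonneg _) hT.le]
    refine setLIntegral_congr_fun measurableSet_Icc fun t ht => ?_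
    simp only [← v0 0 le_rfl t ht, dt_zero]
  have hG : J.weightSup = 1 + Real.log (1 + (1 + T)) := by rw [Jet.weightSup, hJT]
  have hGp := J.one_le_weightSup
  obtain ⟨A, hA⟩ : ∃ A, A = C * (J.weightSup * S + b) := ⟨_, rfl⟩
  have hA0 : 0 ≤ A := by rw [hA]; positivity
  have hk : ∀ X, 0 ≤ X → J.kssInt X J.T ≤ A := fun X hX => J.kssInt_le_of_lt fun T' h0 h1 => by
    have := hkss J ε S hb (by rwa [hG]) hWS hφ X T' hX h0 h1
    rwa [hJT, ← hb0, ← hA] at this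
  have dn : ∀ x t, 0 ≤ J.D₀ x t ∧ 0 ≤ J.D₁ x t ∧ 0 ≤ J.D₂ x t := fun x t =>
    ⟨Jet.fullDensity_nonneg _ _ _, Jet.fullDensity_nonneg _ _ _, Jet.fullDensity_nonneg _ _ _⟩
  have en : ∀ t, 0 ≤ J.E₀ 0 t ∧ 0 ≤ J.E₁ 0 t ∧ 0 ≤ J.E₂ 0 t := fun t =>
    ⟨Jet.mulDensity_nonneg 0 t, Jet.mulDensity_nonneg 0 t, Jet.mulDensity_nonneg 0 t⟩
  have iD : ∀ D : ℝ → ℝ → ℝ, (Continuous fun z : ℝ × ℝ => D z.1 z.2) →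
      (∀ x t, D x t ≤ J.D₀ x t + J.D₁ x t + J.D₂ x t) →
      ∀ X, 0 ≤ X → iint X T (fun x t => (wt x)⁻¹ * D x t) ≤ A := fun D cD hD X hX => by
    have := Jet.iint_le_of_kssInt_le hk (f := fun x t => (wt x)⁻¹ * D x t)
      (by fun_prop (disch := intro z; exact wt_ne _))
      (fun x _ t _ => mul_le_mul_of_nonneg_left (hD x t) (inv_pos.2 (wt_pos x)).le) hX
    rwa [hJT] at this
  have iE : ∀ E : ℝ → ℝ → ℝ, (Continuous fun z : ℝ × ℝ => E z.1 z.2) →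
      (∀ t, E 0 t ≤ J.E₀ 0 t + J.E₁ 0 t + J.E₂ 0 t) → ∫ t in (0 : ℝ)..T, E 0 t ≤ A :=
    fun E cE hE => by
      have := Jet.integral_le_of_kssInt_le hk (continuous_snd_slice cE 0) hE
      rwa [hJT] at this
  have he := hb.toEnergyBound
  have k0 := kssNorm_le h hv hw hq hT hJ v0 v1 x0 he J.cont_φ J.cont_φt J.cont_φx hA0
    (iD J.D₀ J.continuous_D₀ fun x t => by linarith [dn x t])
    (iE J.E₀ J.continuous_E₀ fun t => by linarith [en t])
  have k1 := kssNorm_le h hv hw hq hT hJ v1 v2 x1 he J.cont_φt J.cont_φtt J.cont_φtx hA0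
    (iD J.D₁ J.continuous_D₁ fun x t => by linarith [dn x t])
    (iE J.E₁ J.continuous_E₁ fun t => by linarith [en t])
  have k2 := kssNorm_le h hv hw hq hT hJ v2 v3 x2 he J.cont_φtt J.cont_φttt J.cont_φttx hA0
    (iD J.D₂ J.continuous_D₂ fun x t => by linarith [dn x t])
    (iE J.E₂ J.continuous_E₂ fun t => by linarith [en t])
  obtain ⟨m, hm⟩ : ∃ m, m = max (Real.logb 2 T) 1 := ⟨_, rfl⟩
  have hm1 : 1 ≤ m := by rw [hm]; exact le_max_right _ _
  have hGm : J.weightSup ≤ 4 * m := by rw [hG, hm]; exact one_add_log_le hT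
  have hbound : kssBound P T q R φ = ENNReal.ofReal (m * S + b) := by
    rw [kssBound, ← hSe, hbe, ← hm, ← ENNReal.ofReal_mul (by positivity),
      ← ENNReal.ofReal_add (by positivity) hbn]
  rw [hbound]
  refine ⟨?_, ENNReal.ofReal_lt_top⟩
  rw [Finset.sum_range_succ, Finset.sum_range_succ, Finset.sum_range_one]
  refine (add_le_add (add_le_add k0 k1) k2).trans ?_
  have hp : 0 ≤ (K + 3) * A := by positivity
  rw [← ENNReal.ofReal_add hp hp, ← ENNReal.ofReal_add (by positivity) hp,
    ← ENNReal.ofReal_mul (by positivity)]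
  refine ENNReal.ofReal_le_ofReal ?_
  have h1 : J.weightSup * S + b ≤ 4 * (m * S + b) := by
    have := mul_le_mul_of_nonneg_right hGm hS0
    linarith
  have h2 : (K + 3) * A ≤ (K + 3) * (C * (4 * (m * S + b))) := by
    rw [hA]
    gcongr
  linarith

end Bubble

end

theorem mainTheorem4 (P : Bubble.Params) (B : ℝ) (hB : 0 < B) :
    ∃ ε₀ κ₀ C : ℝ, 0 < ε₀ ∧ 0 < κ₀ ∧ 0 < C ∧
      ∀ (T ε cbar : ℝ) (u q : ℝ → ℝ → ℝ) (R : ℝ → ℝ) (φ : ℝ → ℝ → ℝ),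
        0 < T → 0 < ε → ε ≤ ε₀ →
        Bubble.IsEulerFlow P T u q R →
        Bubble.IsVelocityPotential T u q R φ →
        Bubble.SolvesWave P T q R φ →
        Bubble.Bootstrap P T B ε u q R →
        (∀ x ∈ Set.Ici (0 : ℝ), ∀ t ∈ Set.Icc 0 T,
          P.c q x t * Bubble.rad q R x t ^ 2 / Bubble.xi x ^ 2 ≤ cbar) →
        1 + cbar * T ≤ Real.exp (κ₀ / ε) →
        ∑ j ∈ Finset.range 3, Bubble.kssNorm P T q R φ j
            ≤ ENNReal.ofReal C * Bubble.kssBound P T q R φ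
          ∧ Bubble.kssBound P T q R φ < ⊤ := by
  obtain ⟨K', hK'⟩ := Bubble.Jet.exists_pointBound (P.bound B)
  obtain ⟨K, hK⟩ : ∃ K, K = max (max (P.bound B) K') 1 := ⟨_, rfl⟩
  have hK1 : 1 ≤ K := by rw [hK]; exact le_max_right _ _
  have hKB : P.bound B ≤ K := by rw [hK]; exact (le_max_left _ _).trans (le_max_left _ _)
  have hKK : K' ≤ K := by rw [hK]; exact (le_max_right _ _).trans (le_max_left _ _)
  obtain ⟨C, δ, hC, hδ, h⟩ := Bubble.exists_kssNorm_le K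
  have hL : 0 < 1 + Real.log (2 * K ^ 3) := by
    have : 1 ≤ K ^ 3 := one_le_pow₀ hK1
    have := Real.log_nonneg (by linarith : 1 ≤ 2 * K ^ 3)
    linarith
  -- The first entry of the minimum gives the subsonic condition `small` and `ε ≤ 1`. The second,
  -- together with `κ₀ = δ / 2`, makes `ε` times the logarithm at most `δ`. The summand in `C + 1`
  -- only ensures positivity.
  refine ⟨min (8 * K ^ 3)⁻¹ (δ / 2 / (1 + Real.log (2 * K ^ 3))), δ / 2, C + 1, ?_, by positivity,
    by positivity, ?_⟩
  · exact lt_min (by positivity) (by positivity)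
  intro T ε cbar u q R φ hT hε hε0 hf hv hw hb hc hexp
  have hε8 : 8 * K ^ 3 * ε ≤ 1 := by
    have := hε0.trans (min_le_left _ _)
    rwa [← one_div, le_div_iff₀' (by positivity)] at this
  have hεL := hε0.trans (min_le_right _ _)
  rw [le_div_iff₀ hL] at hεL
  have hε1 : ε ≤ 1 := by
    have : 1 ≤ K ^ 3 := one_le_pow₀ hK1
    nlinarith
  have hq := fun x hx t ht => hb.q_mem_Icc hf (x := x) hx (t := t) ht
  have he := Bubble.Jet.ofFlow_energyBound hf hv hw hq hT hb hB hε hε1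
  have heK := he.mono hKB
  have hbd : (Bubble.Jet.ofFlow hf hv hw hq hT).Bound K ε :=
    { toEnergyBound := heK
      toPointBound := (hK' _ ε he).mono hε hKK
      small := by
        have := mul_le_mul_of_nonneg_right hε8 hε.le
        nlinarith }
  have hc0 := (Bubble.le_sound_speed hf hv hw hq hT heK).trans
    (hc 0 (Set.mem_Ici.2 le_rfl) 0 ⟨le_rfl, hT.le⟩)
  have hlog := Bubble.mul_one_add_log_le hK1 hT hε hc0 hexp le_rfl hεL
  obtain ⟨h1, h2⟩ := h P T ε u q R φ hf hv hw hq hT hbd hlog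
  refine ⟨h1.trans ?_, h2⟩
  gcongr
  linarith
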